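/- Let $p$ be a prime, $r\ge 0$, $u\in \mathrm{GL}_r(\mathbb Z_p)$, and let $G_{\mathbb Q_p}=\mathrm{Gal}(\overline{\mathbb Q}_p/\mathbb Q_p)$. Let $W=\widehat{\mathbb Z_p^{\mathrm{nr}}}\subset\mathcal O_{\mathbb C_p}$ be the completion of the ring of integers of the maximal unramified extension of $\mathbb Q_p$, and let $\varphi\in G_{\mathbb Q_p}$ be a lift of the Frobenius automorphism of $\overline{\mathbb F}_p$ in its geometric normalization, i.e. $\varphi^{-1}$ induces $x\mapsto x^p$; $\varphi$ acts on $W$ by continuity, and for a tuple $\theta$ of power series over $W$ let $\theta^\varphi$ be the tuple obtained by applying $\varphi$ to the coefficients. An $r$-dimensional commutative formal group law $\mathcal F$ over $\mathbb Z_p$ is called a Lubin–Tate formal group with parameter $pu^{-1}$ if it has an endomorphism $d(X)\in\mathbb Z_p[[X_1,\dots,X_r]]^r$ with $d(X)\equiv pu^{-1}X$ modulo degree $2$ and $d(X)\equiv (X_1^p,\dots,X_r^p)$ modulo $p$. Let $\mathbb G_m^r$ be the formal multiplicative group, $X_i+Y_i+X_iY_i$; a matrix $A\in M_r(\mathbb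 Z_p)$ acts on it by the endomorphism with components $\prod_j(1+X_j)^{A_{ij}}-1$. Let $\rho=\rho_u^{\mathrm{nr}}\colon G_{\mathbb Q_p}\to \mathrm{GL}_r(\mathbb Z_p)$ denote the continuous homomorphism that is trivial on inertia and satisfies $\rho(\varphi)=u$, and let $T=\mathbb Z_p^r(1)(\rho)$ be $\mathbb Z_p^r$ with $g\in G_{\mathbb Q_p}$ acting by $\chi_{\mathrm{cyc}}(g)\rho(g)$. Let $T_p\mathcal F$ be the $p$-adic Tate module of $\mathcal F$: the sequences $(z_n)_{n\ge 0}$ of points with coordinates in the maximal ideal of $\mathcal O_{\mathbb C_p}$ such that $z_0=0$ and $[p]_{\mathcal F}(z_{n+1})=z_n$, with the coordinatewise action of $G_{\mathbb Q_p}$. Then a Lubin–Tate formal group with parameter $pu^{-1}$ and the representation $\rho$ exist, and for every Lubin–Tate formal group $\mathcal F$ with parameter $pu^{-1}$: 1. There are $\epsilon\in \mathrm{GL}_r(W)$ with $\varphi(\epsilon^{-1})\,\epsilon=u^{-1}$ and an isomorphism of formal groups $\theta\colon\mathcal F\to\mathbb G_m^r$ defined over $W$ with $$\theta(X)\equiv\epsilon^{-1}X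 \ \text{ modulo degree } 2,\qquad \theta^\varphi\circ\theta^{-1}=u^{-1}.$$ 2. Every isomorphism of formal groups $\theta\colon\mathcal F\to\mathbb G_m^r$ over $W$ with $\theta^\varphi\circ\theta^{-1}=u^{-1}$ induces an isomorphism of $p$-adic representations of $G_{\mathbb Q_p}$ (and hence, by restriction, of $G_K$ for every finite extension $K/\mathbb Q_p$) $$T=\mathbb Z_p^r(1)(\rho)\;\cong\;T_p\mathcal F .$$ More precisely, there are a compatible system $(\zeta_n)$ of primitive $p^n$-th roots of unity ($\zeta_{n+1}^p=\zeta_n$) and a $\mathbb Z_p$-linear $G_{\mathbb Q_p}$-equivariant isomorphism $e\colon T\to T_p\mathcal F$ with $\theta(e(a)_n)=(\zeta_n^{a_1}-1,\dots,\zeta_n^{a_r}-1)$ for all $a\in\mathbb Z_p^r$ and $n\ge0$. (In terms of the arithmetic Frobenius $\sigma=\varphi^{-1}$ the normalizations read $\theta^{\sigma}\circ\theta^{-1}=u$ and $\rho(\sigma)=u^{-1}$.) -/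

import Mathlib

open MvPowerSeries

noncomputable section

/-! ### Tate modules of commutative monoids -/

/-- The `p`-adic Tate module of a commutative monoid `M`: the sequences `(z_n)` in `M` with
`z_0 = 0` and `p z_{n+1} = z_n` (so that `z_n` is killed by `p ^ n`). -/
structure TateModule (p : ℕ) (M : Type*) [AddCommMonoid M] where
  val : ℕ → M
  val_zero : val 0 = 0
  nsmul_succ : ∀ n, p • val (n + 1) = val n

namespace TateModule

variable {p : ℕ} {M : Type*} [AddCommMonoid M]

@[ext] theorem ext {z w : TateModule p M} (h : ∀ n, z.val n = w.val n) : z = w := by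
  obtain ⟨z, _, _⟩ := z
  obtain ⟨w, _, _⟩ := w
  congr
  exact funext h

theorem pow_nsmul (z : TateModule p M) (n : ℕ) : p ^ n • z.val n = 0 := by
  induction n with
  | zero => simp [z.val_zero]
  | succ n ih => rw [pow_succ, mul_nsmul', z.nsmul_succ, ih]

theorem nsmul_congr (z : TateModule p M) {n k l : ℕ} (h : k ≡ l [MOD p ^ n]) :
    k • z.val n = l • z.val n := by
  have key : ∀ k : ℕ, k • z.val n = (k % p ^ n) • z.val n := fun k => by
    conv_lhs => rw [← Nat.mod_add_div k (p ^ n), add_nsmul, mul_nsmul, pow_nsmul, nsmul_zero,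
      add_zero]
  rw [key k, key l, h]

instance : Zero (TateModule p M) := ⟨⟨fun _ => 0, rfl, fun _ => nsmul_zero _⟩⟩

instance : Add (TateModule p M) :=
  ⟨fun z w => ⟨fun n => z.val n + w.val n, by simp [z.val_zero, w.val_zero],
    fun n => by rw [nsmul_add, z.nsmul_succ, w.nsmul_succ]⟩⟩

@[simp] theorem zero_apply (n : ℕ) : (0 : TateModule p M).val n = 0 := rfl

@[simp] theorem add_apply (z w : TateModule p M) (n : ℕ) : (z + w).val n = z.val n + w.val n := rfl

section

variable [Fact p.Prime]

/-- `a ∈ ℤ_p` acts on the `n`-th component, which is killed by `p ^ n`, as any natural number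
congruent to `a` modulo `p ^ n`. -/
instance : SMul ℤ_[p] (TateModule p M) :=
  ⟨fun a z => ⟨fun n => (a.toZModPow n).val • z.val n, by simp [z.val_zero], fun n => by
    rw [← mul_nsmul', mul_comm, mul_nsmul', z.nsmul_succ]
    apply z.nsmul_congr
    rw [← ZMod.natCast_eq_natCast_iff]
    have : NeZero (p ^ n) := ⟨pow_ne_zero _ (Fact.out : p.Prime).ne_zero⟩
    have : NeZero (p ^ (n + 1)) := ⟨pow_ne_zero _ (Fact.out : p.Prime).ne_zero⟩
    rw [ZMod.natCast_zmod_val, ZMod.natCast_val, PadicInt.cast_toZModPow _ _ n.le_succ]⟩⟩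

theorem smul_apply (a : ℤ_[p]) (z : TateModule p M) (n : ℕ) :
    (a • z).val n = (a.toZModPow n).val • z.val n := rfl

theorem smul_apply_eq {a : ℤ_[p]} (z : TateModule p M) {n k : ℕ}
    (h : (k : ZMod (p ^ n)) = a.toZModPow n) : (a • z).val n = k • z.val n := by
  have : NeZero (p ^ n) := ⟨pow_ne_zero _ (Fact.out : p.Prime).ne_zero⟩
  rw [smul_apply]
  apply z.nsmul_congr
  rw [← ZMod.natCast_eq_natCast_iff, h, ZMod.natCast_zmod_val]

theorem val_cast (a : ℤ_[p]) (n : ℕ) : ((a.toZModPow n).val : ZMod (p ^ n)) = a.toZModPow n := by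
  have : NeZero (p ^ n) := ⟨pow_ne_zero _ (Fact.out : p.Prime).ne_zero⟩
  exact ZMod.natCast_zmod_val _

instance : AddCommMonoid (TateModule p M) where
  add_assoc _ _ _ := ext fun _ => add_assoc _ _ _
  zero_add _ := ext fun _ => zero_add _
  add_zero _ := ext fun _ => add_zero _
  add_comm _ _ := ext fun _ => add_comm _ _
  nsmul := nsmulRec

instance : Module ℤ_[p] (TateModule p M) where
  one_smul z := ext fun n => by rw [smul_apply_eq z (k := 1) (by simp), one_nsmul]
  mul_smul a b z := ext fun n => by
    rw [smul_apply_eq z (k := (a.toZModPow n).val * (b.toZModPow n).val)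
      (by simp only [Nat.cast_mul, val_cast, map_mul]), smul_apply, smul_apply, mul_nsmul']
  smul_zero a := ext fun n => by simp [smul_apply]
  smul_add a z w := ext fun n => by simp [smul_apply]
  add_smul a b z := ext fun n => by
    rw [smul_apply_eq z (k := (a.toZModPow n).val + (b.toZModPow n).val)
      (by simp only [Nat.cast_add, val_cast, map_add]), add_apply, smul_apply, smul_apply,
      add_nsmul]
  zero_smul z := ext fun n => by simp [smul_apply]

instance : AddCommGroup (TateModule p M) := Module.addCommMonoidToAddCommGroup ℤ_[p]

end

/-- The map of Tate modules induced by a homomorphism. -/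
def map [Fact p.Prime] {N : Type*} [AddCommMonoid N] (f : M →+ N) :
    TateModule p M →ₗ[ℤ_[p]] TateModule p N where
  toFun z := ⟨fun n => f (z.val n), by rw [z.val_zero, map_zero],
    fun n => by rw [← map_nsmul, z.nsmul_succ]⟩
  map_add' _ _ := ext fun _ => map_add f _ _
  map_smul' _ _ := ext fun _ => map_nsmul f _ _

end TateModule

/-! ### Formal group laws -/

/-- The composition `θ ∘ η` of tuples of power series. -/
def MvPowerSeries.tupleComp {ι σ τ R : Type*} [CommRing R] (θ : ι → MvPowerSeries σ R)
    (η : σ → MvPowerSeries τ R) : ι → MvPowerSeries τ R :=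
  fun i => subst η (θ i)

/-- An `r`-dimensional commutative formal group law over `R`: an `r`-tuple of power series
`F(X, Y)` in `2 r` variables with `F(X, 0) = X`, `F(0, Y) = Y`, `F(F(X, Y), Z) = F(X, F(Y, Z))`
and `F(Y, X) = F(X, Y)`.  Here `X j` is the variable `Sum.inl j` and `Y j` is `Sum.inr j`. -/
structure FormalGroupLaw (r : ℕ) (R : Type*) [CommRing R] where
  toSeries : Fin r → MvPowerSeries (Fin r ⊕ Fin r) R
  constantCoeff_eq_zero : ∀ i, constantCoeff (toSeries i) = 0
  X_zero : tupleComp toSeries (Sum.elim X 0) = (X : Fin r → MvPowerSeries (Fin r) R)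
  zero_X : tupleComp toSeries (Sum.elim 0 X) = (X : Fin r → MvPowerSeries (Fin r) R)
  assoc :
    tupleComp toSeries (Sum.elim
      (tupleComp toSeries (Sum.elim (fun j => X (Sum.inl j)) (fun j => X (Sum.inr (Sum.inl j)))))
      (fun j => X (Sum.inr (Sum.inr j)))) =
    (tupleComp toSeries (Sum.elim (fun j => X (Sum.inl j))
      (tupleComp toSeries (Sum.elim (fun j => X (Sum.inr (Sum.inl j)))
        (fun j => X (Sum.inr (Sum.inr j)))))) : Fin r → MvPowerSeries (Fin r ⊕ Fin r ⊕ Fin r) R)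
  comm : tupleComp toSeries (Sum.elim (fun j => X (Sum.inr j)) (fun j => X (Sum.inl j))) = toSeries

namespace FormalGroupLaw

variable {r : ℕ} {R : Type*} [CommRing R]

theorem hasSubst_elim {r : ℕ} {τ : Type*} {R : Type*} [CommRing R]
    {a b : Fin r → MvPowerSeries τ R}
    (ha : ∀ i, constantCoeff (a i) = 0) (hb : ∀ i, constantCoeff (b i) = 0) :
    HasSubst (Sum.elim a b) :=
  hasSubst_of_constantCoeff_zero (by rintro (i | i) <;> simp [ha, hb])

theorem constantCoeff_tupleComp {ι σ τ : Type*} [Finite σ] {θ : ι → MvPowerSeries σ R}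
    {η : σ → MvPowerSeries τ R} (hθ : ∀ i, constantCoeff (θ i) = 0)
    (hη : ∀ i, constantCoeff (η i) = 0) (i : ι) : constantCoeff (tupleComp θ η i) = 0 :=
  constantCoeff_subst_eq_zero (hasSubst_of_constantCoeff_zero hη) hη (hθ i)

theorem map_tupleComp {ι σ τ S : Type*} [CommRing S] (φ : R →+* S) {θ : ι → MvPowerSeries σ R}
    {η : σ → MvPowerSeries τ R} (hη : HasSubst η) :
    tupleComp (fun i => MvPowerSeries.map φ (θ i)) (fun i => MvPowerSeries.map φ (η i)) =
      fun i => MvPowerSeries.map φ (tupleComp θ η i) :=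
  funext fun i => (map_subst hη (θ i)).symm

theorem map_elim {ι τ S : Type*} [CommRing S] (φ : R →+* S) (a b : ι → MvPowerSeries τ R) :
    (fun i => MvPowerSeries.map φ (Sum.elim a b i)) =
      Sum.elim (fun i => MvPowerSeries.map φ (a i)) (fun i => MvPowerSeries.map φ (b i)) := by
  ext1 (i | i) <;> rfl

/-- Base change of a formal group law. -/
def map {S : Type*} [CommRing S] (φ : R →+* S) (F : FormalGroupLaw r R) : FormalGroupLaw r S where
  toSeries i := MvPowerSeries.map φ (F.toSeries i)
  constantCoeff_eq_zero i := by simp [F.constantCoeff_eq_zero]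
  X_zero := by
    have h := map_tupleComp φ (θ := F.toSeries) (η := Sum.elim X 0)
      (hasSubst_elim (R := R) (by simp) (by simp))
    rw [map_elim, F.X_zero] at h
    simpa [Pi.zero_def] using h
  zero_X := by
    have h := map_tupleComp φ (θ := F.toSeries) (η := Sum.elim 0 X)
      (hasSubst_elim (R := R) (by simp) (by simp))
    rw [map_elim, F.zero_X] at h
    simpa [Pi.zero_def] using h
  assoc := by
    have h1 := map_tupleComp φ (θ := F.toSeries) (hasSubst_elim (R := R)
      (a := tupleComp F.toSeries (Sum.elim (fun j => X (Sum.inl j))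
        (fun j => X (Sum.inr (Sum.inl j)))))
      (b := fun j => (X (Sum.inr (Sum.inr j)) : MvPowerSeries (Fin r ⊕ Fin r ⊕ Fin r) R))
      (constantCoeff_tupleComp F.constantCoeff_eq_zero (by rintro (i | i) <;> simp)) (by simp))
    have h2 := map_tupleComp φ (θ := F.toSeries) (hasSubst_elim (R := R)
      (a := fun j => (X (Sum.inl j) : MvPowerSeries (Fin r ⊕ Fin r ⊕ Fin r) R))
      (b := tupleComp F.toSeries (Sum.elim (fun j => X (Sum.inr (Sum.inl j)))
        (fun j => X (Sum.inr (Sum.inr j))))) (by simp)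
      (constantCoeff_tupleComp F.constantCoeff_eq_zero (by rintro (i | i) <;> simp)))
    rw [map_elim, ← map_tupleComp φ (hasSubst_elim (by simp) (by simp)), map_elim] at h1 h2
    simp only [map_X] at h1 h2
    rw [h1, h2, F.assoc]
  comm := by
    have h := map_tupleComp φ (θ := F.toSeries)
      (η := Sum.elim (fun j => X (Sum.inr j)) (fun j => X (Sum.inl j)))
      (hasSubst_elim (R := R) (by simp) (by simp))
    rw [map_elim, F.comm] at h
    simpa using h

/-- The `r`-dimensional multiplicative group `𝔾_m^r`, with `F_i(X, Y) = X_i + Y_i + X_i Y_i`. -/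
def multiplicative (r : ℕ) (R : Type*) [CommRing R] : FormalGroupLaw r R where
  toSeries i := X (Sum.inl i) + X (Sum.inr i) + X (Sum.inl i) * X (Sum.inr i)
  constantCoeff_eq_zero i := by simp
  X_zero := by
    have h : HasSubst (Sum.elim X 0 : Fin r ⊕ Fin r → MvPowerSeries (Fin r) R) :=
      hasSubst_elim (by simp) (by simp)
    ext1 i
    simp [tupleComp, subst_add h, subst_mul h, subst_X h]
  zero_X := by
    have h : HasSubst (Sum.elim 0 X : Fin r ⊕ Fin r → MvPowerSeries (Fin r) R) :=
      hasSubst_elim (by simp) (by simp)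
    ext1 i
    simp [tupleComp, subst_add h, subst_mul h, subst_X h]
  assoc := by
    have key : ∀ {a b : Fin r → MvPowerSeries (Fin r ⊕ Fin r ⊕ Fin r) R},
        (∀ i, constantCoeff (a i) = 0) → (∀ i, constantCoeff (b i) = 0) →
        tupleComp (fun i => (X (Sum.inl i) + X (Sum.inr i) + X (Sum.inl i) * X (Sum.inr i) :
          MvPowerSeries (Fin r ⊕ Fin r) R)) (Sum.elim a b) =
        fun i => a i + b i + a i * b i := fun ha hb => by
      have h := hasSubst_elim ha hb
      ext1 i
      simp [tupleComp, subst_add h, subst_mul h, subst_X h]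
    rw [key (a := fun j => X (Sum.inl j)) (b := fun j => X (Sum.inr (Sum.inl j)))
      (by simp) (by simp), key (a := fun j => X (Sum.inr (Sum.inl j)))
      (b := fun j => X (Sum.inr (Sum.inr j))) (by simp) (by simp), key (by simp) (by simp),
      key (by simp) (by simp)]
    ext1 i
    ring
  comm := by
    have h : HasSubst (Sum.elim (fun j => X (Sum.inr j)) (fun j => X (Sum.inl j)) :
        Fin r ⊕ Fin r → MvPowerSeries (Fin r ⊕ Fin r) R) := hasSubst_elim (by simp) (by simp)
    ext1 i
    simp only [tupleComp, subst_add h, subst_mul h, subst_X h, Sum.elim_inl, Sum.elim_inr]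
    ring

/-- `θ` is a homomorphism of formal group laws `F → G`: it has no constant term and
`θ(F(X, Y)) = G(θ(X), θ(Y))`. -/
def IsHom (F G : FormalGroupLaw r R) (θ : Fin r → MvPowerSeries (Fin r) R) : Prop :=
  (∀ i, constantCoeff (θ i) = 0) ∧
    tupleComp θ F.toSeries =
      tupleComp G.toSeries (Sum.elim (tupleComp θ (fun j => X (Sum.inl j)))
        (tupleComp θ (fun j => X (Sum.inr j))))

/-- An isomorphism of formal group laws, with its inverse. -/
structure Iso (F G : FormalGroupLaw r R) where
  hom : Fin r → MvPowerSeries (Fin r) R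
  inv : Fin r → MvPowerSeries (Fin r) R
  isHom_hom : IsHom F G hom
  isHom_inv : IsHom G F inv
  inv_comp_hom : tupleComp inv hom = X
  hom_comp_inv : tupleComp hom inv = X

end FormalGroupLaw

/-! ### Evaluation of power series and points of formal group laws -/

section Points

variable {r : ℕ} {R : Type*} [CommRing R] {S : Type*} [CommRing S] [UniformSpace S]

/-- The value `f(x)` of a power series `f` over `R` at a point `x` with coordinates in a
topological `R`-algebra. -/
def MvPowerSeries.evalAt [Algebra R S] {σ : Type*} (x : σ → S) (f : MvPowerSeries σ R) : S :=
  ∑' d : σ →₀ ℕ, algebraMap R S (coeff d f) * d.prod fun s n => x s ^ n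

/-- The points of an `r`-dimensional formal group law with values in a topological algebra `S`:
the `r`-tuples of topologically nilpotent elements of `S`. -/
@[ext] structure FormalGroupLaw.Points (F : FormalGroupLaw r R) (S : Type*) [CommRing S]
    [UniformSpace S] where
  val : Fin r → S
  topNilp : ∀ i, IsTopologicallyNilpotent (val i)

theorem hasEval_of_finite {σ : Type*} [Finite σ] {x : σ → S}
    (hx : ∀ i, IsTopologicallyNilpotent (x i)) : HasEval x :=
  ⟨hx, by simp [Filter.cofinite_eq_bot]⟩

theorem evalAt_zero [Algebra R S] {σ : Type*} {x : σ → S} : evalAt x (0 : MvPowerSeries σ R) = 0 := by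
  simp [evalAt]

theorem FormalGroupLaw.Points.hasEval_elim {F : FormalGroupLaw r R} (x y : F.Points S) : HasEval (Sum.elim x.val y.val) :=
  hasEval_of_finite (by rintro (i | i) <;> simp [x.topNilp, y.topNilp])

variable [Algebra R S]
variable [IsUniformAddGroup S] [CompleteSpace S] [T2Space S] [IsTopologicalRing S]
  [IsLinearTopology S S]

theorem evalAt_eq_eval₂ {σ : Type*} {x : σ → S} (hx : HasEval x) [UniformSpace R]
    [DiscreteUniformity R] (f : MvPowerSeries σ R) :
    evalAt x f = eval₂ (algebraMap R S) x f :=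
  (eval₂_eq_tsum continuous_of_discreteTopology hx f).symm

theorem evalAt_X {σ : Type*} {x : σ → S} (hx : HasEval x) (s : σ) :
    evalAt x (X s : MvPowerSeries σ R) = x s := by
  let : UniformSpace R := ⊥
  rw [evalAt_eq_eval₂ hx, eval₂_X]

theorem evalAt_subst {σ τ : Type*} {a : σ → MvPowerSeries τ R} (ha : HasSubst a) {x : τ → S}
    (hx : HasEval x) (hax : HasEval fun s => evalAt x (a s)) (f : MvPowerSeries σ R) :
    evalAt x (subst a f) = evalAt (fun s => evalAt x (a s)) f := by
  let : UniformSpace R := ⊥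
  rw [evalAt_eq_eval₂ hx, evalAt_eq_eval₂ hax, eval₂_subst ha hx]
  simp only [evalAt_eq_eval₂ hx]

theorem isTopologicallyNilpotent_evalAt {σ : Type*} {x : σ → S} (hx : HasEval x)
    {f : MvPowerSeries σ R} (hf : constantCoeff f = 0) :
    IsTopologicallyNilpotent (evalAt x f) := by
  let : UniformSpace R := ⊥
  rw [evalAt_eq_eval₂ hx, ← coe_eval₂Hom continuous_of_discreteTopology hx]
  let : TopologicalSpace (MvPowerSeries σ R) := WithPiTopology.instTopologicalSpace R
  refine IsTopologicallyNilpotent.map (φ := eval₂Hom continuous_of_discreteTopology hx) ?_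
    (WithPiTopology.isTopologicallyNilpotent_of_constantCoeff_zero hf)
  rw [coe_eval₂Hom]
  exact continuous_eval₂ continuous_of_discreteTopology hx

theorem map_evalAt {σ : Type*} {x : σ → S} (hx : HasEval x) (f : MvPowerSeries σ R)
    {ε : S →+* S} (hε : Continuous ε) (hR : ∀ a : R, ε (algebraMap R S a) = algebraMap R S a) :
    ε (evalAt x f) = evalAt (fun s => ε (x s)) f := by
  let : UniformSpace R := ⊥
  rw [evalAt_eq_eval₂ hx, evalAt_eq_eval₂ (hx.map hε)]
  have h := congrFun (comp_eval₂ (φ := algebraMap R S) continuous_of_discreteTopology hx hε) f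
  have h2 : ε.comp (algebraMap R S) = algebraMap R S := RingHom.ext hR
  rw [h2] at h
  exact h

namespace FormalGroupLaw.Points

variable {F : FormalGroupLaw r R}

instance : Zero (F.Points S) := ⟨⟨0, fun _ => .zero⟩⟩

/-- The sum of two points is `F(x, y)`. -/
instance : Add (F.Points S) :=
  ⟨fun x y => ⟨fun i => evalAt (Sum.elim x.val y.val) (F.toSeries i), fun i =>
    isTopologicallyNilpotent_evalAt (hasEval_elim x y) (F.constantCoeff_eq_zero i)⟩⟩

theorem add_val (x y : F.Points S) (i : Fin r) :
    (x + y).val i = evalAt (Sum.elim x.val y.val) (F.toSeries i) := rfl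

theorem evalAt_tupleComp {τ : Type*} {a b : Fin r → MvPowerSeries τ R}
    (ha : ∀ i, constantCoeff (a i) = 0) (hb : ∀ i, constantCoeff (b i) = 0) {x : τ → S}
    (hx : HasEval x) (y z : F.Points S) (hy : ∀ i, evalAt x (a i) = y.val i)
    (hz : ∀ i, evalAt x (b i) = z.val i) (i : Fin r) :
    evalAt x (tupleComp F.toSeries (Sum.elim a b) i) = (y + z).val i := by
  have h : (fun s => evalAt x (Sum.elim a b s)) = Sum.elim y.val z.val := by
    ext1 (i | i) <;> simp [hy, hz]
  rw [tupleComp, evalAt_subst (hasSubst_elim ha hb) hx (h ▸ hasEval_elim y z), h, add_val]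

instance : AddCommMonoid (F.Points S) where
  nsmul := nsmulRec
  add_zero x := Points.ext <| funext fun i => by
    rw [← evalAt_tupleComp (R := R) (F := F) (a := X) (b := 0) (by simp) (by simp)
      (hasEval_of_finite x.topNilp) x 0 (fun i => evalAt_X (hasEval_of_finite x.topNilp) i)
      (fun i => evalAt_zero), F.X_zero, evalAt_X (hasEval_of_finite x.topNilp)]
  zero_add x := Points.ext <| funext fun i => by
    rw [← evalAt_tupleComp (R := R) (F := F) (a := 0) (b := X) (by simp) (by simp)
      (hasEval_of_finite x.topNilp) 0 x (fun i => evalAt_zero)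
      (fun i => evalAt_X (hasEval_of_finite x.topNilp) i), F.zero_X, evalAt_X (hasEval_of_finite x.topNilp)]
  add_comm x y := Points.ext <| funext fun i => by
    rw [← evalAt_tupleComp (R := R) (F := F) (a := fun j => X (Sum.inr j))
      (b := fun j => X (Sum.inl j)) (by simp) (by simp)
      (hasEval_elim y x) x y (fun i => by rw [evalAt_X (hasEval_elim y x)]; rfl)
      (fun i => by rw [evalAt_X (hasEval_elim y x)]; rfl), F.comm, add_val]
  add_assoc x y z := Points.ext <| funext fun i => by
    have hx : HasEval (Sum.elim x.val (Sum.elim y.val z.val)) :=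
      hasEval_of_finite (by rintro (i | i | i) <;> simp [x.topNilp, y.topNilp, z.topNilp])
    have h1 : ∀ j, evalAt (Sum.elim x.val (Sum.elim y.val z.val))
        (X (Sum.inl j) : MvPowerSeries (Fin r ⊕ Fin r ⊕ Fin r) R) = x.val j :=
      fun j => evalAt_X hx _
    have h2 : ∀ j, evalAt (Sum.elim x.val (Sum.elim y.val z.val))
        (X (Sum.inr (Sum.inl j)) : MvPowerSeries (Fin r ⊕ Fin r ⊕ Fin r) R) = y.val j :=
      fun j => evalAt_X hx _
    have h3 : ∀ j, evalAt (Sum.elim x.val (Sum.elim y.val z.val))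
        (X (Sum.inr (Sum.inr j)) : MvPowerSeries (Fin r ⊕ Fin r ⊕ Fin r) R) = z.val j :=
      fun j => evalAt_X hx _
    have h := congrArg (evalAt (Sum.elim x.val (Sum.elim y.val z.val))) (congrFun F.assoc i)
    rwa [evalAt_tupleComp (constantCoeff_tupleComp F.constantCoeff_eq_zero
        (by rintro (i | i) <;> simp)) (by simp) hx (x + y) z
        (evalAt_tupleComp (by simp) (by simp) hx x y h1 h2) h3,
      evalAt_tupleComp (by simp) (constantCoeff_tupleComp F.constantCoeff_eq_zero
        (by rintro (i | i) <;> simp)) hx x (y + z) h1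
        (evalAt_tupleComp (by simp) (by simp) hx y z h2 h3)] at h

/-- A continuous ring endomorphism of `S` fixing the coefficient ring acts on points
coordinatewise. -/
def mapRingHom (F : FormalGroupLaw r R) (ε : S →+* S) (hε : Continuous ε)
    (hR : ∀ a : R, ε (algebraMap R S a) = algebraMap R S a) : F.Points S →+ F.Points S where
  toFun x := ⟨fun i => ε (x.val i), fun i => (x.topNilp i).map hε⟩
  map_zero' := Points.ext <| funext fun _ => map_zero ε
  map_add' x y := Points.ext <| funext fun i => by
    change ε ((x + y).val i) = evalAt _ _
    rw [add_val, map_evalAt (hasEval_elim x y) _ hε hR]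
    congr 1
    ext1 (i | i) <;> rfl

end FormalGroupLaw.Points

end Points

/-! ### `p`-adic Galois theory -/

section Galois

variable (p : ℕ) [Fact p.Prime]

theorem mem_OCp {p : ℕ} [Fact p.Prime] {x : ℂ_[p]} : x ∈ 𝓞_ℂ_[p] ↔ ‖x‖ ≤ 1 := by
  rw [PadicComplex.norm_eq_norm]
  exact (Valued.toNormedField.norm_le_one_iff (L := ℂ_[p])).symm

instance : CompleteSpace 𝓞_ℂ_[p] := by
  have h : IsClosed ((𝓞_ℂ_[p] : ValuationSubring ℂ_[p]) : Set ℂ_[p]) := by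
    have : ((𝓞_ℂ_[p] : ValuationSubring ℂ_[p]) : Set ℂ_[p]) = {x | ‖x‖ ≤ 1} :=
      Set.ext fun x => mem_OCp
    rw [this]
    exact isClosed_le continuous_norm continuous_const
  exact h.completeSpace_coe

/-- The ideal of `𝓞_ℂ_p` of elements of norm less than `ε`. -/
def normBallIdeal (ε : ℝ) (hε : 0 < ε) : Ideal 𝓞_ℂ_[p] where
  carrier := {x | ‖(x : ℂ_[p])‖ < ε}
  add_mem' {x y} hx hy := (IsUltrametricDist.norm_add_le_max (x : ℂ_[p]) y).trans_lt (max_lt hx hy)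
  zero_mem' := by simpa using hε
  smul_mem' c x hx := by
    refine lt_of_le_of_lt (b := ‖(x : ℂ_[p])‖) ?_ hx
    change ‖(c : ℂ_[p]) * x‖ ≤ _
    rw [norm_mul]
    exact mul_le_of_le_one_left (norm_nonneg _) (mem_OCp.mp c.2)

instance : IsLinearTopology 𝓞_ℂ_[p] 𝓞_ℂ_[p] := by
  refine IsLinearTopology.mk_of_hasBasis 𝓞_ℂ_[p] (ι := {ε : ℝ // 0 < ε}) (S := Ideal 𝓞_ℂ_[p])
    (p := fun _ => True) (s := fun ε => normBallIdeal p ε.1 ε.2) ?_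
  refine ⟨fun t => ?_⟩
  rw [Metric.nhds_basis_ball.mem_iff]
  have key : ∀ ε : ℝ, Metric.ball (0 : 𝓞_ℂ_[p]) ε =
      {x : 𝓞_ℂ_[p] | ‖(x : ℂ_[p])‖ < ε} := fun ε => by
    ext x
    rw [Metric.mem_ball, Subtype.dist_eq, dist_eq_norm]
    simp
  constructor
  · rintro ⟨ε, hε, h⟩
    exact ⟨⟨ε, hε⟩, trivial, fun x hx => h (by rw [key]; exact hx)⟩
  · rintro ⟨⟨ε, hε⟩, -, h⟩
    exact ⟨ε, hε, fun x hx => h (by rw [key] at hx; exact hx)⟩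

/-- The absolute Galois group of `ℚ_p`. -/
abbrev GQp : Type := Gal(PadicAlgCl p/ℚ_[p])

variable {p}

theorem GQp.norm_apply (g : GQp p) (x : PadicAlgCl p) : ‖g x‖ = ‖x‖ :=
  (spectralNorm_eq_of_equiv (K := ℚ_[p]) g x).symm

theorem GQp.continuous (g : GQp p) : Continuous (g : PadicAlgCl p →+* PadicAlgCl p) :=
  (AddMonoidHomClass.isometry_of_norm (g : PadicAlgCl p →+* PadicAlgCl p) g.norm_apply).continuous

/-- The continuous extension to `ℂ_p` of an element of the Galois group. -/
def GQp.actCp (g : GQp p) : ℂ_[p] →+* ℂ_[p] :=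
  UniformSpace.Completion.mapRingHom (g : PadicAlgCl p →+* PadicAlgCl p) g.continuous

theorem GQp.continuous_actCp (g : GQp p) : Continuous g.actCp :=
  UniformSpace.Completion.continuous_map

theorem GQp.actCp_coe (g : GQp p) (x : PadicAlgCl p) : g.actCp (x : ℂ_[p]) = (g x : PadicAlgCl p) :=
  UniformSpace.Completion.mapRingHom_coe g.continuous x

theorem GQp.norm_actCp (g : GQp p) (x : ℂ_[p]) : ‖g.actCp x‖ = ‖x‖ := by
  induction x using UniformSpace.Completion.induction_on with
  | hp => exact isClosed_eq g.continuous_actCp.norm continuous_norm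
  | ih x => rw [g.actCp_coe, PadicComplex.norm_extends, PadicComplex.norm_extends, g.norm_apply]

theorem GQp.actCp_one (x : ℂ_[p]) : (1 : GQp p).actCp x = x := by
  induction x using UniformSpace.Completion.induction_on with
  | hp => exact isClosed_eq (GQp.continuous_actCp 1) continuous_id
  | ih x => rw [GQp.actCp_coe]; rfl

theorem GQp.actCp_mul (g h : GQp p) (x : ℂ_[p]) : (g * h).actCp x = g.actCp (h.actCp x) := by
  induction x using UniformSpace.Completion.induction_on with
  | hp =>
    exact isClosed_eq (GQp.continuous_actCp (g * h))
      (g.continuous_actCp.comp h.continuous_actCp)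
  | ih x => rw [GQp.actCp_coe, GQp.actCp_coe, GQp.actCp_coe]; rfl

/-- The action of the Galois group on the ring of integers of `ℂ_p`. -/
def GQp.actOCp (g : GQp p) : 𝓞_ℂ_[p] →+* 𝓞_ℂ_[p] :=
  g.actCp.restrict 𝓞_ℂ_[p] 𝓞_ℂ_[p] fun x hx => by
    rw [mem_OCp] at hx ⊢
    rwa [g.norm_actCp]

theorem GQp.continuous_actOCp (g : GQp p) : Continuous g.actOCp :=
  (g.continuous_actCp.comp continuous_subtype_val).subtype_mk _

/-- The inertia subgroup: the automorphisms acting trivially on the residue field. -/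
def inertia (p : ℕ) [Fact p.Prime] : Subgroup (GQp p) where
  carrier := {g | ∀ x : PadicAlgCl p, ‖x‖ ≤ 1 → ‖g x - x‖ < 1}
  one_mem' x _ := by simp
  mul_mem' {g h} hg hh x hx := by
    have h1 : (g * h) x - x = g (h x - x) + (g x - x) := by
      rw [map_sub, AlgEquiv.mul_apply]; ring
    rw [h1]
    refine (IsUltrametricDist.norm_add_le_max _ _).trans_lt (max_lt ?_ (hg x hx))
    rw [GQp.norm_apply]
    exact hh x hx
  inv_mem' {g} hg x hx := by
    have h1 : x - g⁻¹ x = g (g⁻¹ x) - g⁻¹ x := by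
      rw [← AlgEquiv.mul_apply, mul_inv_cancel, AlgEquiv.one_apply]
    rw [norm_sub_rev, h1]
    exact hg _ (by rwa [GQp.norm_apply])

/-- `g` lifts the arithmetic Frobenius `x ↦ x ^ p` of the residue field. -/
def IsArithmeticFrobenius (g : GQp p) : Prop :=
  ∀ x : PadicAlgCl p, ‖x‖ ≤ 1 → ‖g x - x ^ p‖ < 1

/-- `g` lifts the geometric Frobenius of the residue field, the inverse of `x ↦ x ^ p`. -/
def IsGeometricFrobenius (g : GQp p) : Prop :=
  IsArithmeticFrobenius g⁻¹

variable (p) in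
/-- The maximal unramified extension of `ℚ_p`, as the fixed field of the inertia group. -/
def Qpnr : IntermediateField ℚ_[p] (PadicAlgCl p) :=
  IntermediateField.fixedField (inertia p)

theorem GQp.apply_mem_Qpnr (g : GQp p) {x : PadicAlgCl p} (hx : x ∈ Qpnr p) : g x ∈ Qpnr p := by
  rw [Qpnr, IntermediateField.mem_fixedField_iff] at hx ⊢
  intro i hi
  have hmem : g⁻¹ * i * g ∈ inertia p := fun y hy => by
    have h1 : (g⁻¹ * i * g) y - y = g⁻¹ (i (g y) - g y) := by
      rw [map_sub]
      simp only [AlgEquiv.mul_apply]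
      congr 1
      rw [← AlgEquiv.mul_apply, inv_mul_cancel, AlgEquiv.one_apply]
    rw [h1, GQp.norm_apply]
    exact hi _ (by rwa [GQp.norm_apply])
  have h2 := congrArg g (hx _ hmem)
  rwa [← AlgEquiv.mul_apply, ← mul_assoc, ← mul_assoc, mul_inv_cancel, one_mul,
    AlgEquiv.mul_apply] at h2

variable (p) in
/-- The ring of integers of the maximal unramified extension of `ℚ_p`, inside `𝓞_ℂ_p`. -/
def Zpnr : Subring 𝓞_ℂ_[p] :=
  ((Qpnr p).toSubring.map (algebraMap (PadicAlgCl p) ℂ_[p])).comap 𝓞_ℂ_[p].subtype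

variable (p) in
/-- The completion of the ring of integers of the maximal unramified extension of `ℚ_p`, as the
closure of that ring in the complete ring `𝓞_ℂ_p`. -/
def ZpnrHat : Subring 𝓞_ℂ_[p] :=
  (Zpnr p).topologicalClosure

/-- The action of the Galois group on the completion of the ring of integers of the maximal
unramified extension. -/
def GQp.actZpnrHat (g : GQp p) : ZpnrHat p →+* ZpnrHat p :=
  g.actOCp.restrict (ZpnrHat p) (ZpnrHat p) fun x hx => by
    refine map_mem_closure g.continuous_actOCp hx fun y hy => ?_
    obtain ⟨z, hz, hzy⟩ := hy
    exact ⟨g z, g.apply_mem_Qpnr hz, (g.actCp_coe z).symm.trans (congrArg g.actCp hzy)⟩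

variable (p) in
/-- The inclusion of `ℤ_p` into `𝓞_ℂ_p`. -/
def zpToOCp : ℤ_[p] →+* 𝓞_ℂ_[p] :=
  ((algebraMap ℚ_[p] ℂ_[p]).comp PadicInt.Coe.ringHom).codRestrict 𝓞_ℂ_[p] fun x => by
    rw [mem_OCp]
    exact (PadicComplex.norm_extends' p (x : ℚ_[p])).trans_le x.2

variable (p) in
/-- The inclusion of `ℤ_p` into the completed ring of integers of the maximal unramified
extension. -/
def zpToZpnrHat : ℤ_[p] →+* ZpnrHat p :=
  (zpToOCp p).codRestrict (ZpnrHat p) fun x =>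
    Subring.le_topologicalClosure _ ⟨algebraMap ℚ_[p] (PadicAlgCl p) x, (Qpnr p).algebraMap_mem _, rfl⟩

instance : Algebra ℤ_[p] 𝓞_ℂ_[p] := (zpToOCp p).toAlgebra

instance : Algebra ℤ_[p] (ZpnrHat p) := (zpToZpnrHat p).toAlgebra

theorem GQp.actOCp_algebraMap (g : GQp p) (a : ℤ_[p]) :
    g.actOCp (algebraMap ℤ_[p] 𝓞_ℂ_[p] a) = algebraMap ℤ_[p] 𝓞_ℂ_[p] a := by
  apply Subtype.ext
  change g.actCp ((algebraMap ℚ_[p] (PadicAlgCl p) a : PadicAlgCl p) : ℂ_[p]) =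
    ((algebraMap ℚ_[p] (PadicAlgCl p) a : PadicAlgCl p) : ℂ_[p])
  rw [g.actCp_coe, AlgEquiv.commutes]

/-! ### Representations -/

variable {r : ℕ}

/-- The Galois representation on the Tate module `T_p F` of a formal group law over `ℤ_p`. The
points are taken in the maximal ideal of `𝓞_ℂ_p`; the torsion points lie in the algebraic closure
of `ℚ_p`. -/
def tateRep (F : FormalGroupLaw r ℤ_[p]) :
    Representation ℤ_[p] (GQp p) (TateModule p (F.Points 𝓞_ℂ_[p])) where
  toFun g := TateModule.map
    (FormalGroupLaw.Points.mapRingHom F g.actOCp g.continuous_actOCp g.actOCp_algebraMap)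
  map_one' := LinearMap.ext fun _ => TateModule.ext fun _ => FormalGroupLaw.Points.ext <|
    funext fun _ => Subtype.ext (GQp.actCp_one _)
  map_mul' g h := LinearMap.ext fun _ => TateModule.ext fun _ => FormalGroupLaw.Points.ext <|
    funext fun _ => Subtype.ext (GQp.actCp_mul g h _)

variable (p) in
/-- The `p`-adic cyclotomic character of `G_{ℚ_p}`. -/
def cycChar : GQp p →* ℤ_[p]ˣ :=
  (cyclotomicCharacter (PadicAlgCl p) p).comp (MulSemiringAction.toRingAut (GQp p) (PadicAlgCl p))

/-- The representation `ℤ_p^r(1)(ρ)`: the twist of the trivial representation `ℤ_p^r` by the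
cyclotomic character and by `ρ`. -/
def cycTwist (ρ : GQp p →* GL (Fin r) ℤ_[p]) : Representation ℤ_[p] (GQp p) (Fin r → ℤ_[p]) where
  toFun g := (cycChar p g : ℤ_[p]) • (ρ g : Matrix (Fin r) (Fin r) ℤ_[p]).mulVecLin
  map_one' := by ext; simp
  map_mul' g h := by
    refine LinearMap.ext fun v => ?_
    rw [map_mul, map_mul, Units.val_mul, Units.val_mul, Matrix.mulVecLin_mul, mul_smul,
      Module.End.mul_apply]
    simp only [LinearMap.smul_apply, LinearMap.comp_apply, map_smul]
    exact smul_comm _ _ _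

/-- `ρ` is the unramified representation with `ρ φ = u`. -/
structure IsUnramifiedRep (φ : GQp p) (u : GL (Fin r) ℤ_[p]) (ρ : GQp p →* GL (Fin r) ℤ_[p]) :
    Prop where
  continuous : Continuous ρ
  unramified : ∀ g ∈ inertia p, ρ g = 1
  frobenius : ρ φ = u

/-! ### Lubin–Tate formal groups -/

/-- `d` is a Lubin–Tate series for the parameter `M`: `d(X) ≡ M X` modulo degree `2` and
`d(X) ≡ X ^ p` modulo `p`. -/
structure IsLubinTateSeries (M : Matrix (Fin r) (Fin r) ℤ_[p])
    (d : Fin r → MvPowerSeries (Fin r) ℤ_[p]) : Prop where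
  constantCoeff_eq_zero : ∀ i, constantCoeff (d i) = 0
  linear : ∀ i j, coeff (Finsupp.single j 1) (d i) = M i j
  frobenius : ∀ i e, (p : ℤ_[p]) ∣ coeff e (d i - X i ^ p)

/-- `F` is a Lubin–Tate formal group for the parameter `M`: some Lubin–Tate series for `M` is an
endomorphism of `F`. -/
def IsLubinTate (M : Matrix (Fin r) (Fin r) ℤ_[p]) (F : FormalGroupLaw r ℤ_[p]) : Prop :=
  ∃ d, IsLubinTateSeries M d ∧ F.IsHom F d

/-- The endomorphism of `𝔾_m^r` attached to `A ∈ M_r(ℤ_p)`: its `i`-th component is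
`∏_j (1 + X_j) ^ (A i j) - 1`. -/
def multiplicativeEnd (S : Type*) [CommRing S] [Algebra ℤ_[p] S]
    (A : Matrix (Fin r) (Fin r) ℤ_[p]) : Fin r → MvPowerSeries (Fin r) S :=
  fun i => (∏ j, (PowerSeries.binomialSeries S (A i j)).subst (X j : MvPowerSeries (Fin r) S)) - 1

end Galois

end

/-! The engine is a Lubin–Tate lemma twisted by a lift `s` of Frobenius on a `p`-torsion free,
`p`-adically separated and complete ring. Let `d` and `f` be congruent to `X ^ p` modulo `p`, with
linear parts `p A` and `p B`, where `B` is invertible. A tuple `Φ` with `Φ^s ∘ d = f ∘ Φ` is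
determined by its linear part `E` (`Intertwines.ext`), and every `E` with `E^s A = B E` occurs
(`exists_intertwines`). The reason: modulo `p` both sides are `Φ(X)^p`, so the error is divisible by
`p`. A correction `g` in degree `N ≥ 2` changes the left side by a multiple of `p^N` and the right
side by `p B g`, so after division by `p` it is the solution of a contracting equation.

Over `ℤ_p` with `s = id`, this constructs the formal group: `F` is the intertwiner with linear part
`X + Y`, and each axiom equates two intertwiners with the same linear part. Over `W`, with `s = σ =
φ⁻¹`, it compares `F` with `𝔾_m^r`, where multiplication by `p` plays the role of `f` with `B = 1`.
The linear part must be some `E` in `GL_r(W)` with `σ(E) = u E`. The matrix `E` has to commute with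
`u`: the intertwining relation asks for `σ(E) = E u`, whereas `θ^σ = u ∘ θ` asks for `σ(E) = u E`.
Such an `E` comes from a version of Lang's theorem (`IsFrobeniusLift.exists_commute_map_eq`): modulo
`p` it is written down with a normal basis of a finite field and its dual, and it is lifted by
solving Artin–Schreier equations inside the commutant of `u`. The same construction, applied to
`u⁻¹`, gives the unramified representation as `ρ(g) = E⁻¹ g(E)`.

That `W` is an admissible ring is checked with Teichmüller representatives: they generate the
maximal unramified extension, `p` is a uniformizer there, and the residue field is algebraically
closed and algebraic over `𝔽_p`.

Finally `x ↦ 1 + θ(x)` turns points of `F` into tuples of principal units, so compatible systems of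
`p`-power torsion points become systems `ζ_n ^ a`. Inertia fixes the coefficients of `θ`, and `θ^φ =
u⁻¹ ∘ θ` produces the factor `u` at `φ`. The elements for which the resulting isomorphism is
equivariant form a closed subgroup, and inertia together with a Frobenius generates a dense one. -/

/-! ### Power series modulo a power of the augmentation ideal -/

namespace MvPowerSeries

variable {ι σ τ R : Type*} [CommRing R]

/-- The ideal of power series all of whose terms have degree at least `N`. -/
def orderIdeal (τ R : Type*) [CommRing R] (N : ℕ) : Ideal (MvPowerSeries τ R) where
  carrier := {f | ∀ e : τ →₀ ℕ, e.degree < N → coeff e f = 0}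
  add_mem' hf hg e he := by rw [map_add, hf e he, hg e he, add_zero]
  zero_mem' _ _ := map_zero _
  smul_mem' c f hf e he := by
    classical
    rw [smul_eq_mul, coeff_mul]
    refine Finset.sum_eq_zero fun x hx => ?_
    rw [Finset.HasAntidiagonal.mem_antidiagonal] at hx
    rw [hf x.2 (by rw [← hx, map_add] at he; omega), mul_zero]

theorem mem_orderIdeal {N : ℕ} {f : MvPowerSeries τ R} :
    f ∈ orderIdeal τ R N ↔ ∀ e : τ →₀ ℕ, e.degree < N → coeff e f = 0 := Iff.rfl

theorem orderIdeal_anti {M N : ℕ} (h : M ≤ N) : orderIdeal τ R N ≤ orderIdeal τ R M :=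
  fun _ hf e he => hf e (he.trans_le h)

theorem orderIdeal_zero : orderIdeal τ R 0 = ⊤ := by
  ext f
  simp [mem_orderIdeal]

theorem mem_orderIdeal_one {f : MvPowerSeries τ R} :
    f ∈ orderIdeal τ R 1 ↔ constantCoeff f = 0 := by
  simp [mem_orderIdeal, Finsupp.degree_eq_zero_iff]

theorem mul_mem_orderIdeal {M N : ℕ} {f g : MvPowerSeries τ R} (hf : f ∈ orderIdeal τ R M)
    (hg : g ∈ orderIdeal τ R N) : f * g ∈ orderIdeal τ R (M + N) := by
  classical
  intro e he
  rw [coeff_mul]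
  refine Finset.sum_eq_zero fun x hx => ?_
  rw [Finset.HasAntidiagonal.mem_antidiagonal] at hx
  rw [← hx, map_add] at he
  by_cases h : x.1.degree < M
  · rw [hf _ h, zero_mul]
  · rw [hg _ (by omega), mul_zero]

theorem eq_zero_of_forall_mem_orderIdeal {f : MvPowerSeries τ R}
    (h : ∀ N, f ∈ orderIdeal τ R N) : f = 0 := by
  ext e
  rw [h (e.degree + 1) e (Nat.lt_succ_self _), map_zero]

theorem map_mem_orderIdeal {S : Type*} [CommRing S] (φ : R →+* S) {N : ℕ}
    {f : MvPowerSeries τ R} (hf : f ∈ orderIdeal τ R N) :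
    MvPowerSeries.map φ f ∈ orderIdeal τ S N := fun e he => by
  rw [coeff_map, hf e he, map_zero]

/-- Allows estimates on monomials to be proved by induction on the degree, one factor at a time. -/
theorem _root_.Finsupp.exists_eq_add_single {d : σ →₀ ℕ} {k : ℕ} (h : d.degree = k + 1) :
    ∃ (i : σ) (d' : σ →₀ ℕ), d = d' + Finsupp.single i 1 ∧ d'.degree = k := by
  classical
  have h0 : d ≠ 0 := by rintro rfl; simp at h
  obtain ⟨i, hi⟩ := Finsupp.ne_iff.mp h0
  have hd : d = (d - Finsupp.single i 1) + Finsupp.single i 1 := by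
    ext j
    by_cases hj : i = j
    · subst hj
      simp only [Finsupp.coe_zero, Pi.zero_apply] at hi
      simp
      omega
    · simp [hj]
  refine ⟨i, _, hd, ?_⟩
  have := congrArg Finsupp.degree hd
  rw [map_add, Finsupp.degree_single] at this
  omega

theorem prod_add_single (a : σ → MvPowerSeries τ R) (d : σ →₀ ℕ) (i : σ) :
    ((d + Finsupp.single i 1).prod fun s n => a s ^ n) = (d.prod fun s n => a s ^ n) * a i := by
  classical
  rw [Finsupp.prod_add_index' (fun _ => pow_zero _) (fun _ _ _ => pow_add _ _ _)]
  simp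

theorem prod_mem_orderIdeal {a : σ → MvPowerSeries τ R} (ha : ∀ i, constantCoeff (a i) = 0)
    (k : ℕ) : ∀ d : σ →₀ ℕ, d.degree = k →
      (d.prod fun s n => a s ^ n) ∈ orderIdeal τ R k := by
  induction k with
  | zero => intro d _; rw [orderIdeal_zero]; trivial
  | succ k ih =>
    intro d hd
    obtain ⟨i, d', rfl, hd'⟩ := Finsupp.exists_eq_add_single hd
    rw [prod_add_single]
    exact mul_mem_orderIdeal (ih d' hd') (mem_orderIdeal_one.mpr (ha i))

/-- Exchange the factors one at a time: each difference contributes `N` to the order and each of the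
`k` remaining factors contributes one. -/
theorem prod_sub_prod_mem_orderIdeal {a b : σ → MvPowerSeries τ R}
    (ha : ∀ i, constantCoeff (a i) = 0) (hb : ∀ i, constantCoeff (b i) = 0) {N : ℕ}
    (hab : ∀ i, a i - b i ∈ orderIdeal τ R N) (k : ℕ) : ∀ d : σ →₀ ℕ, d.degree = k + 1 →
      (d.prod fun s n => a s ^ n) - (d.prod fun s n => b s ^ n) ∈ orderIdeal τ R (N + k) := by
  induction k with
  | zero =>
    intro d hd
    obtain ⟨i, d', rfl, hd'⟩ := Finsupp.exists_eq_add_single hd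
    rw [Finsupp.degree_eq_zero_iff] at hd'
    subst hd'
    simpa using hab i
  | succ k ih =>
    intro d hd
    obtain ⟨i, d', rfl, hd'⟩ := Finsupp.exists_eq_add_single hd
    rw [prod_add_single, prod_add_single]
    have h : (d'.prod fun s n => a s ^ n) * a i - (d'.prod fun s n => b s ^ n) * b i =
        ((d'.prod fun s n => a s ^ n) - (d'.prod fun s n => b s ^ n)) * a i +
          (a i - b i) * (d'.prod fun s n => b s ^ n) := by ring
    rw [h]
    exact add_mem (mul_mem_orderIdeal (M := N + k) (ih d' hd') (mem_orderIdeal_one.mpr (ha i)))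
      (mul_mem_orderIdeal (hab i) (prod_mem_orderIdeal hb _ d' hd'))

section Finite

variable [Finite σ]

/-- For `K = 0`, substitution respects truncation of the argument. For `K = 1`, a perturbation of
order `N` inside a series without linear terms is invisible in degree `N`, which is what linearizes
the Lubin–Tate equation. -/
theorem subst_sub_subst_mem_orderIdeal {a b : σ → MvPowerSeries τ R}
    (ha : ∀ i, constantCoeff (a i) = 0) (hb : ∀ i, constantCoeff (b i) = 0) {N K : ℕ}
    (hab : ∀ i, a i - b i ∈ orderIdeal τ R N) {f : MvPowerSeries σ R}
    (hf : f ∈ orderIdeal σ R (K + 1)) :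
    subst a f - subst b f ∈ orderIdeal τ R (N + K) := by
  intro e he
  rw [map_sub, coeff_subst (hasSubst_of_constantCoeff_zero ha),
    coeff_subst (hasSubst_of_constantCoeff_zero hb), sub_eq_zero]
  refine finsum_congr fun d => ?_
  by_cases hd : d.degree < K + 1
  · rw [hf d hd, zero_smul, zero_smul]
  · obtain ⟨k, hk⟩ : ∃ k, d.degree = k + 1 := ⟨d.degree - 1, by omega⟩
    have h := prod_sub_prod_mem_orderIdeal ha hb hab k d hk e (by omega)
    rw [map_sub, sub_eq_zero] at h
    rw [h]

theorem subst_mem_orderIdeal {a : σ → MvPowerSeries τ R} (ha : ∀ i, constantCoeff (a i) = 0)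
    {N : ℕ} {f : MvPowerSeries σ R} (hf : f ∈ orderIdeal σ R N) :
    subst a f ∈ orderIdeal τ R N := by
  intro e he
  rw [coeff_subst (hasSubst_of_constantCoeff_zero ha)]
  refine finsum_eq_zero_of_forall_eq_zero fun d => ?_
  by_cases hd : d.degree < N
  · rw [hf d hd, zero_smul]
  · rw [prod_mem_orderIdeal ha _ d rfl e (by omega), smul_zero]

/-- Scaling the argument by `c` scales a monomial of degree `k` by `c ^ k`, so only the lowest
terms, scaled by `c ^ N`, survive modulo degree `N + 1`. This is the source of the factor `p ^ N`
against the factor `p`. -/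
theorem subst_C_mul_sub_mem_orderIdeal {a : σ → MvPowerSeries τ R}
    (ha : ∀ i, constantCoeff (a i) = 0) (c : R) {N : ℕ} {f : MvPowerSeries σ R}
    (hf : f ∈ orderIdeal σ R N) :
    subst (fun i => C c * a i) f - C (c ^ N) * subst a f ∈ orderIdeal τ R (N + 1) := by
  intro e he
  have hca : ∀ i, constantCoeff (C c * a i) = 0 := fun i => by simp [ha]
  rw [map_sub, sub_eq_zero, coeff_C_mul, coeff_subst (hasSubst_of_constantCoeff_zero hca),
    coeff_subst (hasSubst_of_constantCoeff_zero ha), mul_finsum' _ _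
      (coeff_subst_finite (hasSubst_of_constantCoeff_zero ha) f e)]
  refine finsum_congr fun d => ?_
  by_cases hd : d.degree < N
  · rw [hf d hd, zero_smul, zero_smul, mul_zero]
  by_cases hd' : d.degree = N
  · have h : (d.prod fun s n => (C c * a s) ^ n) = C (c ^ N) * d.prod fun s n => a s ^ n := by
      simp only [mul_pow, Finsupp.prod_mul]
      congr 1
      rw [← hd', map_pow, Finsupp.degree_apply, Finsupp.prod, Finset.prod_pow_eq_pow_sum]
    rw [h, coeff_C_mul]
    simp only [smul_eq_mul]
    ring
  · rw [prod_mem_orderIdeal ha _ d rfl e (by omega),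
      prod_mem_orderIdeal hca _ d rfl e (by omega)]
    simp

end Finite

/-- The linear part of a tuple of power series. -/
noncomputable def jac (Φ : ι → MvPowerSeries τ R) : Matrix ι τ R :=
  Matrix.of fun i j => coeff (Finsupp.single j 1) (Φ i)

theorem jac_apply (Φ : ι → MvPowerSeries τ R) (i : ι) (j : τ) :
    jac Φ i j = coeff (Finsupp.single j 1) (Φ i) := rfl

/-- The tuple of linear forms with a given matrix. -/
noncomputable def linSeries [Fintype τ] (A : Matrix ι τ R) : ι → MvPowerSeries τ R :=
  fun i => ∑ j, C (A i j) * X j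

theorem constantCoeff_linSeries [Fintype τ] (A : Matrix ι τ R) (i : ι) :
    constantCoeff (linSeries A i) = 0 := by
  simp [linSeries]

theorem jac_linSeries [Fintype τ] (A : Matrix ι τ R) : jac (linSeries A) = A := by
  classical
  ext i j
  simp [jac_apply, linSeries, coeff_C_mul, coeff_X, Finsupp.single_left_inj]

theorem sub_mem_orderIdeal_two {f g : MvPowerSeries τ R}
    (h0 : constantCoeff f = constantCoeff g)
    (h1 : ∀ j, coeff (Finsupp.single j 1) f = coeff (Finsupp.single j 1) g) :
    f - g ∈ orderIdeal τ R 2 := by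
  intro e he
  rw [map_sub, sub_eq_zero]
  rcases Nat.lt_succ_iff_lt_or_eq.mp he with h | h
  · rw [Nat.lt_one_iff, Finsupp.degree_eq_zero_iff] at h
    subst h
    simpa using h0
  · obtain ⟨i, d', rfl, hd'⟩ := Finsupp.exists_eq_add_single h
    rw [Finsupp.degree_eq_zero_iff] at hd'
    subst hd'
    simpa using h1 i

theorem sub_linSeries_jac_mem [Fintype τ] {Φ : ι → MvPowerSeries τ R}
    (h : ∀ i, constantCoeff (Φ i) = 0) (i : ι) :
    Φ i - linSeries (jac Φ) i ∈ orderIdeal τ R 2 :=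
  sub_mem_orderIdeal_two (by rw [h, constantCoeff_linSeries]) fun j => by
    rw [← jac_apply (linSeries _), jac_linSeries, jac_apply]

theorem jac_eq_of_sub_mem {Φ Ψ : ι → MvPowerSeries τ R}
    (h : ∀ i, Φ i - Ψ i ∈ orderIdeal τ R 2) : jac Φ = jac Ψ := by
  ext i j
  have := h i (Finsupp.single j 1) (by simp)
  rwa [map_sub, sub_eq_zero] at this

theorem subst_linSeries [Fintype σ] {a : σ → MvPowerSeries τ R} (ha : ∀ i, constantCoeff (a i) = 0)
    (A : Matrix ι σ R) (i : ι) : subst a (linSeries A i) = ∑ j, C (A i j) * a j := by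
  have h := hasSubst_of_constantCoeff_zero ha
  rw [linSeries, ← coe_substAlgHom h, map_sum]
  refine Finset.sum_congr rfl fun j _ => ?_
  rw [map_mul, substAlgHom_X, coe_substAlgHom]
  congr 1
  exact subst_C _

/-- The chain rule at the origin: terms of `θ` of degree at least two do not reach the linear part.
-/
theorem jac_tupleComp [Fintype σ] {θ : ι → MvPowerSeries σ R} {η : σ → MvPowerSeries τ R}
    (hθ : ∀ i, constantCoeff (θ i) = 0) (hη : ∀ i, constantCoeff (η i) = 0) :
    jac (tupleComp θ η) = jac θ * jac η := by
  have h : jac (tupleComp θ η) = jac (tupleComp (linSeries (jac θ)) η) :=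
    jac_eq_of_sub_mem fun i => by
      rw [tupleComp, tupleComp, ← subst_sub (hasSubst_of_constantCoeff_zero hη)]
      exact subst_mem_orderIdeal hη (sub_linSeries_jac_mem hθ i)
  rw [h]
  ext i j
  rw [jac_apply, tupleComp, subst_linSeries hη, map_sum, Matrix.mul_apply]
  simp [jac_apply, coeff_C_mul]

theorem jac_map {S : Type*} [CommRing S] (φ : R →+* S) (Φ : ι → MvPowerSeries τ R) :
    jac (fun i => MvPowerSeries.map φ (Φ i)) = (jac Φ).map φ := by
  ext i j
  simp [jac_apply]

theorem jac_X [DecidableEq τ] : jac (X : τ → MvPowerSeries τ R) = 1 := by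
  ext i j
  rw [jac_apply, coeff_index_single_X, Matrix.one_apply]
  simp [eq_comm]

theorem tupleComp_assoc {κ : Type*} {θ : ι → MvPowerSeries κ R} {η : κ → MvPowerSeries σ R}
    {ξ : σ → MvPowerSeries τ R} (hη : HasSubst η) (hξ : HasSubst ξ) :
    tupleComp (tupleComp θ η) ξ = tupleComp θ (tupleComp η ξ) :=
  funext fun i => subst_comp_subst_apply hη hξ (θ i)

theorem tupleComp_X (θ : ι → MvPowerSeries σ R) : tupleComp θ X = θ :=
  funext fun i => by rw [tupleComp, subst_self, id]

theorem X_tupleComp {η : σ → MvPowerSeries τ R} (hη : HasSubst η) : tupleComp X η = η :=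
  funext fun i => by rw [tupleComp, subst_X hη]

theorem elim_tupleComp {κ : Type*} (θ : ι → MvPowerSeries σ R) (θ' : κ → MvPowerSeries σ R)
    (η : σ → MvPowerSeries τ R) :
    tupleComp (Sum.elim θ θ') η = Sum.elim (tupleComp θ η) (tupleComp θ' η) := by
  ext1 (i | i) <;> rfl

end MvPowerSeries

/-! ### The Lubin–Tate lemma -/

/-- `R` is `p`-torsion free, `p`-adically separated and complete, and `s` is an endomorphism of
`R` lifting the Frobenius endomorphism of `R / p`. -/
structure IsFrobeniusLift (p : ℕ) {R : Type*} [CommRing R] (s : R →+* R) : Prop where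
  not_isUnit : ¬ IsUnit (p : R)
  regular : ∀ x : R, (p : R) * x = 0 → x = 0
  separated : ∀ x : R, (∀ n, (p : R) ^ n ∣ x) → x = 0
  complete : ∀ a : ℕ → R, ∃ x, ∀ n, (p : R) ^ n ∣ x - ∑ k ∈ Finset.range n, (p : R) ^ k * a k
  frobenius : ∀ x, (p : R) ∣ s x - x ^ p

namespace IsFrobeniusLift

variable {p : ℕ} {R : Type*} [CommRing R] {s : R →+* R}

theorem mul_left_cancel (hs : IsFrobeniusLift p s) {x y : R} (h : (p : R) * x = p * y) : x = y :=
  sub_eq_zero.mp (hs.regular _ (by rw [mul_sub, h, sub_self]))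

theorem pow_mul_left_cancel (hs : IsFrobeniusLift p s) (n : ℕ) {x y : R}
    (h : (p : R) ^ n * x = p ^ n * y) : x = y := by
  induction n with
  | zero => simpa using h
  | succ n ih => exact ih (hs.mul_left_cancel (by rw [← mul_assoc, ← mul_assoc, ← pow_succ', h]))

variable {ι τ : Type*}

/-- The contraction principle for an equation `h = δ + p T(h)` between tuples of power series. -/
theorem exists_eq_add_smul (hs : IsFrobeniusLift p s)
    (T : (ι → MvPowerSeries τ R) →+ (ι → MvPowerSeries τ R)) (δ : ι → MvPowerSeries τ R) (N : ℕ)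
    (hδ : ∀ i, δ i ∈ orderIdeal τ R N)
    (hT : ∀ h, (∀ i, h i ∈ orderIdeal τ R N) → ∀ i, T h i ∈ orderIdeal τ R N) :
    ∃ h : ι → MvPowerSeries τ R, h = δ + p • T h ∧ ∀ i, h i ∈ orderIdeal τ R N := by
  -- The solution is `∑ p ^ k T^k(δ)`, summed coefficient by coefficient.
  choose h hh using fun (i : ι) (e : τ →₀ ℕ) => hs.complete fun k => coeff e (T^[k] δ i)
  let h' : ι → MvPowerSeries τ R := h
  -- The remainder is kept as an exact multiple `p ^ n • y`. Since `T` is additive it commutes with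
  -- multiplication by `p ^ n`, so no continuity of `T` is needed.
  have key : ∀ n, ∃ y : ι → MvPowerSeries τ R,
      h' = ∑ k ∈ Finset.range n, p ^ k • T^[k] δ + p ^ n • y := fun n => by
    choose y₀ hy using fun i e => hh i e n
    let y : ι → MvPowerSeries τ R := y₀
    refine ⟨y, funext fun i => MvPowerSeries.ext fun e => ?_⟩
    have h1 : coeff e (h' i) = h i e := rfl
    have h2 : coeff e ((p ^ n • y) i) = (p : R) ^ n * y₀ i e := by
      rw [Pi.smul_apply, map_nsmul, nsmul_eq_mul, Nat.cast_pow]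
      rfl
    rw [Pi.add_apply, map_add, h1, h2, ← hy, Finset.sum_apply, map_sum]
    simp only [Pi.smul_apply, map_nsmul]
    simp only [nsmul_eq_mul, Nat.cast_pow]
    ring
  refine ⟨h', ?_, fun i e he => ?_⟩
  · refine sub_eq_zero.mp (funext fun i => MvPowerSeries.ext fun e => hs.separated _ fun n => ?_)
    obtain ⟨y, hy⟩ := key n
    obtain ⟨z, hz⟩ := key (n + 1)
    have h1 : h' - (δ + p • T h') = p ^ n • (p • z - p • T y) := by
      have h2 : h' - (δ + p • T h') =
          (∑ k ∈ Finset.range (n + 1), p ^ k • T^[k] δ + p ^ (n + 1) • z) -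
            (δ + p • T (∑ k ∈ Finset.range n, p ^ k • T^[k] δ + p ^ n • y)) := by
        rw [← hy, ← hz]
      rw [h2, map_add, map_sum, map_nsmul, Finset.sum_range_succ', smul_add,
        Finset.smul_sum, smul_sub]
      simp only [map_nsmul, smul_smul, pow_succ', Function.iterate_succ_apply']
      simp only [pow_zero, one_smul, Function.iterate_zero, id, mul_comm (p ^ n) p]
      abel
    rw [h1, Pi.smul_apply, map_nsmul, nsmul_eq_mul, Nat.cast_pow]
    exact dvd_mul_right _ _
  · have hk : ∀ k i, T^[k] δ i ∈ orderIdeal τ R N := fun k => by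
      induction k with
      | zero => exact hδ
      | succ k ih => rw [Function.iterate_succ_apply']; exact hT _ ih
    refine hs.separated _ fun n => ?_
    obtain ⟨y, hy⟩ := key n
    rw [hy, Pi.add_apply, map_add, Finset.sum_apply, map_sum, Finset.sum_eq_zero, zero_add,
      Pi.smul_apply, map_nsmul, nsmul_eq_mul, Nat.cast_pow]
    · exact dvd_mul_right _ _
    · intro k _
      rw [Pi.smul_apply, map_nsmul, hk k i e he, smul_zero]

end IsFrobeniusLift

theorem MvPowerSeries.map_mk_eq_map_mk {R τ : Type*} [CommRing R] {a : R} {f g : MvPowerSeries τ R}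
    (h : ∀ e, a ∣ coeff e (f - g)) :
    MvPowerSeries.map (Ideal.Quotient.mk (Ideal.span {a})) f =
      MvPowerSeries.map (Ideal.Quotient.mk (Ideal.span {a})) g := by
  ext e
  rw [coeff_map, coeff_map, Ideal.Quotient.mk_eq_mk_iff_sub_mem, ← map_sub,
    Ideal.mem_span_singleton]
  exact h e

/-- A power series endomorphism `d` with `d(X) ≡ p A X` modulo degree two and `d(X) ≡ X ^ p`
modulo `p`. -/
structure IsFrobeniusSeries (p : ℕ) {ι R : Type*} [CommRing R] (A : Matrix ι ι R)
    (d : ι → MvPowerSeries ι R) : Prop where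
  constantCoeff_eq_zero : ∀ i, constantCoeff (d i) = 0
  linear : jac d = (p : R) • A
  frobenius : ∀ i e, (p : R) ∣ coeff e (d i - X i ^ p)

/-- `Φ^s ∘ d = f ∘ Φ`. -/
structure Intertwines {ι τ R : Type*} [CommRing R] (s : R →+* R) (d : τ → MvPowerSeries τ R)
    (f : ι → MvPowerSeries ι R) (Φ : ι → MvPowerSeries τ R) : Prop where
  constantCoeff_eq_zero : ∀ i, constantCoeff (Φ i) = 0
  comm : tupleComp (fun i => MvPowerSeries.map s (Φ i)) d = tupleComp f Φ

namespace IsFrobeniusSeries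

variable {p : ℕ} [hp : Fact p.Prime] {R : Type*} [CommRing R] {s : R →+* R}
variable {ι τ : Type*} [Fintype ι] [Fintype τ]

/-- Modulo `p`, `s` raises coefficients to the `p`-th power while `d` and `f` are `X ↦ X ^ p`, so
both terms reduce to `Φ(X) ^ p`. -/
theorem dvd_coeff_sub (hs : IsFrobeniusLift p s) {A : Matrix τ τ R} {B : Matrix ι ι R}
    {d : τ → MvPowerSeries τ R} {f : ι → MvPowerSeries ι R}
    (hd : IsFrobeniusSeries p A d) (hf : IsFrobeniusSeries p B f) {Φ : ι → MvPowerSeries τ R}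
    (hΦ : ∀ i, constantCoeff (Φ i) = 0) (i : ι) (e : τ →₀ ℕ) :
    (p : R) ∣ coeff e (subst d (MvPowerSeries.map s (Φ i)) - subst Φ (f i)) := by
  let k := R ⧸ Ideal.span {(p : R)}
  let q : R →+* k := Ideal.Quotient.mk _
  have hq : ∀ x, q x = 0 ↔ (p : R) ∣ x := fun x =>
    Ideal.Quotient.eq_zero_iff_mem.trans Ideal.mem_span_singleton
  have : Nontrivial k := Ideal.Quotient.nontrivial_iff.mpr
    (by rw [Ne, Ideal.span_singleton_eq_top]; exact hs.not_isUnit)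
  have : CharP k p := by
    refine (CharP.charP_iff_prime_eq_zero hp.out).mpr ?_
    rw [← map_natCast q]
    exact (hq _).mpr dvd_rfl
  have hsq : ∀ g : MvPowerSeries τ R, MvPowerSeries.map q (MvPowerSeries.map s g) =
      MvPowerSeries.map (_root_.frobenius k p) (MvPowerSeries.map q g) := fun g => by
    ext e
    simp only [coeff_map, _root_.frobenius_def]
    rw [← map_pow, ← sub_eq_zero, ← map_sub]
    exact (hq _).mpr (hs.frobenius _)
  have h0 : HasSubst d := hasSubst_of_constantCoeff_zero hd.constantCoeff_eq_zero
  have h1 : HasSubst Φ := hasSubst_of_constantCoeff_zero hΦ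
  rw [← hq, ← coeff_map, map_sub, map_subst h0, map_subst h1, hsq, map_mk_eq_map_mk (hf.frobenius i), map_pow,
    map_X, subst_pow (h1.map q), subst_X (h1.map q)]
  have h2 : (fun i => MvPowerSeries.map q (d i)) = fun i => X i ^ p := funext fun i => by
    rw [map_mk_eq_map_mk (hd.frobenius i), map_pow, map_X]
  have h3 := map_frobenius_expand p hp.out.ne_zero (f := MvPowerSeries.map q (Φ i))
  rw [map_expand, expand, coe_substAlgHom] at h3
  rw [h2, h3, sub_self, map_zero]

end IsFrobeniusSeries

section LubinTate

variable {p : ℕ} {R : Type*} [CommRing R] {s : R →+* R} {ι τ : Type*} [Fintype ι]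

theorem IsFrobeniusLift.mem_orderIdeal_of_C_mul (hs : IsFrobeniusLift p s) {N : ℕ}
    {f : MvPowerSeries τ R} (h : C (p : R) * f ∈ orderIdeal τ R N) : f ∈ orderIdeal τ R N :=
  fun e he => hs.regular _ (by rw [← coeff_C_mul]; exact h e he)

/-- On a series of order `N` only the linear part `p A` of `d` matters to leading order, and it acts
there through `p ^ N`. -/
theorem IsFrobeniusSeries.subst_sub_mem [Fintype τ] {A : Matrix τ τ R} {d : τ → MvPowerSeries τ R}
    (hd : IsFrobeniusSeries p A d) {N : ℕ} (hN : 1 ≤ N) {g : MvPowerSeries τ R}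
    (hg : g ∈ orderIdeal τ R N) :
    subst d g - C ((p : R) ^ N) * subst (linSeries A) g ∈ orderIdeal τ R (N + 1) := by
  obtain ⟨m, rfl⟩ : ∃ m, N = m + 1 := ⟨N - 1, by omega⟩
  have h1 := subst_sub_subst_mem_orderIdeal hd.constantCoeff_eq_zero
    (constantCoeff_linSeries (jac d)) (sub_linSeries_jac_mem hd.constantCoeff_eq_zero) hg
  have h2 : linSeries (jac d) = fun i => C (p : R) * linSeries A i := funext fun i => by
    rw [hd.linear, linSeries, linSeries, Finset.mul_sum]
    refine Finset.sum_congr rfl fun j _ => ?_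
    rw [Matrix.smul_apply, smul_eq_mul, map_mul, mul_assoc]
  have h3 := subst_C_mul_sub_mem_orderIdeal (constantCoeff_linSeries A) (p : R) hg
  rw [h2] at h1
  have h4 := add_mem h1 (orderIdeal_anti (by omega) h3)
  rw [sub_add_sub_cancel] at h4
  exact orderIdeal_anti (by omega) h4

/-- A perturbation of order `N` passes through `f` to leading order by its linear part `p B` alone.
-/
theorem IsFrobeniusSeries.subst_add_sub_mem {B : Matrix ι ι R} {f : ι → MvPowerSeries ι R}
    (hf : IsFrobeniusSeries p B f) {Φ Ψ : ι → MvPowerSeries τ R}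
    (hΦ : ∀ i, constantCoeff (Φ i) = 0) (hΨ : ∀ i, constantCoeff (Ψ i) = 0) {N : ℕ}
    (h : ∀ i, Ψ i - Φ i ∈ orderIdeal τ R N) (i : ι) :
    subst Ψ (f i) - subst Φ (f i) - C (p : R) * ∑ j, C (B i j) * (Ψ j - Φ j) ∈
      orderIdeal τ R (N + 1) := by
  have h1 := subst_sub_subst_mem_orderIdeal (K := 1) hΨ hΦ h
    (sub_linSeries_jac_mem hf.constantCoeff_eq_zero i)
  rw [subst_sub (hasSubst_of_constantCoeff_zero hΦ), subst_sub (hasSubst_of_constantCoeff_zero hΨ),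
    subst_linSeries hΦ, subst_linSeries hΨ] at h1
  convert h1 using 1
  rw [hf.linear]
  simp only [Matrix.smul_apply, smul_eq_mul, map_mul, mul_sub, Finset.sum_sub_distrib,
    Finset.mul_sum, mul_assoc]
  abel

variable [Fintype τ]

/-- One step of the construction of a power series intertwining `d` and `f`. -/
theorem exists_add_mem_orderIdeal [Fact p.Prime] [DecidableEq ι] (hs : IsFrobeniusLift p s)
    {A : Matrix τ τ R} {B B' : Matrix ι ι R} (hB : B * B' = 1)
    {d : τ → MvPowerSeries τ R} {f : ι → MvPowerSeries ι R}
    (hd : IsFrobeniusSeries p A d) (hf : IsFrobeniusSeries p B f) {Φ : ι → MvPowerSeries τ R}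
    (hΦ : ∀ i, constantCoeff (Φ i) = 0) {m : ℕ}
    (h : ∀ i, subst d (MvPowerSeries.map s (Φ i)) - subst Φ (f i) ∈ orderIdeal τ R (m + 2)) :
    ∃ Ψ : ι → MvPowerSeries τ R, (∀ i, Ψ i - Φ i ∈ orderIdeal τ R (m + 2)) ∧
      ∀ i, subst d (MvPowerSeries.map s (Ψ i)) - subst Ψ (f i) ∈ orderIdeal τ R (m + 3) := by
  choose δ₀ hδ₀ using fun i e => hd.dvd_coeff_sub hs hf hΦ i e
  let δ : ι → MvPowerSeries τ R := δ₀
  have hδ : ∀ i, subst d (MvPowerSeries.map s (Φ i)) - subst Φ (f i) = C (p : R) * δ i :=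
    fun i => MvPowerSeries.ext fun e => by rw [coeff_C_mul, hδ₀]; rfl
  have hδm : ∀ i, δ i ∈ orderIdeal τ R (m + 2) := fun i =>
    hs.mem_orderIdeal_of_C_mul (by rw [← hδ]; exact h i)
  have hA : HasSubst (linSeries A) := hasSubst_of_constantCoeff_zero (constantCoeff_linSeries A)
  have hd0 : HasSubst d := hasSubst_of_constantCoeff_zero hd.constantCoeff_eq_zero
  let S : (ι → MvPowerSeries τ R) → ι → MvPowerSeries τ R :=
    fun g i => subst (linSeries A) (MvPowerSeries.map s (g i))
  -- For `Ψ = Φ + g` the error in degree `m + 2` becomes `p δ + p ^ (m + 2) S(g) - p B g`. Divided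
  -- by `p`, it vanishes when `g = B' δ + p T(g)` with `T = p ^ m B' S`.
  let T : (ι → MvPowerSeries τ R) →+ (ι → MvPowerSeries τ R) :=
    { toFun := fun g i => ∑ j, C (B' i j) * (C ((p : R) ^ m) * S g j)
      map_zero' := funext fun i => by
        simp only [S, Pi.zero_apply, map_zero, ← coe_substAlgHom hA, mul_zero,
          Finset.sum_const_zero]
      map_add' := fun g g' => funext fun i => by
        simp only [S, Pi.add_apply, map_add, subst_add hA, mul_add, Finset.sum_add_distrib] }
  have hS : ∀ g : ι → MvPowerSeries τ R, (∀ i, g i ∈ orderIdeal τ R (m + 2)) →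
      ∀ i, S g i ∈ orderIdeal τ R (m + 2) := fun g hg i =>
    subst_mem_orderIdeal (constantCoeff_linSeries A) (map_mem_orderIdeal s (hg i))
  obtain ⟨g, hg, hgm⟩ := hs.exists_eq_add_smul T (fun i => ∑ j, C (B' i j) * δ j) (m + 2)
    (fun i => sum_mem fun j _ => Ideal.mul_mem_left _ _ (hδm j))
    (fun g hg i => sum_mem fun j _ => Ideal.mul_mem_left _ _ (Ideal.mul_mem_left _ _ (hS g hg j)))
  have hg1 : ∀ j, g j = ∑ k, C (B' j k) * (δ k + C ((p : R) ^ (m + 1)) * S g k) := fun j => by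
    have h1 : g j = ∑ k, C (B' j k) * δ k + p • ∑ k, C (B' j k) * (C ((p : R) ^ m) * S g k) :=
      congrFun hg j
    rw [h1, nsmul_eq_mul, Finset.mul_sum, ← Finset.sum_add_distrib]
    refine Finset.sum_congr rfl fun k _ => ?_
    rw [pow_succ, map_mul, map_natCast]
    ring
  have hg2 : ∀ i, ∑ j, C (B i j) * g j = δ i + C ((p : R) ^ (m + 1)) * S g i := fun i => by
    simp_rw [hg1, Finset.mul_sum, ← mul_assoc, ← map_mul]
    rw [Finset.sum_comm]
    simp_rw [← Finset.sum_mul, ← map_sum, ← Matrix.mul_apply, hB, Matrix.one_apply]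
    simp [apply_ite]
  have hg0 : ∀ i, constantCoeff (g i) = 0 := fun i =>
    mem_orderIdeal_one.mp (orderIdeal_anti (by omega) (hgm i))
  have hΨ : ∀ i, constantCoeff ((Φ + g) i) = 0 := fun i => by
    rw [Pi.add_apply, map_add, hΦ, hg0, add_zero]
  refine ⟨Φ + g, fun i => by simpa using hgm i, fun i => ?_⟩
  have h1 := hf.subst_add_sub_mem hΦ hΨ (N := m + 2) (fun i => by simpa using hgm i) i
  have h2 := hd.subst_sub_mem (by omega) (map_mem_orderIdeal s (hgm i))
  convert sub_mem h2 h1 using 1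
  simp only [Pi.add_apply, map_add, subst_add hd0, add_sub_cancel_left, hg2]
  have h3 : subst d (MvPowerSeries.map s (Φ i)) = subst Φ (f i) + C (p : R) * δ i := by
    rw [← hδ]; ring
  rw [h3]
  have h4 : C ((p : R) ^ (m + 2)) * subst (linSeries A) (MvPowerSeries.map s (g i)) =
      C (p : R) * (C ((p : R) ^ (m + 1)) * S g i) := by
    rw [← mul_assoc, ← map_mul, ← pow_succ']
  rw [h4]
  ring

/-- If the two series agree below degree `m + 2`, the leading part of their difference satisfies `B
g = p ^ (m + 1) S(g)`, where `S(g)` is `g^s` composed with the linear map `A`. Iterating, `g` is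
divisible by every power of `p` in that degree, hence zero there by separatedness. -/
theorem Intertwines.ext [DecidableEq ι] (hs : IsFrobeniusLift p s)
    {A : Matrix τ τ R} {B B' : Matrix ι ι R} (hB : B' * B = 1)
    {d : τ → MvPowerSeries τ R} {f : ι → MvPowerSeries ι R}
    (hd : IsFrobeniusSeries p A d) (hf : IsFrobeniusSeries p B f) {Φ Ψ : ι → MvPowerSeries τ R}
    (hΦ : Intertwines s d f Φ) (hΨ : Intertwines s d f Ψ) (hj : jac Φ = jac Ψ) : Φ = Ψ := by
  have hA : HasSubst (linSeries A) := hasSubst_of_constantCoeff_zero (constantCoeff_linSeries A)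
  have hd0 : HasSubst d := hasSubst_of_constantCoeff_zero hd.constantCoeff_eq_zero
  suffices h : ∀ m i, Ψ i - Φ i ∈ orderIdeal τ R (m + 2) from
    funext fun i => (sub_eq_zero.mp (eq_zero_of_forall_mem_orderIdeal fun N =>
      orderIdeal_anti (Nat.le_add_right N 2) (h N i))).symm
  intro m
  induction m with
  | zero =>
    exact fun i => sub_mem_orderIdeal_two
      (by rw [hΦ.constantCoeff_eq_zero, hΨ.constantCoeff_eq_zero])
      fun j => (congrFun (congrFun hj i) j).symm
  | succ m ih =>
    let g : ι → MvPowerSeries τ R := fun i => Ψ i - Φ i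
    let S : (ι → MvPowerSeries τ R) → ι → MvPowerSeries τ R :=
      fun g i => subst (linSeries A) (MvPowerSeries.map s (g i))
    have h1 : ∀ i, C ((p : R) ^ (m + 1)) * S g i - ∑ j, C (B i j) * g j ∈
        orderIdeal τ R (m + 3) := fun i => by
      refine hs.mem_orderIdeal_of_C_mul ?_
      have h1 := hf.subst_add_sub_mem hΦ.constantCoeff_eq_zero hΨ.constantCoeff_eq_zero ih i
      have h2 := hd.subst_sub_mem (by omega) (map_mem_orderIdeal s (ih i))
      have h3 := congrFun hΦ.comm i
      have h4 := congrFun hΨ.comm i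
      simp only [tupleComp] at h3 h4
      convert sub_mem h1 h2 using 1
      rw [← h3, ← h4, map_sub, subst_sub hd0]
      simp only [S, g, map_sub, mul_sub, pow_succ' (p : R) (m + 1), map_mul]
      ring
    have h2 : ∀ i, g i - C ((p : R) ^ (m + 1)) * ∑ j, C (B' i j) * S g j ∈
        orderIdeal τ R (m + 3) := fun i => by
      have h2 : g i = ∑ j, C (B' i j) * ∑ k, C (B j k) * g k := by
        simp_rw [Finset.mul_sum, ← mul_assoc, ← map_mul]
        rw [Finset.sum_comm]
        simp_rw [← Finset.sum_mul, ← map_sum, ← Matrix.mul_apply, hB, Matrix.one_apply]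
        simp [apply_ite]
      have h3 : ∑ j, C (B' i j) * (C ((p : R) ^ (m + 1)) * S g j - ∑ k, C (B j k) * g k) ∈
          orderIdeal τ R (m + 3) := sum_mem fun j _ => Ideal.mul_mem_left _ _ (h1 j)
      rw [← neg_mem_iff]
      convert h3 using 1
      conv_lhs => rw [h2]
      simp only [mul_sub, Finset.sum_sub_distrib, Finset.mul_sum, neg_sub]
      congr 1
      exact Finset.sum_congr rfl fun j _ => by ring
    -- Each pass through `g ≡ p ^ (m + 1) B' S(g)` gains `p ^ (m + 1)`. One factor `p` is recorded,
    -- and the remaining `p ^ m` is absorbed into `w`.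
    have h3 : ∀ n, ∃ w : ι → MvPowerSeries τ R,
        ∀ i, g i - C ((p : R) ^ n) * w i ∈ orderIdeal τ R (m + 3) := fun n => by
      induction n with
      | zero => exact ⟨g, fun i => by simp⟩
      | succ n ihn =>
        obtain ⟨w, hw⟩ := ihn
        refine ⟨fun i => C ((p : R) ^ m) * ∑ j, C (B' i j) * S w j, fun i => ?_⟩
        have h3 : ∀ j, S g j - C ((p : R) ^ n) * S w j ∈ orderIdeal τ R (m + 3) := fun j => by
          have := subst_mem_orderIdeal (constantCoeff_linSeries A) (map_mem_orderIdeal s (hw j))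
          rwa [map_sub, map_mul, map_C, subst_sub hA, subst_mul hA, map_pow, map_natCast,
            subst_C] at this
        have h4 : C ((p : R) ^ (m + 1)) * ∑ j, C (B' i j) * (S g j - C ((p : R) ^ n) * S w j) ∈
            orderIdeal τ R (m + 3) :=
          Ideal.mul_mem_left _ _ (sum_mem fun j _ => Ideal.mul_mem_left _ _ (h3 j))
        convert add_mem (h2 i) h4 using 1
        simp only [mul_sub, Finset.sum_sub_distrib, Finset.mul_sum, pow_succ, map_mul]
        simp only [mul_assoc, mul_comm, mul_left_comm]
        ring
    intro i e he
    refine hs.separated _ fun n => ?_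
    obtain ⟨w, hw⟩ := h3 n
    have := hw i e he
    rw [map_sub, sub_eq_zero, coeff_C_mul] at this
    exact this ▸ dvd_mul_right _ _

/-- The linear form `E` solves the equation modulo degree two, `hE` being its degree-one part
divided by `p`. Corrections of increasing order then converge in the degree filtration. -/
theorem exists_intertwines [Fact p.Prime] [DecidableEq ι] (hs : IsFrobeniusLift p s)
    {A : Matrix τ τ R} {B B' : Matrix ι ι R} (hB : B * B' = 1)
    {d : τ → MvPowerSeries τ R} {f : ι → MvPowerSeries ι R}
    (hd : IsFrobeniusSeries p A d) (hf : IsFrobeniusSeries p B f) (E : Matrix ι τ R)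
    (hE : E.map s * A = B * E) : ∃ Φ, Intertwines s d f Φ ∧ jac Φ = E := by
  let P : ℕ → (ι → MvPowerSeries τ R) → Prop := fun m Φ => (∀ i, constantCoeff (Φ i) = 0) ∧
    ∀ i, subst d (MvPowerSeries.map s (Φ i)) - subst Φ (f i) ∈ orderIdeal τ R (m + 2)
  have h0 : P 0 (linSeries E) := by
    have hc := constantCoeff_linSeries E
    have hsc : ∀ i, constantCoeff (MvPowerSeries.map s (linSeries E i)) = 0 := fun i => by
      rw [constantCoeff_map, hc, map_zero]
    refine ⟨hc, fun i => sub_mem_orderIdeal_two ?_ fun j => ?_⟩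
    · rw [constantCoeff_subst_eq_zero (hasSubst_of_constantCoeff_zero hd.constantCoeff_eq_zero)
        hd.constantCoeff_eq_zero (hsc i), constantCoeff_subst_eq_zero
        (hasSubst_of_constantCoeff_zero hc) hc (hf.constantCoeff_eq_zero i)]
    · have h1 := jac_tupleComp hsc hd.constantCoeff_eq_zero
      have h2 := jac_tupleComp hf.constantCoeff_eq_zero hc
      rw [jac_map, hd.linear, jac_linSeries, Matrix.mul_smul, hE] at h1
      rw [hf.linear, jac_linSeries, Matrix.smul_mul, ← h1] at h2
      exact (congrFun (congrFun h2 i) j).symm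
  have step : ∀ m Φ, P m Φ → ∃ Ψ, P (m + 1) Ψ ∧ ∀ i, Ψ i - Φ i ∈ orderIdeal τ R (m + 2) := by
    rintro m Φ ⟨h1, h2⟩
    obtain ⟨Ψ, h3, h4⟩ := exists_add_mem_orderIdeal hs hB hd hf h1 h2
    refine ⟨Ψ, ⟨fun i => ?_, h4⟩, h3⟩
    have h5 := mem_orderIdeal_one.mp (orderIdeal_anti (by omega) (h3 i))
    rwa [map_sub, h1, sub_zero] at h5
  choose! next hP hnext using step
  let F : ℕ → ι → MvPowerSeries τ R := fun m => Nat.rec (linSeries E) (fun m Φ => next m Φ) m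
  have hF : ∀ m, P m (F m) := fun m => by
    induction m with
    | zero => exact h0
    | succ m ih => exact hP m _ ih
  have hFm : ∀ m k i, F (m + k) i - F m i ∈ orderIdeal τ R (m + 2) := fun m k i => by
    induction k with
    | zero => simp
    | succ k ih =>
      have := add_mem (orderIdeal_anti (by omega) (hnext (m + k) _ (hF (m + k)) i)) ih
      rwa [sub_add_sub_cancel] at this
  -- Stage `m` is final in all degrees below `m + 2`, so the coefficient at `e` has stabilized by
  -- stage `e.degree`.
  let Φ : ι → MvPowerSeries τ R := fun i e => coeff e (F e.degree i)
  have hΦF : ∀ m i, Φ i - F m i ∈ orderIdeal τ R (m + 1) := fun m i e he => by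
    have h1 := hFm e.degree (m - e.degree) i e (by omega)
    rw [show e.degree + (m - e.degree) = m by omega, map_sub, sub_eq_zero] at h1
    rw [map_sub, h1, sub_eq_zero]
    rfl
  have hΦ0 : ∀ i, constantCoeff (Φ i) = 0 := fun i => by
    have := mem_orderIdeal_one.mp (hΦF 0 i)
    rwa [map_sub, (hF 0).1, sub_zero] at this
  refine ⟨Φ, ⟨hΦ0, funext fun i => sub_eq_zero.mp (eq_zero_of_forall_mem_orderIdeal fun N => ?_)⟩,
    ?_⟩
  · have hd0 : HasSubst d := hasSubst_of_constantCoeff_zero hd.constantCoeff_eq_zero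
    have h1 := subst_mem_orderIdeal hd.constantCoeff_eq_zero (map_mem_orderIdeal s (hΦF N i))
    rw [map_sub, subst_sub hd0] at h1
    have h2 := subst_sub_subst_mem_orderIdeal (K := 0) hΦ0 (hF N).1 (hΦF N)
      (mem_orderIdeal_one.mpr (hf.constantCoeff_eq_zero i))
    have h3 := add_mem (sub_mem h1 (orderIdeal_anti (by omega) h2))
      (orderIdeal_anti (by omega) ((hF N).2 i))
    refine orderIdeal_anti (Nat.le_succ N) ?_
    convert h3 using 1
    simp only [tupleComp]
    abel
  · rw [jac_eq_of_sub_mem (hΦF 1), ← jac_linSeries E]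
    exact jac_eq_of_sub_mem (hFm 0 1)

end LubinTate

/-! ### Formal group laws from the Lubin–Tate lemma -/

namespace MvPowerSeries

variable {ι κ τ R : Type*} [CommRing R]

theorem jac_elim (a : ι → MvPowerSeries τ R) (b : κ → MvPowerSeries τ R) :
    jac (Sum.elim a b) = Matrix.fromRows (jac a) (jac b) := by
  ext (i | i) j <;> rfl

theorem jac_zero : jac (0 : ι → MvPowerSeries τ R) = 0 := by
  ext i j
  simp [jac_apply]

theorem jac_X_inl [DecidableEq ι] [DecidableEq κ] :
    jac (fun i => (X (Sum.inl i) : MvPowerSeries (ι ⊕ κ) R)) = Matrix.fromCols 1 0 := by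
  ext i (j | j)
  · rw [jac_apply, coeff_index_single_X]
    simp [Matrix.one_apply, eq_comm]
  · rw [jac_apply, coeff_index_single_X]
    simp

theorem jac_X_inr [DecidableEq ι] [DecidableEq κ] :
    jac (fun i => (X (Sum.inr i) : MvPowerSeries (ι ⊕ κ) R)) = Matrix.fromCols 0 1 := by
  ext i (j | j)
  · rw [jac_apply, coeff_index_single_X]
    simp
  · rw [jac_apply, coeff_index_single_X]
    simp [Matrix.one_apply, eq_comm]

/-- The direct sum of two endomorphisms. -/
noncomputable def sumSeries (d : ι → MvPowerSeries ι R) (d' : κ → MvPowerSeries κ R) :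
    ι ⊕ κ → MvPowerSeries (ι ⊕ κ) R :=
  Sum.elim (tupleComp d fun i => X (Sum.inl i)) (tupleComp d' fun i => X (Sum.inr i))

theorem map_elim {S : Type*} [CommRing S] (φ : R →+* S) (a : ι → MvPowerSeries τ R)
    (b : κ → MvPowerSeries τ R) :
    (fun i => MvPowerSeries.map φ (Sum.elim a b i)) =
      Sum.elim (fun i => MvPowerSeries.map φ (a i)) (fun i => MvPowerSeries.map φ (b i)) := by
  ext1 (i | i) <;> rfl

theorem tupleComp_inl {σ : Type*} [Finite ι] [Finite κ] (θ : σ → MvPowerSeries ι R)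
    {a : ι → MvPowerSeries τ R}
    {b : κ → MvPowerSeries τ R} (h : HasSubst (Sum.elim a b)) :
    tupleComp (tupleComp θ fun i => X (Sum.inl i)) (Sum.elim a b) = tupleComp θ a := by
  rw [tupleComp_assoc (hasSubst_of_constantCoeff_zero (by simp)) h]
  congr 1
  ext1 i
  rw [tupleComp, subst_X h, Sum.elim_inl]

theorem tupleComp_inr {σ : Type*} [Finite ι] [Finite κ] (θ : σ → MvPowerSeries κ R)
    {a : ι → MvPowerSeries τ R}
    {b : κ → MvPowerSeries τ R} (h : HasSubst (Sum.elim a b)) :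
    tupleComp (tupleComp θ fun i => X (Sum.inr i)) (Sum.elim a b) = tupleComp θ b := by
  rw [tupleComp_assoc (hasSubst_of_constantCoeff_zero (by simp)) h]
  congr 1
  ext1 i
  rw [tupleComp, subst_X h, Sum.elim_inr]

theorem constantCoeff_elim {a : ι → MvPowerSeries τ R} {b : κ → MvPowerSeries τ R}
    (ha : ∀ i, constantCoeff (a i) = 0) (hb : ∀ i, constantCoeff (b i) = 0) (i : ι ⊕ κ) :
    constantCoeff (Sum.elim a b i) = 0 := by
  rcases i with i | i <;> simp [ha, hb]

end MvPowerSeries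

namespace Intertwines

variable {ι κ σ τ R : Type*} [CommRing R] {s : R →+* R}

theorem hasSubst [Finite ι] {d : τ → MvPowerSeries τ R} {f : ι → MvPowerSeries ι R}
    {Φ : ι → MvPowerSeries τ R} (h : Intertwines s d f Φ) : HasSubst Φ :=
  hasSubst_of_constantCoeff_zero h.constantCoeff_eq_zero

protected theorem X [Finite τ] {d : τ → MvPowerSeries τ R}
    (hd : ∀ i, constantCoeff (d i) = 0) : Intertwines s d d X :=
  ⟨by simp, by
    simp only [map_X]
    exact (X_tupleComp (hasSubst_of_constantCoeff_zero hd)).trans (tupleComp_X d).symm⟩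

protected theorem zero [Finite ι] [Finite τ] {d : τ → MvPowerSeries τ R}
    {f : ι → MvPowerSeries ι R} (hd : ∀ i, constantCoeff (d i) = 0)
    (hf : ∀ i, constantCoeff (f i) = 0) : Intertwines s d f 0 :=
  ⟨by simp, funext fun i => by
    have hd := hasSubst_of_constantCoeff_zero hd
    rw [tupleComp, tupleComp, Pi.zero_apply, map_zero, ← coe_substAlgHom hd, map_zero]
    exact (subst_zero_of_constantCoeff_zero (hf i)).symm⟩

theorem comp [Finite ι] [Finite κ] [Finite τ] {d : τ → MvPowerSeries τ R}
    {f : ι → MvPowerSeries ι R}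
    {g : κ → MvPowerSeries κ R} (hd : ∀ i, constantCoeff (d i) = 0)
    (hf : ∀ i, constantCoeff (f i) = 0) {Φ : ι → MvPowerSeries τ R}
    {Ψ : κ → MvPowerSeries ι R} (hΨ : Intertwines s f g Ψ) (hΦ : Intertwines s d f Φ) :
    Intertwines s d g (tupleComp Ψ Φ) where
  constantCoeff_eq_zero i :=
    constantCoeff_subst_eq_zero hΦ.hasSubst hΦ.constantCoeff_eq_zero (hΨ.constantCoeff_eq_zero i)
  comm := by
    have hd := hasSubst_of_constantCoeff_zero hd
    have hf := hasSubst_of_constantCoeff_zero hf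
    rw [← FormalGroupLaw.map_tupleComp s hΦ.hasSubst, tupleComp_assoc (hΦ.hasSubst.map s) hd,
      hΦ.comm, ← tupleComp_assoc hf hΦ.hasSubst, hΨ.comm,
      tupleComp_assoc hΨ.hasSubst hΦ.hasSubst]

theorem elim [Finite ι] [Finite κ] {d : τ → MvPowerSeries τ R} {f : ι → MvPowerSeries ι R}
    {g : κ → MvPowerSeries κ R} {Φ : ι → MvPowerSeries τ R} {Ψ : κ → MvPowerSeries τ R}
    (hΦ : Intertwines s d f Φ) (hΨ : Intertwines s d g Ψ) :
    Intertwines s d (sumSeries f g) (Sum.elim Φ Ψ) := by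
  have h0 := constantCoeff_elim hΦ.constantCoeff_eq_zero hΨ.constantCoeff_eq_zero
  have h1 := hasSubst_of_constantCoeff_zero h0
  refine ⟨h0, ?_⟩
  rw [MvPowerSeries.map_elim, elim_tupleComp, hΦ.comm, hΨ.comm, sumSeries, elim_tupleComp,
    tupleComp_inl f h1, tupleComp_inr g h1]

end Intertwines

theorem constantCoeff_sumSeries {ι κ R : Type*} [CommRing R] [Finite ι] [Finite κ]
    {d : ι → MvPowerSeries ι R} {d' : κ → MvPowerSeries κ R} (hd : ∀ i, constantCoeff (d i) = 0)
    (hd' : ∀ i, constantCoeff (d' i) = 0) (i : ι ⊕ κ) : constantCoeff (sumSeries d d' i) = 0 :=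
  constantCoeff_elim
    (fun i => constantCoeff_subst_eq_zero (hasSubst_of_constantCoeff_zero (by simp)) (by simp)
      (hd i))
    (fun i => constantCoeff_subst_eq_zero (hasSubst_of_constantCoeff_zero (by simp)) (by simp)
      (hd' i)) i

theorem Intertwines.X_inl {ι κ R : Type*} [CommRing R] [Finite ι] [Finite κ] {s : R →+* R}
    {d : ι → MvPowerSeries ι R} {d' : κ → MvPowerSeries κ R} (hd : ∀ i, constantCoeff (d i) = 0)
    (hd' : ∀ i, constantCoeff (d' i) = 0) :
    Intertwines s (sumSeries d d') d fun i => X (Sum.inl i) :=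
  ⟨by simp, funext fun i => by
    have h := hasSubst_of_constantCoeff_zero (constantCoeff_sumSeries hd hd')
    simp only [tupleComp, map_X, subst_X h]
    rfl⟩

theorem Intertwines.X_inr {ι κ R : Type*} [CommRing R] [Finite ι] [Finite κ] {s : R →+* R}
    {d : ι → MvPowerSeries ι R} {d' : κ → MvPowerSeries κ R} (hd : ∀ i, constantCoeff (d i) = 0)
    (hd' : ∀ i, constantCoeff (d' i) = 0) :
    Intertwines s (sumSeries d d') d' fun i => X (Sum.inr i) :=
  ⟨by simp, funext fun i => by
    have h := hasSubst_of_constantCoeff_zero (constantCoeff_sumSeries hd hd')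
    simp only [tupleComp, map_X, subst_X h]
    rfl⟩

theorem MvPowerSeries.dvd_coeff_subst {σ τ R : Type*} [CommRing R] {a : σ → MvPowerSeries τ R}
    (ha : HasSubst a) {c : R} {f : MvPowerSeries σ R} (hf : ∀ e, c ∣ coeff e f) (e : τ →₀ ℕ) :
    c ∣ coeff e (subst a f) := by
  choose g hg using hf
  let g' : MvPowerSeries σ R := g
  have h : f = C c * g' := MvPowerSeries.ext fun e => by rw [hg, coeff_C_mul]; rfl
  rw [h, subst_mul ha, subst_C, coeff_C_mul]
  exact dvd_mul_right _ _

theorem IsFrobeniusSeries.sumSeries {p : ℕ} {ι κ R : Type*} [CommRing R] [Fintype ι]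
    [Fintype κ] [DecidableEq ι] [DecidableEq κ] {A : Matrix ι ι R} {A' : Matrix κ κ R}
    {d : ι → MvPowerSeries ι R} {d' : κ → MvPowerSeries κ R} (hd : IsFrobeniusSeries p A d)
    (hd' : IsFrobeniusSeries p A' d') :
    IsFrobeniusSeries p (Matrix.fromBlocks A 0 0 A') (sumSeries d d') where
  constantCoeff_eq_zero := constantCoeff_sumSeries hd.constantCoeff_eq_zero hd'.constantCoeff_eq_zero
  linear := by
    rw [MvPowerSeries.sumSeries, jac_elim, jac_tupleComp hd.constantCoeff_eq_zero (by simp),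
      jac_tupleComp hd'.constantCoeff_eq_zero (by simp), jac_X_inl, jac_X_inr, hd.linear, hd'.linear]
    ext (i | i) (j | j) <;> simp [Matrix.mul_fromCols]
  frobenius := by
    rintro (i | i) e
    · have h : HasSubst fun i => (X (Sum.inl i) : MvPowerSeries (ι ⊕ κ) R) :=
        hasSubst_of_constantCoeff_zero (by simp)
      have := dvd_coeff_subst h (hd.frobenius i) e
      rwa [subst_sub h, subst_pow h, subst_X h] at this
    · have h : HasSubst fun i => (X (Sum.inr i) : MvPowerSeries (ι ⊕ κ) R) :=
        hasSubst_of_constantCoeff_zero (by simp)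
      have := dvd_coeff_subst h (hd'.frobenius i) e
      rwa [subst_sub h, subst_pow h, subst_X h] at this

namespace FormalGroupLaw

variable {r : ℕ} {R : Type*} [CommRing R]

theorem jac_toSeries (F : FormalGroupLaw r R) : jac F.toSeries = Matrix.fromCols 1 1 := by
  have h1 := congrArg jac F.X_zero
  have h2 := congrArg jac F.zero_X
  rw [jac_tupleComp F.constantCoeff_eq_zero (constantCoeff_elim (by simp) (by simp)), jac_elim,
    jac_zero, jac_X] at h1 h2
  rw [← Matrix.fromCols_toCols (jac F.toSeries), Matrix.fromCols_mul_fromRows] at h1 h2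
  rw [← Matrix.fromCols_toCols (jac F.toSeries)]
  simp only [Matrix.mul_one, Matrix.mul_zero, add_zero, zero_add] at h1 h2
  rw [h1, h2]

/-- That `d` is an endomorphism of `F` is itself an intertwining relation, for `d` acting separately
on both groups of variables. This brings formal group laws within reach of the uniqueness statement.
-/
theorem intertwines_toSeries {s : R →+* R} {F : FormalGroupLaw r R}
    {d : Fin r → MvPowerSeries (Fin r) R} (hd : F.IsHom F d)
    (hF : ∀ i, MvPowerSeries.map s (F.toSeries i) = F.toSeries i) :
    Intertwines s (sumSeries d d) d F.toSeries :=
  ⟨F.constantCoeff_eq_zero, by simp only [hF]; exact hd.2.symm⟩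

/-- Power series intertwining Lubin–Tate endomorphisms are homomorphisms. -/
theorem isHom_of_intertwines {p : ℕ} {s : R →+* R} (hs : IsFrobeniusLift p s)
    {F G : FormalGroupLaw r R} {d f θ : Fin r → MvPowerSeries (Fin r) R}
    {A B B' : Matrix (Fin r) (Fin r) R} (hB : B' * B = 1) (hd : IsFrobeniusSeries p A d)
    (hf : IsFrobeniusSeries p B f) (hF : Intertwines s (sumSeries d d) d F.toSeries)
    (hG : Intertwines s (sumSeries f f) f G.toSeries) (hθ : Intertwines s d f θ) :
    F.IsHom G θ := by
  have hd0 := hd.constantCoeff_eq_zero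
  have hf0 := hf.constantCoeff_eq_zero
  have hdd := hd.sumSeries hd
  have hff := hf.sumSeries hf
  have hl := hθ.comp hdd.constantCoeff_eq_zero hd0 (Intertwines.X_inl hd0 hd0)
  have hr := hθ.comp hdd.constantCoeff_eq_zero hd0 (Intertwines.X_inr hd0 hd0)
  have hlr := hl.elim hr
  refine ⟨hθ.constantCoeff_eq_zero, Intertwines.ext hs hB hdd hf
    (hθ.comp hdd.constantCoeff_eq_zero hd0 hF)
    (hG.comp hdd.constantCoeff_eq_zero hff.constantCoeff_eq_zero hlr) ?_⟩
  rw [jac_tupleComp hθ.constantCoeff_eq_zero F.constantCoeff_eq_zero,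
    jac_tupleComp G.constantCoeff_eq_zero hlr.constantCoeff_eq_zero, jac_elim,
    jac_tupleComp hθ.constantCoeff_eq_zero (by simp),
    jac_tupleComp hθ.constantCoeff_eq_zero (by simp), F.jac_toSeries, G.jac_toSeries,
    jac_X_inl, jac_X_inr, Matrix.fromCols_mul_fromRows]
  ext i (j | j) <;> simp [Matrix.mul_fromCols]

/-- `F` is the intertwiner with linear part `X + Y`. Each axiom follows from uniqueness, and because
`s` is the identity the intertwining relation already says that `d` is an endomorphism. -/
theorem exists_isHom_of_isFrobeniusSeries {p : ℕ} [Fact p.Prime]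
    (hs : IsFrobeniusLift p (RingHom.id R)) {B B' : Matrix (Fin r) (Fin r) R} (hB : B * B' = 1)
    {d : Fin r → MvPowerSeries (Fin r) R} (hd : IsFrobeniusSeries p B d) :
    ∃ F : FormalGroupLaw r R, F.IsHom F d := by
  have hB' := mul_eq_one_comm.mp hB
  have hd0 := hd.constantCoeff_eq_zero
  have hdd := hd.sumSeries hd
  have hdd0 := hdd.constantCoeff_eq_zero
  have hddd := hd.sumSeries hdd
  have hddd0 := hddd.constantCoeff_eq_zero
  obtain ⟨F, hF, hFj⟩ := exists_intertwines hs hB hdd hd (Matrix.fromCols 1 1) (by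
    ext i (j | j) <;> simp [Matrix.fromCols_mul_fromBlocks, Matrix.mul_fromCols])
  -- Substituting intertwiners into `F` gives an intertwiner whose linear part is the sum, so the
  -- axioms reduce to identities between sums of linear forms.
  have key : ∀ {τ : Type} [Fintype τ] {D : τ → MvPowerSeries τ R}
      {a b : Fin r → MvPowerSeries τ R}, (∀ i, constantCoeff (D i) = 0) →
      Intertwines (RingHom.id R) D d a → Intertwines (RingHom.id R) D d b →
      Intertwines (RingHom.id R) D d (tupleComp F (Sum.elim a b)) ∧
        jac (tupleComp F (Sum.elim a b)) = jac a + jac b := by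
    intro τ _ D a b hD ha hb
    have hab := ha.elim hb
    refine ⟨hF.comp hD hdd0 hab, ?_⟩
    rw [jac_tupleComp hF.constantCoeff_eq_zero hab.constantCoeff_eq_zero, hFj, jac_elim,
      Matrix.fromCols_mul_fromRows, Matrix.one_mul, Matrix.one_mul]
  have hX : Intertwines (RingHom.id R) d d X := Intertwines.X hd0
  have h0 : Intertwines (RingHom.id R) d d 0 := Intertwines.zero hd0 hd0
  have hl : Intertwines (RingHom.id R) (sumSeries d d) d _ := Intertwines.X_inl hd0 hd0
  have hr : Intertwines (RingHom.id R) (sumSeries d d) d _ := Intertwines.X_inr hd0 hd0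
  have h1 : Intertwines (RingHom.id R) (sumSeries d (sumSeries d d)) d _ :=
    Intertwines.X_inl hd0 hdd0
  have h23 : Intertwines (RingHom.id R) (sumSeries d (sumSeries d d)) (sumSeries d d) _ :=
    Intertwines.X_inr hd0 hdd0
  have h2 : Intertwines (RingHom.id R) (sumSeries d (sumSeries d d)) d
      (fun j => X (Sum.inr (Sum.inl j))) := by
    have h := hl.comp hddd0 hdd0 h23
    have h' : tupleComp (fun i => X (Sum.inl i)) (fun i => X (Sum.inr i)) =
        fun j => (X (Sum.inr (Sum.inl j)) : MvPowerSeries (Fin r ⊕ Fin r ⊕ Fin r) R) :=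
      funext fun j => subst_X h23.hasSubst _
    rwa [h'] at h
  have h3 : Intertwines (RingHom.id R) (sumSeries d (sumSeries d d)) d
      (fun j => X (Sum.inr (Sum.inr j))) := by
    have h := hr.comp hddd0 hdd0 h23
    have h' : tupleComp (fun i => X (Sum.inr i)) (fun i => X (Sum.inr i)) =
        fun j => (X (Sum.inr (Sum.inr j)) : MvPowerSeries (Fin r ⊕ Fin r ⊕ Fin r) R) :=
      funext fun j => subst_X h23.hasSubst _
    rwa [h'] at h
  refine ⟨⟨F, hF.constantCoeff_eq_zero, ?_, ?_, ?_, ?_⟩, hd0, ?_⟩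
  · have h := key hd0 hX h0
    exact Intertwines.ext hs hB' hd hd h.1 hX (by rw [h.2, jac_zero, add_zero])
  · have h := key hd0 h0 hX
    exact Intertwines.ext hs hB' hd hd h.1 hX (by rw [h.2, jac_zero, zero_add])
  · have h12 := key hddd0 h1 h2
    have h23 := key hddd0 h2 h3
    have h123 := key hddd0 h12.1 h3
    have h123' := key hddd0 h1 h23.1
    exact Intertwines.ext hs hB' hddd hd h123.1 h123'.1
      (by rw [h123.2, h123'.2, h12.2, h23.2, add_assoc])
  · have h := key hdd0 hr hl
    refine Intertwines.ext hs hB' hdd hd h.1 hF ?_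
    rw [h.2, hFj, jac_X_inl, jac_X_inr]
    ext i (j | j) <;> simp
  · have := hF.comm
    simp only [MvPowerSeries.map_id, RingHom.id_apply] at this
    exact this.symm

end FormalGroupLaw

/-! ### Endomorphisms of the multiplicative group -/

section Binomial

variable {p : ℕ} [hp : Fact p.Prime] {τ : Type*}

/-- The power `f ^ a` of a power series `f` with constant coefficient one. -/
noncomputable def MvPowerSeries.padicPow (f : MvPowerSeries τ ℤ_[p]) (a : ℤ_[p]) :
    MvPowerSeries τ ℤ_[p] :=
  (PowerSeries.binomialSeries ℤ_[p] a).subst (f - 1)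

namespace MvPowerSeries

theorem hasSubst_sub_one {f : MvPowerSeries τ ℤ_[p]} (hf : constantCoeff f = 1) :
    PowerSeries.HasSubst (f - 1) :=
  PowerSeries.HasSubst.of_constantCoeff_zero (by simp [hf])

theorem padicPow_natCast {f : MvPowerSeries τ ℤ_[p]} (hf : constantCoeff f = 1) (n : ℕ) :
    padicPow f n = f ^ n := by
  have h := hasSubst_sub_one hf
  rw [padicPow, PowerSeries.binomialSeries_nat, PowerSeries.subst_pow h, PowerSeries.subst_add h,
    PowerSeries.subst_X h, ← map_one (PowerSeries.C (R := ℤ_[p])), PowerSeries.subst_C, map_one]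
  simp

theorem padicPow_add {f : MvPowerSeries τ ℤ_[p]} (hf : constantCoeff f = 1) (a b : ℤ_[p]) :
    padicPow f (a + b) = padicPow f a * padicPow f b := by
  rw [padicPow, PowerSeries.binomialSeries_add, PowerSeries.subst_mul (hasSubst_sub_one hf)]
  rfl

theorem constantCoeff_padicPow {f : MvPowerSeries τ ℤ_[p]} (hf : constantCoeff f = 1)
    (a : ℤ_[p]) : constantCoeff (padicPow f a) = 1 := by
  have h := hasSubst_sub_one hf
  have h1 : PowerSeries.binomialSeries ℤ_[p] a =
      (PowerSeries.binomialSeries ℤ_[p] a - PowerSeries.C 1) + PowerSeries.C 1 := by ring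
  rw [padicPow, h1, PowerSeries.subst_add h, PowerSeries.subst_C, map_add,
    PowerSeries.constantCoeff_subst_eq_zero (by simp [hf]) _ (by simp)]
  simp

/-- Since `f - 1` has no constant term, only the binomial terms with `k ≤ e.degree` contribute: a
finite combination of the continuous functions `a ↦ Ring.choose a k`. The power laws below then
extend from `ℕ` to `ℤ_p` by density. -/
theorem continuous_coeff_padicPow {f : MvPowerSeries τ ℤ_[p]} (hf : constantCoeff f = 1)
    (e : τ →₀ ℕ) : Continuous fun a => coeff e (padicPow f a) := by
  have h : ∀ a : ℤ_[p], coeff e (padicPow f a) =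
      ∑ k ∈ Finset.range (e.degree + 1), Ring.choose a k * coeff e ((f - 1) ^ k) := fun a => by
    rw [padicPow, PowerSeries.coeff_subst (hasSubst_sub_one hf)]
    rw [finsum_eq_sum_of_support_subset (s := Finset.range (e.degree + 1))]
    · simp
    · intro k hk
      rw [Function.mem_support] at hk
      simp only [Finset.coe_range, Set.mem_Iio]
      by_contra! hlt
      refine hk ?_
      have : (f - 1) ^ k ∈ orderIdeal τ ℤ_[p] k := by
        have := prod_mem_orderIdeal (a := fun _ : Unit => f - 1) (by simp [hf]) k
          (Finsupp.single () k) (by simp)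
        simpa using this
      rw [this e (by omega), smul_zero]
  simp only [h]
  exact continuous_finsetSum _ fun k _ => (PadicInt.continuous_choose k).mul continuous_const

/-- Two families of power series with continuous coefficients agree if they do at `ℕ`. -/
theorem eq_of_continuous_coeff {F G : ℤ_[p] → MvPowerSeries τ ℤ_[p]}
    (hF : ∀ e, Continuous fun a => coeff e (F a)) (hG : ∀ e, Continuous fun a => coeff e (G a))
    (h : ∀ n : ℕ, F n = G n) (a : ℤ_[p]) : F a = G a := by
  ext e
  exact congrFun (PadicInt.denseRange_natCast.equalizer (hF e) (hG e)
    (funext fun n => by simp [h])) a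

theorem mul_padicPow {f g : MvPowerSeries τ ℤ_[p]} (hf : constantCoeff f = 1)
    (hg : constantCoeff g = 1) (a : ℤ_[p]) :
    padicPow (f * g) a = padicPow f a * padicPow g a := by
  have hfg : constantCoeff (f * g) = 1 := by simp [hf, hg]
  refine eq_of_continuous_coeff (F := padicPow (f * g)) (G := fun a => padicPow f a * padicPow g a)
    (continuous_coeff_padicPow hfg) (fun e => ?_) (fun n => ?_) a
  · classical
    simp only [coeff_mul]
    exact continuous_finsetSum _ fun k _ =>
      (continuous_coeff_padicPow hf _).mul (continuous_coeff_padicPow hg _)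
  · simp only [padicPow_natCast hfg, padicPow_natCast hf, padicPow_natCast hg, mul_pow]

theorem padicPow_mul {f : MvPowerSeries τ ℤ_[p]} (hf : constantCoeff f = 1) (a b : ℤ_[p]) :
    padicPow f (a * b) = padicPow (padicPow f a) b := by
  refine eq_of_continuous_coeff (F := fun b => padicPow f (a * b))
    (G := fun b => padicPow (padicPow f a) b)
    (fun e => (continuous_coeff_padicPow hf e).comp (continuous_const_mul a))
    (continuous_coeff_padicPow (constantCoeff_padicPow hf a)) (fun n => ?_) b
  simp only [padicPow_natCast (constantCoeff_padicPow hf a)]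
  induction n with
  | zero => simpa using padicPow_natCast hf 0
  | succ n ih => rw [Nat.cast_succ, mul_add, padicPow_add hf, ih, mul_one, pow_succ]

theorem one_padicPow (a : ℤ_[p]) : padicPow (1 : MvPowerSeries τ ℤ_[p]) a = 1 := by
  -- The power is a unit equal to its own square.
  have h := mul_padicPow (f := (1 : MvPowerSeries τ ℤ_[p])) (g := 1) (by simp) (by simp) a
  rw [one_mul] at h
  have hu : IsUnit (padicPow (1 : MvPowerSeries τ ℤ_[p]) a) := by
    rw [MvPowerSeries.isUnit_iff_constantCoeff, constantCoeff_padicPow (by simp)]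
    exact isUnit_one
  exact hu.mul_left_cancel (by rw [← h, mul_one])

theorem prod_padicPow {ι : Type*} (s : Finset ι) {f : ι → MvPowerSeries τ ℤ_[p]}
    (hf : ∀ i, constantCoeff (f i) = 1) (a : ℤ_[p]) :
    padicPow (∏ i ∈ s, f i) a = ∏ i ∈ s, padicPow (f i) a := by
  classical
  induction s using Finset.induction_on with
  | empty => exact one_padicPow a
  | insert i s hi ih =>
    rw [Finset.prod_insert hi, Finset.prod_insert hi, mul_padicPow (hf i) _ a, ih]
    rw [map_prod]
    exact Finset.prod_eq_one fun i _ => hf i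

theorem padicPow_sum {ι : Type*} (s : Finset ι) {f : MvPowerSeries τ ℤ_[p]}
    (hf : constantCoeff f = 1) (a : ι → ℤ_[p]) :
    padicPow f (∑ i ∈ s, a i) = ∏ i ∈ s, padicPow f (a i) := by
  classical
  induction s using Finset.induction_on with
  | empty => simpa using padicPow_natCast hf 0
  | insert i s hi ih => rw [Finset.sum_insert hi, Finset.prod_insert hi, padicPow_add hf, ih]

theorem subst_padicPow {σ : Type*} {η : σ → MvPowerSeries τ ℤ_[p]} (hη : HasSubst η)
    {f : MvPowerSeries σ ℤ_[p]} (hf : constantCoeff f = 1) (a : ℤ_[p]) :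
    subst η (padicPow f a) = padicPow (subst η f) a := by
  have h1 : subst η (1 : MvPowerSeries σ ℤ_[p]) = 1 := by rw [← coe_substAlgHom hη, map_one]
  have h2 : subst η f - 1 = subst η (f - 1) := by rw [subst_sub hη, h1]
  rw [padicPow, padicPow, h2]
  exact subst_comp_subst_apply (PowerSeries.HasSubst.const (hasSubst_sub_one hf)) hη _

theorem coeff_single_mul {f g : MvPowerSeries τ ℤ_[p]} (hf : constantCoeff f = 1)
    (hg : constantCoeff g = 1) (j : τ) : coeff (Finsupp.single j 1) (f * g) =
      coeff (Finsupp.single j 1) f + coeff (Finsupp.single j 1) g := by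
  have h : (f - 1) * (g - 1) ∈ orderIdeal τ ℤ_[p] (1 + 1) :=
    mul_mem_orderIdeal (mem_orderIdeal_one.mpr (by simp [hf])) (mem_orderIdeal_one.mpr (by simp [hg]))
  have h1 := h (Finsupp.single j 1) (by simp)
  have h2 : f * g = (f - 1) * (g - 1) + f + g - 1 := by ring
  have h3 : coeff (Finsupp.single j 1) (1 : MvPowerSeries τ ℤ_[p]) = 0 := by
    classical
    rw [coeff_one, if_neg (by simp)]
  rw [h2, map_sub, map_add, map_add, h1, h3]
  ring

theorem coeff_single_prod {ι : Type*} (s : Finset ι) {f : ι → MvPowerSeries τ ℤ_[p]}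
    (hf : ∀ i, constantCoeff (f i) = 1) (j : τ) :
    coeff (Finsupp.single j 1) (∏ i ∈ s, f i) = ∑ i ∈ s, coeff (Finsupp.single j 1) (f i) := by
  classical
  induction s using Finset.induction_on with
  | empty => rw [Finset.prod_empty, Finset.sum_empty, coeff_one, if_neg (by simp)]
  | insert i s hi ih =>
    rw [Finset.prod_insert hi, Finset.sum_insert hi, coeff_single_mul (hf i) _ j, ih]
    rw [map_prod]
    exact Finset.prod_eq_one fun i _ => hf i

theorem coeff_single_padicPow {f : MvPowerSeries τ ℤ_[p]} (hf : constantCoeff f = 1)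
    (a : ℤ_[p]) (j : τ) : coeff (Finsupp.single j 1) (padicPow f a) =
      a * coeff (Finsupp.single j 1) f := by
  refine congrFun (PadicInt.denseRange_natCast.equalizer
    (continuous_coeff_padicPow hf (Finsupp.single j 1)) (continuous_mul_const _)
    (funext fun n => ?_)) a
  simp only [Function.comp_apply, padicPow_natCast hf]
  have := coeff_single_prod (Finset.range n) (f := fun _ => f) (fun _ => hf) j
  simpa using this

end MvPowerSeries

variable {r : ℕ} (S : Type*) [CommRing S] [Algebra ℤ_[p] S]

theorem one_add_multiplicativeEnd (A : Matrix (Fin r) (Fin r) ℤ_[p]) (i : Fin r) :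
    1 + multiplicativeEnd ℤ_[p] A i = ∏ j, padicPow (1 + X j) (A i j) := by
  simp [multiplicativeEnd, padicPow]

theorem constantCoeff_one_add_X (j : τ) :
    constantCoeff (1 + X j : MvPowerSeries τ ℤ_[p]) = 1 := by simp

theorem constantCoeff_multiplicativeEnd (A : Matrix (Fin r) (Fin r) ℤ_[p]) (i : Fin r) :
    constantCoeff (multiplicativeEnd ℤ_[p] A i) = 0 := by
  have h := congrArg constantCoeff (one_add_multiplicativeEnd A i)
  rw [map_prod, Finset.prod_eq_one fun j _ =>
    constantCoeff_padicPow (constantCoeff_one_add_X j) _, map_add, map_one] at h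
  simpa using h

/-- The exponent law: `∏_k (∏_j (1 + X_j) ^ B_kj) ^ A_ik = ∏_j (1 + X_j) ^ ((A B)_ij)`. -/
theorem multiplicativeEnd_mul (A B : Matrix (Fin r) (Fin r) ℤ_[p]) :
    tupleComp (multiplicativeEnd ℤ_[p] A) (multiplicativeEnd ℤ_[p] B) =
      multiplicativeEnd ℤ_[p] (A * B) := by
  have hB : HasSubst (multiplicativeEnd ℤ_[p] B) :=
    hasSubst_of_constantCoeff_zero (constantCoeff_multiplicativeEnd B)
  have h1 : subst (multiplicativeEnd ℤ_[p] B) (1 : MvPowerSeries (Fin r) ℤ_[p]) = 1 := by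
    rw [← coe_substAlgHom hB, map_one]
  ext1 i
  apply add_left_cancel (a := 1)
  rw [one_add_multiplicativeEnd, tupleComp]
  nth_rewrite 1 [← h1]
  rw [← subst_add hB, one_add_multiplicativeEnd, ← coe_substAlgHom hB, map_prod]
  simp only [coe_substAlgHom, subst_padicPow hB (constantCoeff_one_add_X _), subst_add hB, h1,
    subst_X hB, one_add_multiplicativeEnd, Matrix.mul_apply,
    padicPow_sum _ (constantCoeff_one_add_X _)]
  rw [Finset.prod_comm]
  refine Finset.prod_congr rfl fun j _ => ?_
  rw [prod_padicPow _ fun k => constantCoeff_padicPow (constantCoeff_one_add_X _) _]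
  refine Finset.prod_congr rfl fun k _ => ?_
  rw [mul_comm, padicPow_mul (constantCoeff_one_add_X _)]

theorem multiplicativeEnd_natCast (n : ℕ) :
    multiplicativeEnd ℤ_[p] ((n : ℤ_[p]) • (1 : Matrix (Fin r) (Fin r) ℤ_[p])) =
      fun i => (1 + X i) ^ n - 1 := by
  ext1 i
  rw [eq_sub_iff_add_eq', one_add_multiplicativeEnd, Finset.prod_eq_single i]
  · simp [padicPow_natCast]
  · intro j _ hj
    rw [Matrix.smul_apply, Matrix.one_apply_ne hj.symm, smul_zero]
    simpa using padicPow_natCast (constantCoeff_one_add_X (p := p) j) 0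
  · simp

theorem multiplicativeEnd_one :
    multiplicativeEnd ℤ_[p] (1 : Matrix (Fin r) (Fin r) ℤ_[p]) = X := by
  have := multiplicativeEnd_natCast (p := p) (r := r) 1
  simpa using this

theorem jac_multiplicativeEnd (A : Matrix (Fin r) (Fin r) ℤ_[p]) :
    jac (multiplicativeEnd ℤ_[p] A) = A := by
  have h3 : ∀ j, coeff (Finsupp.single j 1) (1 : MvPowerSeries (Fin r) ℤ_[p]) = 0 := fun j => by
    rw [coeff_one, if_neg (by simp)]
  ext i j
  have h := congrArg (coeff (Finsupp.single j 1)) (one_add_multiplicativeEnd A i)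
  rw [map_add, h3, zero_add, coeff_single_prod _ fun k =>
    constantCoeff_padicPow (constantCoeff_one_add_X k) _] at h
  rw [jac_apply, h]
  simp only [coeff_single_padicPow (constantCoeff_one_add_X _), map_add, h3, zero_add,
    coeff_index_single_X]
  simp

theorem multiplicativeEnd_eq_map (A : Matrix (Fin r) (Fin r) ℤ_[p]) :
    multiplicativeEnd S A =
      fun i => MvPowerSeries.map (algebraMap ℤ_[p] S) (multiplicativeEnd ℤ_[p] A i) := by
  ext1 i
  simp only [multiplicativeEnd, map_sub, map_one, map_prod]
  congr 1
  refine Finset.prod_congr rfl fun j _ => ?_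
  rw [PowerSeries.map_subst (PowerSeries.HasSubst.X j), map_X]
  congr 1
  ext n
  simp [Algebra.smul_def]

/-- Makes multiplication by `p` on `𝔾_m^r` an admissible series for the Lubin–Tate lemma. -/
theorem isFrobeniusSeries_multiplicative {R : Type*} [CommRing R] (p : ℕ) [hp : Fact p.Prime]
    (r : ℕ) : IsFrobeniusSeries p (1 : Matrix (Fin r) (Fin r) R)
      (fun i => (1 + X i) ^ p - 1) := by
  have h : ∀ i : Fin r, ∃ g : MvPowerSeries (Fin r) R,
      (1 + X i) ^ p - 1 = X i ^ p + C (p : R) * (X i * g) := fun i => by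
    obtain ⟨g, hg⟩ := exists_add_pow_prime_eq hp.out (1 : MvPowerSeries (Fin r) R) (X i)
    exact ⟨g, by rw [hg, one_pow, map_natCast]; ring⟩
  refine ⟨fun i => by simp, ?_, fun i e => ?_⟩
  · have h2 : ∀ (x : MvPowerSeries (Fin r) R) (n : ℕ), ∃ g, (1 + x) ^ n = 1 + n * x + x * x * g := by
      intro x n
      induction n with
      | zero => exact ⟨0, by simp⟩
      | succ n ih =>
        obtain ⟨g, hg⟩ := ih
        exact ⟨n + g + x * g, by rw [pow_succ, hg]; push_cast; ring⟩
    rw [← jac_linSeries ((p : R) • (1 : Matrix (Fin r) (Fin r) R))]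
    refine jac_eq_of_sub_mem fun i => ?_
    obtain ⟨g, hg⟩ := h2 (X i) p
    have h3 : linSeries ((p : R) • (1 : Matrix (Fin r) (Fin r) R)) i =
        (p : MvPowerSeries (Fin r) R) * X i := by
      rw [linSeries, Finset.sum_eq_single i (fun j _ hj => by simp [Matrix.one_apply_ne hj.symm])
        (by simp)]
      simp
    have hX : (X i : MvPowerSeries (Fin r) R) ∈ orderIdeal (Fin r) R 1 :=
      mem_orderIdeal_one.mpr (by simp)
    rw [h3, hg]
    convert Ideal.mul_mem_right g _ (mul_mem_orderIdeal hX hX) using 1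
    ring
  · obtain ⟨g, hg⟩ := h i
    rw [hg, add_sub_cancel_left, coeff_C_mul]
    exact dvd_mul_right _ _

end Binomial

/-! ### Frobenius-semilinear equations -/

/-- Here `d` generates a normal basis of the field with `p ^ m` elements over `𝔽_p`, and `c` is the
member dual to `d` of the trace-dual basis. The sums are the traces of `c` times the Frobenius
conjugates of `d`, transported along an embedding into `k`. -/
theorem exists_normal_dual_pair {p : ℕ} [Fact p.Prime] (k : Type*) [Field k] [CharP k p]
    [IsAlgClosed k] {m : ℕ} (hm : m ≠ 0) :
    ∃ c d : k, c ^ p ^ m = c ∧ d ^ p ^ m = d ∧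
      ∀ l < m, ∑ i ∈ Finset.range m, (c * d ^ p ^ l) ^ p ^ i = if l = 0 then 1 else 0 := by
  classical
  let L := GaloisField p m
  let b := IsGalois.normalBasis (ZMod p) L
  have hB := traceForm_nondegenerate (ZMod p) L
  let c := (Algebra.traceForm (ZMod p) L).dualBasis hB b 1
  have hfin : Module.finrank (ZMod p) L = m := GaloisField.finrank p hm
  have hcard : Nat.card L = p ^ m := GaloisField.card p m hm
  have hpow : ∀ x : L, x ^ p ^ m = x := fun x => by
    have : Fintype L := Fintype.ofFinite L
    rw [← hcard, Nat.card_eq_fintype_card, FiniteField.pow_card]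
  have hL : ∀ l < m, ∑ i ∈ Finset.range m, (c * b 1 ^ p ^ l) ^ p ^ i = if l = 0 then 1 else 0 := by
    intro l hl
    let F := FiniteField.frobeniusAlgEquivOfAlgebraic (ZMod p) L
    have h1 : b (F ^ l) = b 1 ^ p ^ l := by
      rw [IsGalois.normalBasis_apply, AlgEquiv.coe_pow,
        FiniteField.coe_frobeniusAlgEquivOfAlgebraic_iterate, ZMod.card]
    have h2 : F ^ l = 1 ↔ l = 0 := by
      refine ⟨fun h => ?_, fun h => by rw [h, pow_zero]⟩
      have := orderOf_dvd_of_pow_eq_one h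
      rw [FiniteField.orderOf_frobeniusAlgEquivOfAlgebraic, hfin] at this
      exact Nat.eq_zero_of_dvd_of_lt this hl
    have h3 := FiniteField.algebraMap_trace_eq_sum_pow (ZMod p) L (c * b 1 ^ p ^ l)
    rw [hfin, Nat.card_zmod] at h3
    have h4 := LinearMap.BilinForm.apply_dualBasis_left hB b 1 (F ^ l)
    rw [Algebra.traceForm_apply, h1] at h4
    rw [← h3, h4]
    simp only [h2]
    split_ifs <;> simp
  let : Algebra (ZMod p) k := ZMod.algebra k p
  let f : L →ₐ[ZMod p] k := IsAlgClosed.lift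
  refine ⟨f c, f (b 1), by rw [← map_pow, hpow], by rw [← map_pow, hpow], fun l hl => ?_⟩
  have := congrArg f (hL l hl)
  simpa only [map_sum, map_pow, map_mul, apply_ite, map_one, map_zero] using this

theorem sum_range_add_of_periodic {M : Type*} [AddCommGroup M] {f : ℕ → M} {m : ℕ}
    (hf : ∀ i, f (i + m) = f i) (i : ℕ) :
    ∑ l ∈ Finset.range m, f (i + l) = ∑ l ∈ Finset.range m, f l := by
  induction i with
  | zero => simp
  | succ i ih =>
    rw [← ih]
    have h1 := Finset.sum_range_succ (fun l => f (i + l)) m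
    have h2 := Finset.sum_range_succ' (fun l => f (i + l)) m
    rw [h1, hf, add_zero] at h2
    rw [add_right_cancel h2]
    exact Finset.sum_congr rfl fun l _ => by rw [add_right_comm, add_assoc]

/-! ### Frobenius lifts: closed subrings of ultrametric fields, units, fixed points -/

/-- When divisibility by `p` can be read off the norm, `p`-adic separatedness and completeness are
those of a closed subring of the complete field `K`. -/
theorem isFrobeniusLift_of_norm {p : ℕ} {W K : Type*} [CommRing W] [NormedField K]
    [IsUltrametricDist K] [CompleteSpace K] {s : W →+* W} (i : W →+* K)
    (hinj : Function.Injective i) (hi : ∀ w, ‖i w‖ ≤ 1) (hclosed : IsClosed (Set.range i))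
    (hp0 : 0 < ‖(p : K)‖) (hp1 : ‖(p : K)‖ < 1) (hdvd : ∀ w, ‖i w‖ ≤ ‖(p : K)‖ → (p : W) ∣ w)
    (hs : ∀ x, (p : W) ∣ s x - x ^ p) : IsFrobeniusLift p s := by
  have hpow : ∀ n w, ‖i w‖ ≤ ‖(p : K)‖ ^ n → (p : W) ^ n ∣ w := by
    intro n
    induction n with
    | zero => simp
    | succ n ih =>
      intro w hw
      obtain ⟨y, rfl⟩ := hdvd w (hw.trans (pow_le_of_le_one hp0.le hp1.le n.succ_ne_zero))
      rw [map_mul, map_natCast, norm_mul, pow_succ'] at hw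
      rw [pow_succ']
      exact mul_dvd_mul_left _ (ih y (le_of_mul_le_mul_left hw hp0))
  have hle : ∀ n w, ‖i ((p : W) ^ n * w)‖ ≤ ‖(p : K)‖ ^ n := fun n w => by
    rw [map_mul, map_pow, map_natCast, norm_mul, norm_pow]
    exact mul_le_of_le_one_right (pow_nonneg hp0.le _) (hi w)
  refine ⟨fun h => ?_, fun x hx => ?_, fun x hx => ?_, fun a => ?_, hs⟩
  · obtain ⟨w, hw⟩ := h.exists_right_inv
    have h1 := hle 1 w
    rw [pow_one, hw, map_one, norm_one, pow_one] at h1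
    exact absurd h1 (not_le.mpr hp1)
  · have h1 := congrArg i hx
    rw [map_mul, map_natCast, map_zero, mul_eq_zero, or_iff_right (norm_pos_iff.mp hp0)] at h1
    exact hinj (h1.trans (map_zero i).symm)
  · refine hinj ((norm_eq_zero.mp (le_antisymm ?_ (norm_nonneg _))).trans (map_zero i).symm)
    refine ge_of_tendsto' (tendsto_pow_atTop_nhds_zero_of_lt_one hp0.le hp1) fun n => ?_
    obtain ⟨y, rfl⟩ := hx n
    exact hle n y
  · let S : ℕ → W := fun n => ∑ k ∈ Finset.range n, (p : W) ^ k * a k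
    have hS : ∀ n m, ‖i (S (n + m)) - i (S n)‖ ≤ ‖(p : K)‖ ^ n := fun n m => by
      induction m with
      | zero => simp [pow_nonneg hp0.le]
      | succ m ih =>
        have h1 : S (n + (m + 1)) = S (n + m) + (p : W) ^ (n + m) * a (n + m) :=
          Finset.sum_range_succ _ _
        rw [h1, map_add, add_sub_right_comm]
        refine (IsUltrametricDist.norm_add_le_max _ _).trans (max_le ih ((hle _ _).trans ?_))
        exact pow_le_pow_of_le_one hp0.le hp1.le (Nat.le_add_right n m)
    have hcau : CauchySeq fun n => i (S n) := by
      refine cauchySeq_of_le_geometric ‖(p : K)‖ 1 hp1 fun n => ?_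
      rw [dist_eq_norm, norm_sub_rev, one_mul]
      exact hS n 1
    obtain ⟨y, hy⟩ := cauchySeq_tendsto_of_complete hcau
    obtain ⟨x, rfl⟩ := hclosed.mem_of_tendsto hy (Filter.Eventually.of_forall fun n => ⟨S n, rfl⟩)
    refine ⟨x, fun n => hpow n _ ?_⟩
    rw [map_sub]
    refine le_of_tendsto (hy.sub_const (i (S n))).norm
      (Filter.eventually_atTop.mpr ⟨n, fun m hm => ?_⟩)
    obtain ⟨l, rfl⟩ := Nat.exists_eq_add_of_le hm
    exact hS n l

theorem isFrobeniusLift_padicInt (p : ℕ) [hp : Fact p.Prime] :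
    IsFrobeniusLift p (RingHom.id ℤ_[p]) := by
  have hdvd : ∀ w : ℤ_[p], ‖w‖ ≤ ‖(p : ℚ_[p])‖ → (p : ℤ_[p]) ∣ w := fun w hw => by
    rw [← Ideal.mem_span_singleton, ← pow_one (p : ℤ_[p]),
      ← PadicInt.norm_le_pow_iff_mem_span_pow]
    simpa using hw
  refine isFrobeniusLift_of_norm (K := ℚ_[p]) PadicInt.Coe.ringHom Subtype.val_injective
    (fun w => w.2) ?_ ?_ Padic.norm_p_lt_one hdvd fun x => ?_
  · have h : Set.range (PadicInt.Coe.ringHom (p := p)) = {x : ℚ_[p] | ‖x‖ ≤ 1} := Subtype.range_val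
    rw [h]
    exact isClosed_le continuous_norm continuous_const
  · rw [norm_pos_iff, Nat.cast_ne_zero]
    exact hp.out.ne_zero
  · rw [← Ideal.mem_span_singleton, ← PadicInt.maximalIdeal_eq_span_p, ← PadicInt.ker_toZMod,
      RingHom.mem_ker, map_sub, map_pow, ZMod.pow_card, RingHom.id_apply, sub_self]

namespace IsFrobeniusLift

variable {p : ℕ} {W : Type*} [CommRing W] {s : W →+* W}

/-- The inverse is the geometric series in `p z`, which completeness provides. -/
theorem isUnit_one_add_mul (hs : IsFrobeniusLift p s) (z : W) : IsUnit (1 - (p : W) * z) := by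
  obtain ⟨w, hw⟩ := hs.complete fun k => z ^ k
  refine IsUnit.of_mul_eq_one w (sub_eq_zero.mp (hs.separated _ fun n => ?_))
  obtain ⟨y, hy⟩ := hw n
  have h1 : ∑ k ∈ Finset.range n, (p : W) ^ k * z ^ k = ∑ k ∈ Finset.range n, ((p : W) * z) ^ k :=
    Finset.sum_congr rfl fun k _ => (mul_pow _ _ _).symm
  have h2 := mul_neg_geom_sum ((p : W) * z) n
  rw [h1, sub_eq_iff_eq_add'] at hy
  refine ⟨(1 - p * z) * y - z ^ n, ?_⟩
  rw [hy, mul_add, h2, mul_pow]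
  ring

variable {k : Type*} [Field k] {π : W →+* k}

theorem isUnit_of_map_ne_zero (hs : IsFrobeniusLift p s) (hπ : Function.Surjective π)
    (hker : ∀ x, π x = 0 ↔ (p : W) ∣ x) {x : W} (hx : π x ≠ 0) : IsUnit x := by
  obtain ⟨y, hy⟩ := hπ (π x)⁻¹
  have h1 : π (1 - x * y) = 0 := by rw [map_sub, map_one, map_mul, hy, mul_inv_cancel₀ hx, sub_self]
  obtain ⟨z, hz⟩ := (hker _).mp h1
  have h2 := hs.isUnit_one_add_mul z
  rw [← hz, sub_sub_cancel] at h2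
  exact isUnit_of_mul_isUnit_left h2

theorem map_apply (hs : IsFrobeniusLift p s) (hker : ∀ x, π x = 0 ↔ (p : W) ∣ x) (x : W) :
    π (s x) = π x ^ p := by
  rw [← map_pow, ← sub_eq_zero, ← map_sub]
  exact (hker _).mpr (hs.frobenius x)

theorem map_iterate (hs : IsFrobeniusLift p s) (hker : ∀ x, π x = 0 ↔ (p : W) ∣ x) (n : ℕ)
    (x : W) : π (s^[n] x) = π x ^ p ^ n := by
  induction n with
  | zero => simp
  | succ n ih => rw [Function.iterate_succ_apply', hs.map_apply hker, ih, pow_succ, pow_mul]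

/-- The elements of `ℤ_p` are the fixed points of a Frobenius lift. -/
theorem exists_algebraMap_eq [Fact p.Prime] [CharP k p] [Algebra ℤ_[p] W] (hs : IsFrobeniusLift p s)
    (hker : ∀ x, π x = 0 ↔ (p : W) ∣ x) {x : W} (hx : s x = x) :
    ∃ a : ℤ_[p], algebraMap ℤ_[p] W a = x := by
  -- One digit: `π x` is fixed by the `p`-th power map, hence lies in `𝔽_p`. Removing an integer
  -- representative and dividing by `p` gives another fixed point, because `p` is regular.
  have step : ∀ x : W, s x = x → ∃ (n : ℤ) (y : W), s y = y ∧ x = n + p * y := fun x hx => by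
    have h1 : π x ^ p = π x := by rw [← hs.map_apply hker, hx]
    rw [← Subfield.mem_bot_iff_pow_eq_self, mem_bot_iff_intCast p] at h1
    obtain ⟨n, hn⟩ := h1
    have h2 : π (x - n) = 0 := by rw [map_sub, map_intCast, hn, sub_self]
    obtain ⟨y, hy⟩ := (hker _).mp h2
    refine ⟨n, y, hs.mul_left_cancel ?_, by rw [← hy]; ring⟩
    rw [← hy, ← map_natCast s, ← map_mul, ← hy, map_sub, hx, map_intCast]
  choose! n f hf hnf using step
  have hfix : ∀ i, s (f^[i] x) = f^[i] x := fun i => by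
    induction i with
    | zero => exact hx
    | succ i ih => rw [Function.iterate_succ_apply']; exact hf _ ih
  have hsum : ∀ N, x = ∑ i ∈ Finset.range N, (p : W) ^ i * n (f^[i] x) + p ^ N * f^[N] x :=
    fun N => by
      induction N with
      | zero => simp
      | succ N ih =>
        rw [Finset.sum_range_succ, Function.iterate_succ_apply']
        conv_lhs => rw [ih]
        conv_lhs => rw [hnf _ (hfix N)]
        ring
  have hz : ∃ a : ℤ_[p], ∀ N, (p : ℤ_[p]) ^ N ∣
      a - ∑ i ∈ Finset.range N, (p : ℤ_[p]) ^ i * n (f^[i] x) :=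
    (isFrobeniusLift_padicInt p).complete _
  obtain ⟨a, ha⟩ := hz
  refine ⟨a, sub_eq_zero.mp (hs.separated _ fun N => ?_)⟩
  obtain ⟨y, hy⟩ := ha N
  have h1 := congrArg (algebraMap ℤ_[p] W) hy
  simp only [map_sub, map_sum, map_mul, map_pow, map_natCast, map_intCast] at h1
  have h2 := hsum N
  refine ⟨algebraMap ℤ_[p] W y - f^[N] x, ?_⟩
  rw [mul_sub, ← h1]
  conv_lhs => rw [h2]
  ring

/-- A finite family of elements algebraic over the prime field lies in a common finite field. -/
theorem exists_common_pow {ι : Type*} [Finite ι]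
    (halg : ∀ x : k, ∃ n : ℕ, n ≠ 0 ∧ x ^ p ^ n = x) (x : ι → k) :
    ∃ n : ℕ, n ≠ 0 ∧ ∀ i, x i ^ p ^ n = x i := by
  have := Fintype.ofFinite ι
  choose n hn hx using fun i => halg (x i)
  have key : ∀ (y : k) (a b : ℕ), y ^ p ^ a = y → y ^ p ^ (a * b) = y := fun y a b h => by
    induction b with
    | zero => simp
    | succ b ih => rw [mul_add, mul_one, pow_add, pow_mul, ih, h]
  refine ⟨∏ i, n i, Finset.prod_ne_zero_iff.mpr fun i _ => hn i, fun i => ?_⟩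
  obtain ⟨b, hb⟩ := Finset.dvd_prod_of_mem n (Finset.mem_univ i)
  rw [hb]
  exact key _ _ _ (hx i)

end IsFrobeniusLift

namespace IsFrobeniusLift

variable {p : ℕ} {W : Type*} [CommRing W] {s : W →+* W} {k : Type*} [Field k] {π : W →+* k}
variable {ι : Type*}

theorem matrix_smul_left_cancel (hs : IsFrobeniusLift p s) (n : ℕ) {M N : Matrix ι ι W}
    (h : (p : W) ^ n • M = (p : W) ^ n • N) : M = N :=
  Matrix.ext fun i j => hs.pow_mul_left_cancel n (congrFun (congrFun h i) j)

theorem matrix_eq_of_forall (hs : IsFrobeniusLift p s) {M N : Matrix ι ι W}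
    (h : ∀ n, ∃ D, M = N + (p : W) ^ n • D) : M = N :=
  Matrix.ext fun i j => sub_eq_zero.mp (hs.separated _ fun n => by
    obtain ⟨D, hD⟩ := h n
    rw [hD, Matrix.add_apply, add_sub_cancel_left]
    exact dvd_mul_right _ _)

variable [Fintype ι] [DecidableEq ι]

theorem matrix_dvd (hker : ∀ x, π x = 0 ↔ (p : W) ∣ x) {M : Matrix ι ι W}
    (hM : π.mapMatrix M = 0) : ∃ N, M = (p : W) • N := by
  choose N hN using fun i j => (hker (M i j)).mp (congrFun (congrFun hM i) j)
  exact ⟨Matrix.of N, Matrix.ext hN⟩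

theorem matrix_isUnit (hs : IsFrobeniusLift p s) (hπ : Function.Surjective π)
    (hker : ∀ x, π x = 0 ↔ (p : W) ∣ x) {M : Matrix ι ι W} (hM : IsUnit (π.mapMatrix M)) :
    IsUnit M := by
  rw [Matrix.isUnit_iff_isUnit_det] at hM ⊢
  rw [← RingHom.map_det] at hM
  exact hs.isUnit_of_map_ne_zero hπ hker hM.ne_zero

theorem mapMatrix_apply (hs : IsFrobeniusLift p s) (hker : ∀ x, π x = 0 ↔ (p : W) ∣ x)
    (M : Matrix ι ι W) : π.mapMatrix (s.mapMatrix M) = (π.mapMatrix M).map (· ^ p) :=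
  Matrix.ext fun _ _ => hs.map_apply hker _

/-- The entries of `U` and its powers are roots of `X ^ p - X`, so the powers lie in a finite set
and two of them coincide. -/
theorem exists_pow_eq_one [Fact p.Prime] [CharP k p] {U : Matrix ι ι k} (hU : IsUnit U)
    (hUp : (_root_.frobenius k p).mapMatrix U = U) : ∃ m : ℕ, m ≠ 0 ∧ U ^ m = 1 := by
  classical
  have hp : p.Prime := Fact.out
  have hfin : {x : k | x ^ p = x}.Finite := by
    have h0 := FiniteField.X_pow_card_sub_X_ne_zero k hp.one_lt
    refine ((Polynomial.X ^ p - Polynomial.X : Polynomial k).roots.toFinset.finite_toSet).subset ?_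
    intro x hx
    simpa [h0, sub_eq_zero] using hx
  have hfin' : {M : Matrix ι ι k | ∀ i j, M i j ∈ {x : k | x ^ p = x}}.Finite :=
    Set.Finite.subset (Set.Finite.pi fun _ : ι => Set.Finite.pi fun _ : ι => hfin)
      fun M hM i _ j _ => hM i j
  have hmem : ∀ n : ℕ, U ^ n ∈ {M : Matrix ι ι k | ∀ i j, M i j ∈ {x : k | x ^ p = x}} :=
    fun n i j => by
      have h : (_root_.frobenius k p).mapMatrix (U ^ n) = U ^ n := by rw [map_pow, hUp]
      exact congrFun (congrFun h i) j
  obtain ⟨a, b, hab, h⟩ := hfin'.exists_lt_map_eq_of_forall_mem hmem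
  refine ⟨b - a, by omega, (hU.pow a).mul_left_cancel ?_⟩
  rw [← pow_add, Nat.add_sub_cancel' hab.le, mul_one, h]

/-- Let `U` be the reduction of `u`, with `U ^ m = 1`. Modulo `p` take `E = ∑ c ^ (p ^ i) U ^ (-i)`
over `i < m`: Frobenius shifts the index by one, and the shift is multiplication by `U`. The lift is
a polynomial in `v`, the inverse of `u`, so it commutes with `u`. The dual element `d` supplies the
inverse. -/
theorem exists_commute_map_eq_mod [Fact p.Prime] [CharP k p] [IsAlgClosed k]
    (hs : IsFrobeniusLift p s) (hπ : Function.Surjective π) (hker : ∀ x, π x = 0 ↔ (p : W) ∣ x)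
    {u v : Matrix ι ι W} (huv : u * v = 1) (hsu : s.mapMatrix u = u) :
    ∃ E : Matrix ι ι W, IsUnit E ∧ Commute u E ∧ ∃ D, s.mapMatrix E = u * E + (p : W) • D := by
  have hvu := mul_eq_one_comm.mp huv
  set U := π.mapMatrix u with hU
  set V := π.mapMatrix v with hV
  have hUV : U * V = 1 := by rw [hU, hV, ← map_mul, huv, map_one]
  have hVU : V * U = 1 := by rw [hU, hV, ← map_mul, hvu, map_one]
  obtain ⟨m, hm, hUm⟩ : ∃ m : ℕ, m ≠ 0 ∧ U ^ m = 1 :=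
    exists_pow_eq_one (p := p) (IsUnit.of_mul_eq_one V hUV)
      ((hs.mapMatrix_apply hker u).symm.trans (by rw [hsu]))
  have hUVn : ∀ n, V ^ n * U ^ n = 1 := fun n => by
    rw [← (Commute.mul_pow (hVU.trans hUV.symm) n), hVU, one_pow]
  have hVm : V ^ m = 1 := by simpa [hUm] using hUVn m
  obtain ⟨c, d, hc, hd, hcd⟩ := exists_normal_dual_pair (p := p) k hm
  obtain ⟨C, hC⟩ := hπ c
  have hcm : ∀ i, c ^ p ^ (i + m) = c ^ p ^ i := fun i => by
    rw [add_comm, pow_add, pow_mul, hc]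
  have hdm : ∀ i, d ^ p ^ (i + m) = d ^ p ^ i := fun i => by
    rw [add_comm, pow_add, pow_mul, hd]
  let E : Matrix ι ι W := ∑ i ∈ Finset.range m, s^[i] C • v ^ i
  have hsmul : ∀ (x : W) (M : Matrix ι ι W), π.mapMatrix (x • M) = π x • π.mapMatrix M :=
    fun x M => Matrix.ext fun i j => by simp
  have hssmul : ∀ (x : W) (M : Matrix ι ι W), s.mapMatrix (x • M) = s x • s.mapMatrix M :=
    fun x M => Matrix.ext fun i j => by simp
  have hE : π.mapMatrix E = ∑ i ∈ Finset.range m, c ^ p ^ i • V ^ i := by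
    simp only [E, map_sum, hsmul, map_pow, hs.map_iterate hker, hC, hV]
  have hsv : s.mapMatrix v = v := by
    have h1 := congrArg s.mapMatrix huv
    rw [map_mul, map_one, hsu] at h1
    exact (left_inv_eq_right_inv hvu h1).symm
  refine ⟨E, hs.matrix_isUnit hπ hker ?_, ?_, ?_⟩
  · refine IsUnit.of_mul_eq_one (∑ j ∈ Finset.range m, d ^ p ^ j • U ^ j) ?_
    rw [hE, Finset.sum_mul_sum]
    -- With `j = i + l`, allowed by periodicity modulo `m`, the product with `∑ d ^ (p ^ j) U ^ j`
    -- collects into `∑_l Tr(c d ^ (p ^ l)) U ^ l`, which duality reduces to the identity.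
    have h1 : ∀ i ∈ Finset.range m, ∑ j ∈ Finset.range m, c ^ p ^ i • V ^ i * d ^ p ^ j • U ^ j =
        ∑ l ∈ Finset.range m, (c * d ^ p ^ l) ^ p ^ i • U ^ l := fun i _ => by
      rw [← sum_range_add_of_periodic
        (f := fun j => c ^ p ^ i • V ^ i * d ^ p ^ j • U ^ j) (m := m) (fun j => by
          simp only [hdm, pow_add U, hUm, mul_one]) i]
      refine Finset.sum_congr rfl fun l _ => ?_
      rw [smul_mul_smul_comm, pow_add U, ← mul_assoc, hUVn, one_mul, mul_pow, ← pow_mul,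
        ← pow_add p, add_comm l i]
    rw [Finset.sum_congr rfl h1, Finset.sum_comm, Finset.sum_eq_single 0]
    · rw [← Finset.sum_smul, hcd 0 (Nat.pos_of_ne_zero hm), if_pos rfl, one_smul, pow_zero]
    · intro l hl hl0
      rw [← Finset.sum_smul, hcd l (Finset.mem_range.mp hl), if_neg hl0, zero_smul]
    · intro h
      exact absurd (Finset.mem_range.mpr (Nat.pos_of_ne_zero hm)) h
  · exact Commute.sum_right _ _ _ fun i _ =>
      (Commute.pow_right (huv.trans hvu.symm) i).smul_right _
  · obtain ⟨D, hD⟩ := matrix_dvd (p := p) hker (M := s.mapMatrix E - u * E) (by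
      have h1 : s.mapMatrix E = ∑ i ∈ Finset.range m, s^[i + 1] C • v ^ i := by
        simp only [E, map_sum, hssmul, map_pow, hsv, Function.iterate_succ_apply']
      rw [map_sub, map_mul, hE, h1, Finset.mul_sum, sub_eq_zero, map_sum]
      simp only [hsmul, map_pow, hs.map_iterate hker, hC]
      rw [← sum_range_add_of_periodic (f := fun i => U * c ^ p ^ i • V ^ i) (m := m)
        (fun i => by simp only [hcm, pow_add V, hVm, mul_one]) 1]
      refine Finset.sum_congr rfl fun i _ => ?_
      rw [mul_smul_comm, pow_add V, pow_one, ← mul_assoc, hUV, one_mul, add_comm 1 i])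
    exact ⟨D, by rw [← hD]; abel⟩

/-- An Artin–Schreier equation; solving it entry by entry could destroy commutation with `u`. Choose
instead `m` such that the entries of `B` reduce into the field with `p ^ m` elements, and `y` with
reduction `x` satisfying `x - x ^ (p ^ m) = 1`. Then `D = ∑ s^i(y B)` over `i < m` telescopes to `y
B - s^m(y B) ≡ B`, and each term commutes with `u` because `s` fixes `u`. -/
theorem exists_commute_map_eq_step [Fact p.Prime] [CharP k p] [IsAlgClosed k]
    (hs : IsFrobeniusLift p s) (hπ : Function.Surjective π) (hker : ∀ x, π x = 0 ↔ (p : W) ∣ x)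
    (halg : ∀ x : k, ∃ n : ℕ, n ≠ 0 ∧ x ^ p ^ n = x)
    {u : Matrix ι ι W} (hsu : s.mapMatrix u = u) {B : Matrix ι ι W} (hB : Commute u B) :
    ∃ D : Matrix ι ι W, Commute u D ∧ ∃ N, D = s.mapMatrix D + B + (p : W) • N := by
  obtain ⟨m, hm, hBm⟩ := exists_common_pow (p := p) halg fun ij : ι × ι => π (B ij.1 ij.2)
  obtain ⟨x, hx⟩ : ∃ x : k, x - x ^ p ^ m = 1 := by
    have hq : 1 < p ^ m := one_lt_pow₀ (Fact.out : p.Prime).one_lt hm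
    let P : Polynomial k := Polynomial.X ^ p ^ m + (1 - Polynomial.X)
    have hdeg : (1 - Polynomial.X : Polynomial k).natDegree < p ^ m := by
      refine lt_of_le_of_lt (Polynomial.natDegree_sub_le _ _) ?_
      simpa using hq
    have hP : P.natDegree = p ^ m := by
      rw [Polynomial.natDegree_add_eq_left_of_natDegree_lt] <;> simp [hdeg]
    obtain ⟨x, hx⟩ := IsAlgClosed.exists_root P (by
      rw [Polynomial.degree_eq_natDegree (by rintro h; rw [h] at hP; simp at hP; omega), hP]
      exact_mod_cast (by omega : p ^ m ≠ 0))
    refine ⟨x, ?_⟩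
    have h1 : x ^ p ^ m + (1 - x) = 0 := by simpa [P] using hx
    linear_combination -h1
  obtain ⟨y, rfl⟩ := hπ x
  let T := s.mapMatrix (m := ι)
  let D : Matrix ι ι W := ∑ i ∈ Finset.range m, T^[i] (y • B)
  have hT : ∀ i, Commute u (T^[i] (y • B)) := fun i => by
    induction i with
    | zero => exact hB.smul_right y
    | succ i ih =>
      rw [Function.iterate_succ_apply']
      have := ih.map T
      rwa [hsu] at this
  have hTi : ∀ i (M : Matrix ι ι W) a b, T^[i] M a b = s^[i] (M a b) := fun i M a b => by
    induction i with
    | zero => rfl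
    | succ i ih => rw [Function.iterate_succ_apply', Function.iterate_succ_apply', ← ih]; rfl
  have h1 : D - s.mapMatrix D = y • B - T^[m] (y • B) := by
    have h2 : s.mapMatrix D = ∑ i ∈ Finset.range m, T^[i + 1] (y • B) := by
      simp only [D, map_sum, Function.iterate_succ_apply']
      rfl
    rw [h2, ← Finset.sum_sub_distrib, Finset.sum_range_sub']
    rfl
  obtain ⟨N, hN⟩ := matrix_dvd (p := p) hker (M := D - s.mapMatrix D - B) (by
    rw [h1]
    ext a b
    have h2 : π (s^[m] ((y • B) a b)) = π y ^ p ^ m * π (B a b) := by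
      rw [hs.map_iterate hker, Matrix.smul_apply, smul_eq_mul, map_mul, mul_pow, hBm (a, b)]
    have h3 : π.mapMatrix (y • B - T^[m] (y • B) - B) a b =
        π ((y • B) a b) - π (s^[m] ((y • B) a b)) - π (B a b) := by
      rw [← map_sub, ← map_sub, ← hTi]
      rfl
    rw [h3, h2, Matrix.smul_apply, smul_eq_mul, map_mul]
    simp only [Matrix.zero_apply]
    linear_combination π (B a b) * hx)
  exact ⟨D, Commute.sum_right _ _ _ fun i _ => hT i, N, by rw [← hN]; abel⟩

/-- Lang's theorem, with a solution commuting with `u`. -/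
theorem exists_commute_map_eq [Fact p.Prime] [CharP k p] [IsAlgClosed k]
    (hs : IsFrobeniusLift p s) (hπ : Function.Surjective π) (hker : ∀ x, π x = 0 ↔ (p : W) ∣ x)
    (halg : ∀ x : k, ∃ n : ℕ, n ≠ 0 ∧ x ^ p ^ n = x)
    {u v : Matrix ι ι W} (huv : u * v = 1) (hsu : s.mapMatrix u = u) :
    ∃ E : Matrix ι ι W, IsUnit E ∧ Commute u E ∧ s.mapMatrix E = u * E := by
  have hvu := mul_eq_one_comm.mp huv
  have hsp : ∀ n (M : Matrix ι ι W), s.mapMatrix ((p : W) ^ n • M) =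
      (p : W) ^ n • s.mapMatrix M := fun n M => Matrix.ext fun i j => by simp
  have hpp : ∀ n (M : Matrix ι ι W), π.mapMatrix ((p : W) ^ (n + 1) • M) = 0 :=
    fun n M => Matrix.ext fun i j => by simp
  let Q : ℕ → Matrix ι ι W → Prop := fun n E => IsUnit E ∧ Commute u E ∧
    ∃ D, s.mapMatrix E = u * E + (p : W) ^ (n + 1) • D
  have step : ∀ n E, Q n E → ∃ G, Q (n + 1) (E + (p : W) ^ (n + 1) • G) ∧ Commute u G := by
    rintro n E ⟨hE, hEu, D, hD⟩
    obtain ⟨F, hEF⟩ := hE.exists_right_inv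
    have hFE := mul_eq_one_comm.mp hEF
    have huF : Commute u F := by
      have h1 : u * F = F * (E * u) * F := by rw [← mul_assoc F, hFE, one_mul]
      rw [commute_iff_eq, h1, ← hEu.eq, mul_assoc, mul_assoc u, hEF, mul_one]
    -- `p ^ (n + 1) D` is `s(E) - u E`, which commutes with `u`; then cancel the power of `p`.
    have huD : Commute u D := by
      have h1 := hEu.map s.mapMatrix
      rw [hsu, hD] at h1
      have h2 := h1.sub_right ((Commute.refl u).mul_right hEu)
      rw [add_sub_cancel_left] at h2
      refine hs.matrix_smul_left_cancel (n + 1) ?_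
      rw [← mul_smul_comm, ← smul_mul_assoc]
      exact h2
    have huv' : Commute u v := huv.trans hvu.symm
    -- Replace `E` by `E (1 + p ^ (n + 1) B)`. The equation at the next order asks for `B - s(B) ≡
    -- E⁻¹ u⁻¹ D` modulo `p`, and the right side commutes with `u`.
    obtain ⟨B, hBu, N, hN⟩ := exists_commute_map_eq_step hs hπ hker halg hsu
      (huF.mul_right (huv'.mul_right huD))
    refine ⟨E * B, ⟨hs.matrix_isUnit hπ hker ?_, ?_, ?_⟩, hEu.mul_right hBu⟩
    · rw [map_add, hpp, add_zero]
      exact hE.map _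
    · exact hEu.add_right ((hEu.mul_right hBu).smul_right _)
    · refine ⟨(p : W) ^ n • (D * s.mapMatrix B) - u * E * N, ?_⟩
      have h1 : u * E * (F * (v * D)) = D := by
        rw [mul_assoc, ← mul_assoc E, hEF, one_mul, ← mul_assoc, huv, one_mul]
      have h2 : u * E * B = u * E * s.mapMatrix B + D + (p : W) • (u * E * N) := by
        conv_lhs => rw [hN]
        rw [mul_add, mul_add, h1, mul_smul_comm]
      rw [map_add, hsp, map_mul, hD, mul_add, mul_smul_comm, ← mul_assoc u, h2, add_mul]
      simp only [smul_add, smul_sub, smul_mul_assoc, smul_smul, ← pow_succ, ← pow_add]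
      rw [show n + 1 + 1 + n = n + 1 + (n + 1) by ring]
      abel
  obtain ⟨E₀, hE₀, hE₀u, hD₀⟩ := exists_commute_map_eq_mod hs hπ hker huv hsu
  have hQ₀ : Q 0 E₀ := ⟨hE₀, hE₀u, by simpa using hD₀⟩
  choose! G hG hGu using step
  let S : ℕ → Matrix ι ι W := fun n => Nat.rec E₀ (fun n E => E + (p : W) ^ (n + 1) • G n E) n
  have hS : ∀ n, Q n (S n) := fun n => by
    induction n with
    | zero => exact hQ₀
    | succ n ih => exact hG n _ ih
  have hsum : ∀ n, S n = E₀ + (p : W) • ∑ i ∈ Finset.range n, (p : W) ^ i • G i (S i) := fun n => by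
    induction n with
    | zero => simp [S]
    | succ n ih =>
      have h1 : S (n + 1) = S n + (p : W) ^ (n + 1) • G n (S n) := rfl
      rw [h1, Finset.sum_range_succ, smul_add, ← add_assoc, ← ih, smul_smul, ← pow_succ']
  choose L hL using fun i j => hs.complete fun n => G n (S n) i j
  let E : Matrix ι ι W := E₀ + (p : W) • Matrix.of L
  have hE : ∀ n, ∃ D, E = S n + (p : W) ^ (n + 1) • D := fun n => by
    choose D hD using fun i j => hL i j n
    refine ⟨Matrix.of D, Matrix.ext fun i j => ?_⟩
    have h1 : L i j = ∑ k ∈ Finset.range n, (p : W) ^ k * G k (S k) i j + (p : W) ^ n * D i j := by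
      rw [← hD]; ring
    rw [hsum]
    simp only [E, Matrix.add_apply, Matrix.smul_apply, Matrix.of_apply, smul_eq_mul,
      Matrix.sum_apply, h1, pow_succ]
    ring
  refine ⟨E, hs.matrix_isUnit hπ hker ?_, ?_, ?_⟩
  · obtain ⟨D, hD⟩ := hE 0
    rw [hD, map_add, hpp, add_zero]
    exact hE₀.map _
  · refine hs.matrix_eq_of_forall fun n => ?_
    obtain ⟨D, hD⟩ := hE n
    refine ⟨(p : W) • (u * D - D * u), ?_⟩
    rw [hD, mul_add, add_mul, (hS n).2.1.eq, mul_smul_comm, smul_mul_assoc, smul_smul, ← pow_succ,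
      smul_sub]
    abel
  · refine hs.matrix_eq_of_forall fun n => ?_
    obtain ⟨D, hD⟩ := hE n
    obtain ⟨D', hD'⟩ := (hS n).2.2
    refine ⟨(p : W) • (D' + s.mapMatrix D - u * D), ?_⟩
    rw [hD, map_add, hD', hsp, mul_add, mul_smul_comm, smul_smul, ← pow_succ, smul_sub, smul_add]
    abel

end IsFrobeniusLift

/-! ### The residue field of the ring of integers of `ℂ_p` -/

namespace PadicComplexInt

variable {p : ℕ} [Fact p.Prime]

theorem norm_natCast : ‖(p : ℂ_[p])‖ = (p : ℝ)⁻¹ := by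
  rw [← PadicComplex.coe_natCast, PadicComplex.norm_extends,
    ← PadicAlgCl.valuation_coe, PadicAlgCl.valuation_p]
  simp

theorem norm_natCast_pos : 0 < ‖(p : ℂ_[p])‖ := by
  rw [norm_natCast, inv_pos, Nat.cast_pos]
  exact (Fact.out : p.Prime).pos

theorem norm_natCast_lt_one : ‖(p : ℂ_[p])‖ < 1 := by
  rw [norm_natCast]
  exact inv_lt_one_of_one_lt₀ (Nat.one_lt_cast.mpr (Fact.out : p.Prime).one_lt)

theorem residue_eq_zero_iff {x : 𝓞_ℂ_[p]} :
    IsLocalRing.residue 𝓞_ℂ_[p] x = 0 ↔ ‖(x : ℂ_[p])‖ < 1 := by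
  rw [IsLocalRing.residue_eq_zero_iff, IsLocalRing.mem_maximalIdeal, mem_nonunits_iff,
    ← not_iff_comm, not_lt]
  constructor
  · intro h
    have h0 : (x : ℂ_[p]) ≠ 0 := by
      rintro h0
      rw [h0, norm_zero] at h
      exact not_le.mpr one_pos h
    refine IsUnit.of_mul_eq_one ⟨(x : ℂ_[p])⁻¹, mem_OCp.mpr ?_⟩ (Subtype.ext (mul_inv_cancel₀ h0))
    rw [norm_inv]
    exact inv_le_one_of_one_le₀ h
  · rintro h
    obtain ⟨y, hy⟩ := h.exists_right_inv
    have h1 := congrArg (fun z : 𝓞_ℂ_[p] => ‖(z : ℂ_[p])‖) hy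
    simp only [MulMemClass.coe_mul, norm_mul, OneMemClass.coe_one, norm_one] at h1
    rw [← h1]
    exact mul_le_of_le_one_right (norm_nonneg _) (mem_OCp.mp y.2)

theorem residue_eq_iff {x y : 𝓞_ℂ_[p]} :
    IsLocalRing.residue 𝓞_ℂ_[p] x = IsLocalRing.residue 𝓞_ℂ_[p] y ↔ ‖(x : ℂ_[p]) - y‖ < 1 := by
  rw [← sub_eq_zero, ← map_sub, residue_eq_zero_iff]
  rfl

instance charP_residueField : CharP (IsLocalRing.ResidueField 𝓞_ℂ_[p]) p := by
  refine (CharP.charP_iff_prime_eq_zero Fact.out).mpr ?_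
  rw [← map_natCast (IsLocalRing.residue 𝓞_ℂ_[p]), residue_eq_zero_iff]
  exact norm_natCast_lt_one

/-- Lift a monic polynomial to the ring of integers and take a root in `ℂ_p`. The root is integral,
hence lies in the ring of integers, and reduces to the desired root. -/
instance isAlgClosed_residueField : IsAlgClosed (IsLocalRing.ResidueField 𝓞_ℂ_[p]) := by
  refine IsAlgClosed.of_exists_root _ fun P hP hirr => ?_
  obtain ⟨Q, rfl, hdeg, hQ⟩ := Polynomial.lifts_and_degree_eq_and_monic
    ((Polynomial.lifts_iff_coeff_lifts P).mpr fun n => IsLocalRing.residue_surjective (P.coeff n)) hP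
  have h0 : (Q.map (algebraMap 𝓞_ℂ_[p] ℂ_[p])).degree ≠ 0 := by
    rw [hQ.degree_map, hdeg]
    exact (Polynomial.degree_pos_of_irreducible hirr).ne'
  obtain ⟨x, hx⟩ := IsAlgClosed.exists_root _ h0
  have hint : IsIntegral 𝓞_ℂ_[p] x := ⟨Q, hQ, by rwa [Polynomial.IsRoot, Polynomial.eval_map] at hx⟩
  obtain ⟨y, rfl⟩ := IsIntegrallyClosed.isIntegral_iff.mp hint
  refine ⟨IsLocalRing.residue _ y, ?_⟩
  rw [Polynomial.IsRoot, Polynomial.eval_map, Polynomial.eval₂_at_apply] at hx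
  rw [Polynomial.eval_map, Polynomial.eval₂_at_apply,
    (FaithfulSMul.algebraMap_injective 𝓞_ℂ_[p] ℂ_[p]) (hx.trans (map_zero _).symm), map_zero]

end PadicComplexInt

/-! ### Teichmüller representatives and the maximal unramified extension -/

namespace PadicAlgCl

variable {p : ℕ} [Fact p.Prime]

/-- An element of the algebraic closure of norm at most one, in the ring of integers of `ℂ_p`. -/
noncomputable def toOCp (x : PadicAlgCl p) (hx : ‖x‖ ≤ 1) : 𝓞_ℂ_[p] :=
  ⟨x, mem_OCp.mpr ((PadicComplex.norm_extends p x).trans_le hx)⟩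

theorem residue_toOCp_eq_iff {x y : PadicAlgCl p} (hx : ‖x‖ ≤ 1) (hy : ‖y‖ ≤ 1) :
    IsLocalRing.residue _ (toOCp x hx) = IsLocalRing.residue _ (toOCp y hy) ↔ ‖x - y‖ < 1 := by
  rw [PadicComplexInt.residue_eq_iff, ← PadicComplex.norm_extends p (x - y),
    UniformSpace.Completion.coe_sub]
  rfl

/-- The norm is the spectral norm, so `‖x‖ ≤ 1` bounds the coefficients of the minimal polynomial.
-/
theorem isIntegral_of_norm_le_one {x : PadicAlgCl p} (hx : ‖x‖ ≤ 1) : IsIntegral ℤ_[p] x := by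
  have hmon : (minpoly ℚ_[p] x).Monic := minpoly.monic (Algebra.IsIntegral.isIntegral x)
  have hcoeff := (spectralValue_le_one_iff hmon).mp hx
  obtain ⟨Q, hQm, -, hQ⟩ := Polynomial.lifts_and_degree_eq_and_monic (f := algebraMap ℤ_[p] ℚ_[p])
    ((Polynomial.lifts_iff_coeff_lifts _).mpr fun n => ⟨⟨_, hcoeff n⟩, rfl⟩) hmon
  refine ⟨Q, hQ, ?_⟩
  rw [IsScalarTower.algebraMap_eq ℤ_[p] ℚ_[p] (PadicAlgCl p), ← Polynomial.eval₂_map, hQm]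
  exact minpoly.aeval ℚ_[p] x

/-- Reducing an integral equation shows that the residue of `x` is integral over `𝔽_p`, so it
generates a finite field. -/
theorem exists_residue_pow_eq {x : PadicAlgCl p} (hx : ‖x‖ ≤ 1) : ∃ n : ℕ, n ≠ 0 ∧
    IsLocalRing.residue _ (toOCp x hx) ^ p ^ n = IsLocalRing.residue _ (toOCp x hx) := by
  set k := IsLocalRing.ResidueField 𝓞_ℂ_[p]
  set y : k := IsLocalRing.residue _ (toOCp x hx) with hy
  let : Algebra (ZMod p) k := ZMod.algebra k p
  have hf : ((IsLocalRing.residue 𝓞_ℂ_[p]).comp (algebraMap ℤ_[p] 𝓞_ℂ_[p])) =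
      (algebraMap (ZMod p) k).comp PadicInt.toZMod := by
    ext a
    obtain ⟨b, hb⟩ : ∃ b, a - (PadicInt.toZMod a).val = p * b := by
      rw [← dvd_def, ← Ideal.mem_span_singleton, ← PadicInt.maximalIdeal_eq_span_p,
        ← PadicInt.ker_toZMod, RingHom.mem_ker, map_sub, map_natCast, ZMod.natCast_zmod_val,
        sub_self]
    rw [sub_eq_iff_eq_add] at hb
    rw [hb]
    simp only [map_add, map_mul, map_natCast, CharP.cast_eq_zero, zero_mul, zero_add]
  have hint : IsIntegral (ZMod p) y := by
    obtain ⟨Q, hQ, hQx⟩ := isIntegral_of_norm_le_one hx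
    refine ⟨Q.map PadicInt.toZMod, hQ.map _, ?_⟩
    have h1 : Q.eval₂ (algebraMap ℤ_[p] 𝓞_ℂ_[p]) (toOCp x hx) = 0 := by
      apply Subtype.ext
      have h2 : (algebraMap (PadicAlgCl p) ℂ_[p]).comp (algebraMap ℤ_[p] (PadicAlgCl p)) =
          (𝓞_ℂ_[p].subtype).comp (algebraMap ℤ_[p] 𝓞_ℂ_[p]) := rfl
      have h3 := congrArg (algebraMap (PadicAlgCl p) ℂ_[p]) hQx
      rw [Polynomial.hom_eval₂, h2, map_zero] at h3
      refine Eq.trans ?_ h3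
      exact Polynomial.hom_eval₂ Q _ 𝓞_ℂ_[p].subtype (toOCp x hx)
    rw [Polynomial.eval₂_map, ← hf, hy, ← Polynomial.hom_eval₂, h1, map_zero]
  have hfd : FiniteDimensional (ZMod p) (IntermediateField.adjoin (ZMod p) {y}) :=
    IntermediateField.adjoin.finiteDimensional hint
  have hfin : Finite (IntermediateField.adjoin (ZMod p) {y}) := Module.finite_of_finite (ZMod p)
  have := Fintype.ofFinite (IntermediateField.adjoin (ZMod p) {y})
  obtain ⟨q, hq, n, -, hn⟩ := FiniteField.card' (IntermediateField.adjoin (ZMod p) {y})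
  have hqp : q = p := CharP.eq _ hq (charP_of_injective_algebraMap
    (algebraMap (ZMod p) (IntermediateField.adjoin (ZMod p) {y})).injective p)
  refine ⟨n, n.ne_zero, ?_⟩
  have h1 := FiniteField.pow_card (⟨y, IntermediateField.mem_adjoin_simple_self _ y⟩ :
    IntermediateField.adjoin (ZMod p) {y})
  rw [hn, hqp] at h1
  exact congrArg Subtype.val h1

variable (p) in
/-- The Teichmüller representatives of the field with `p ^ n` elements. -/
def teichmuller (n : ℕ) : Submonoid (PadicAlgCl p) where
  carrier := {z | z ^ p ^ n = z}
  one_mem' := one_pow _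
  mul_mem' {y z} hy hz := by exact (mul_pow y z _).trans (congrArg₂ _ hy hz)

theorem mem_teichmuller {n : ℕ} {z : PadicAlgCl p} : z ∈ teichmuller p n ↔ z ^ p ^ n = z := Iff.rfl

theorem teichmuller_le_mul (m n : ℕ) : teichmuller p m ≤ teichmuller p (m * n) := fun z hz => by
  rw [mem_teichmuller] at hz ⊢
  induction n with
  | zero => simp
  | succ n ih => rw [mul_add, mul_one, pow_add, pow_mul, ih, hz]

theorem norm_le_one_of_mem_teichmuller {n : ℕ} (hn : n ≠ 0) {z : PadicAlgCl p}
    (hz : z ∈ teichmuller p n) : ‖z‖ ≤ 1 := by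
  by_contra! h
  have h1 := congrArg norm (mem_teichmuller.mp hz)
  rw [norm_pow] at h1
  have h2 : 1 < p ^ n := one_lt_pow₀ (Fact.out : p.Prime).one_lt hn
  exact (lt_self_pow₀ h h2).ne' h1

theorem finite_teichmuller {n : ℕ} (hn : n ≠ 0) : (teichmuller p n : Set (PadicAlgCl p)).Finite := by
  classical
  have h0 := FiniteField.X_pow_card_sub_X_ne_zero (PadicAlgCl p)
    (one_lt_pow₀ (Fact.out : p.Prime).one_lt hn)
  refine ((Polynomial.X ^ p ^ n - Polynomial.X : Polynomial (PadicAlgCl p)).roots.toFinset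
    |>.finite_toSet).subset fun x hx => ?_
  simpa [h0, sub_eq_zero] using mem_teichmuller.mp hx

/-- For a suitable `q = p ^ n`, `x ^ q - x` has norm less than one. It is the product of the `x - z`
over the roots `z` of `X ^ q - X`, so some factor has norm less than one. -/
theorem exists_mem_teichmuller {x : PadicAlgCl p} (hx : ‖x‖ ≤ 1) :
    ∃ n : ℕ, n ≠ 0 ∧ ∃ z ∈ teichmuller p n, ‖x - z‖ < 1 := by
  obtain ⟨n, hn, h⟩ := exists_residue_pow_eq hx
  have hq : 1 < p ^ n := one_lt_pow₀ (Fact.out : p.Prime).one_lt hn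
  refine ⟨n, hn, ?_⟩
  have h1 : ‖x ^ p ^ n‖ ≤ 1 := by rw [norm_pow]; exact pow_le_one₀ (norm_nonneg _) hx
  have h2 : ‖x ^ p ^ n - x‖ < 1 := by
    rw [← residue_toOCp_eq_iff h1 hx, ← h, ← map_pow]
    congr 1
    exact Subtype.ext (map_pow (algebraMap (PadicAlgCl p) ℂ_[p]) x _)
  let P : Polynomial (PadicAlgCl p) := Polynomial.X ^ p ^ n - Polynomial.X
  have hP : P.Monic := Polynomial.monic_X_pow_sub (by
    rw [Polynomial.degree_X]; exact_mod_cast hq)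
  have hev := (IsAlgClosed.splits P).eval_eq_prod_roots_of_monic hP x
  by_contra! hcon
  have h3 : ∀ s : Multiset (PadicAlgCl p), (∀ z ∈ s, 1 ≤ ‖x - z‖) →
      1 ≤ ‖(s.map (x - ·)).prod‖ := fun s => by
    induction s using Multiset.induction_on with
    | empty => simp
    | cons a s ih =>
      intro hs
      rw [Multiset.map_cons, Multiset.prod_cons, norm_mul]
      exact one_le_mul_of_one_le_of_one_le (hs a (Multiset.mem_cons_self a s))
        (ih fun z hz => hs z (Multiset.mem_cons_of_mem hz))
  refine not_le.mpr h2 ?_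
  have h4 : x ^ p ^ n - x = P.eval x := by simp [P]
  rw [h4, hev]
  refine h3 _ fun z hz => hcon z ?_
  have h5 := Polynomial.isRoot_of_mem_roots hz
  rw [mem_teichmuller]
  simpa [P, sub_eq_zero] using h5

/-- For a common `q`, `y - z = y ^ q - z ^ q = (y - z) ∑ y ^ i z ^ (q - 1 - i)`. If `y` and `z` have
the same residue, the sum reduces to `q y ^ (q - 1) = 0`, so it has norm less than one and `y - z`
must vanish. -/
theorem teichmuller_eq_of_norm_lt {m n : ℕ} (hm : m ≠ 0) (hn : n ≠ 0) {y z : PadicAlgCl p}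
    (hy : y ∈ teichmuller p m) (hz : z ∈ teichmuller p n) (h : ‖y - z‖ < 1) : y = z := by
  replace hy := teichmuller_le_mul m n hy
  replace hz := teichmuller_le_mul n m hz
  rw [mul_comm] at hz
  have hmn := mul_ne_zero hm hn
  have hy1 := norm_le_one_of_mem_teichmuller hmn hy
  have hz1 := norm_le_one_of_mem_teichmuller hmn hz
  rw [mem_teichmuller] at hy hz
  set q := p ^ (m * n)
  let Y := toOCp y hy1
  let Z := toOCp z hz1
  have hYZ : IsLocalRing.residue _ Y = IsLocalRing.residue _ Z :=
    (residue_toOCp_eq_iff hy1 hz1).mpr h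
  have hS : IsLocalRing.residue _ (∑ i ∈ Finset.range q, Y ^ i * Z ^ (q - 1 - i)) = 0 := by
    rw [map_sum]
    simp only [map_mul, map_pow, hYZ]
    rw [Finset.sum_congr rfl fun i hi => by
      rw [← pow_add, Nat.add_sub_cancel' (Nat.le_sub_one_of_lt (Finset.mem_range.mp hi))],
      Finset.sum_const, Finset.card_range, nsmul_eq_mul]
    have : ((q : ℕ) : IsLocalRing.ResidueField 𝓞_ℂ_[p]) = 0 :=
      (CharP.cast_eq_zero_iff _ p _).mpr (dvd_pow_self p hmn)
    rw [this, zero_mul]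
  rw [PadicComplexInt.residue_eq_zero_iff] at hS
  have h1 : (∑ i ∈ Finset.range q, Y ^ i * Z ^ (q - 1 - i)) * (Y - Z) = Y - Z := by
    rw [(Commute.all Y Z).geom_sum₂_mul]
    apply Subtype.ext
    change ((y : ℂ_[p]) ^ q - (z : ℂ_[p]) ^ q) = (y : ℂ_[p]) - z
    have h2 : ∀ w : PadicAlgCl p, w ^ q = w → (w : ℂ_[p]) ^ q = w := fun w hw => by
      rw [PadicComplex.coe_eq, ← map_pow, hw]
    rw [h2 y hy, h2 z hz]
  have h2 : ((Y - Z : 𝓞_ℂ_[p]) : ℂ_[p]) = ((y - z : PadicAlgCl p) : ℂ_[p]) :=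
    (UniformSpace.Completion.coe_sub y z).symm
  have h3 := congrArg (fun w : 𝓞_ℂ_[p] => ‖(w : ℂ_[p])‖) h1
  simp only [MulMemClass.coe_mul, norm_mul] at h3
  rw [h2, PadicComplex.norm_extends] at h3
  by_contra hne
  have h4 : 0 < ‖y - z‖ := norm_pos_iff.mpr (sub_ne_zero.mpr hne)
  exact (mul_lt_of_lt_one_left h4 hS).ne h3

variable (p) in
/-- The Teichmüller representatives of all the residue classes. -/
def allTeichmuller : Submonoid (PadicAlgCl p) where
  carrier := {z | ∃ n : ℕ, n ≠ 0 ∧ z ∈ teichmuller p n}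
  one_mem' := ⟨1, one_ne_zero, one_mem _⟩
  mul_mem' := by
    rintro y z ⟨m, hm, hy⟩ ⟨n, hn, hz⟩
    exact ⟨m * n, mul_ne_zero hm hn, mul_mem (teichmuller_le_mul m n hy)
      (mul_comm m n ▸ teichmuller_le_mul n m hz)⟩

theorem map_mem_teichmuller (g : GQp p) {n : ℕ} {z : PadicAlgCl p} (hz : z ∈ teichmuller p n) :
    g z ∈ teichmuller p n := by
  rw [mem_teichmuller] at hz ⊢
  rw [← map_pow, hz]

/-- Galois elements preserve Teichmüller representatives, and each residue class of an integral
element contains exactly one; fixing the classes is therefore fixing the representatives. -/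
theorem mem_inertia_iff {g : GQp p} : g ∈ inertia p ↔ ∀ z ∈ allTeichmuller p, g z = z := by
  constructor
  · rintro hg z ⟨n, hn, hz⟩
    exact teichmuller_eq_of_norm_lt hn hn (map_mem_teichmuller g hz) hz
      (hg z (norm_le_one_of_mem_teichmuller hn hz))
  · intro h x hx
    obtain ⟨n, hn, z, hz, hxz⟩ := exists_mem_teichmuller hx
    have h1 : g x - x = g (x - z) - (x - z) := by
      rw [map_sub, h z ⟨n, hn, hz⟩]; ring
    rw [h1, sub_eq_add_neg]
    refine (IsUltrametricDist.norm_add_le_max _ _).trans_lt (max_lt ?_ ?_)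
    · rwa [g.norm_apply]
    · rwa [norm_neg]

theorem inertia_eq_fixingSubgroup : inertia p =
    (IntermediateField.adjoin ℚ_[p] (allTeichmuller p : Set (PadicAlgCl p))).fixingSubgroup := by
  ext g
  rw [mem_inertia_iff, IntermediateField.mem_fixingSubgroup_iff]
  constructor
  · intro h x hx
    induction hx using IntermediateField.adjoin_induction with
    | mem x hx => exact h x hx
    | algebraMap x => exact g.commutes x
    | add x y _ _ hx hy => rw [map_add, hx, hy]
    | inv x _ hx => rw [map_inv₀, hx]
    | mul x y _ _ hx hy => rw [map_mul, hx, hy]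
  · exact fun h z hz => h z (IntermediateField.subset_adjoin _ _ hz)

/-- The Galois correspondence turns the abstract fixed field into one with explicit generators. -/
theorem Qpnr_eq_adjoin : Qpnr p =
    IntermediateField.adjoin ℚ_[p] (allTeichmuller p : Set (PadicAlgCl p)) := by
  rw [Qpnr, inertia_eq_fixingSubgroup, InfiniteGalois.fixedField_fixingSubgroup]

end PadicAlgCl

namespace PadicAlgCl

variable {p : ℕ} [Fact p.Prime]

variable (p) in
/-- The `ℤ_p`-algebra generated by the Teichmüller representatives of the field with `p ^ n`
elements. -/
noncomputable def teichmullerAlgebra (n : ℕ) : Subalgebra ℤ_[p] (PadicAlgCl p) :=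
  Algebra.adjoin ℤ_[p] (teichmuller p n : Set (PadicAlgCl p))

theorem toSubmodule_teichmullerAlgebra (n : ℕ) :
    Subalgebra.toSubmodule (teichmullerAlgebra p n) =
      Submodule.span ℤ_[p] (teichmuller p n : Set (PadicAlgCl p)) := by
  rw [teichmullerAlgebra, Algebra.adjoin_eq_span, Submonoid.closure_eq]

theorem teichmullerAlgebra_le_mul (m n : ℕ) :
    teichmullerAlgebra p m ≤ teichmullerAlgebra p (m * n) :=
  Algebra.adjoin_mono (teichmuller_le_mul m n)

/-- The algebra is the span of a finite multiplicative set over the compact ring `ℤ_p`, hence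
compact. -/
theorem isClosed_teichmullerAlgebra {n : ℕ} (hn : n ≠ 0) :
    IsClosed (teichmullerAlgebra p n : Set (PadicAlgCl p)) := by
  have : ContinuousSMul ℤ_[p] (PadicAlgCl p) := ⟨by
    have h : (fun x : ℤ_[p] × PadicAlgCl p => x.1 • x.2) = fun x => (x.1 : ℚ_[p]) • x.2 :=
      funext fun x => algebra_compatible_smul ℚ_[p] x.1 x.2
    rw [h]
    exact (continuous_subtype_val.comp continuous_fst).smul continuous_snd⟩
  have h : (Subalgebra.toSubmodule (teichmullerAlgebra p n)).FG := by
    rw [toSubmodule_teichmullerAlgebra]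
    exact Submodule.fg_span (finite_teichmuller hn)
  exact (Submodule.isCompact_of_fg h).isClosed

/-- Modulo `p` the map `y ↦ y ^ (p ^ n)` is additive, is the identity on `ℤ_p`, and fixes the
generators. -/
theorem exists_pow_eq_add {n : ℕ} {y : PadicAlgCl p} (hy : y ∈ teichmullerAlgebra p n) :
    ∃ r ∈ teichmullerAlgebra p n, y = y ^ p ^ n + p * r := by
  have hy' : y ∈ Submodule.span ℤ_[p] (teichmuller p n : Set (PadicAlgCl p)) := by
    rwa [← toSubmodule_teichmullerAlgebra]
  clear hy
  induction hy' using Submodule.span_induction with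
  | mem x hx => exact ⟨0, zero_mem _, by rw [mem_teichmuller.mp hx]; ring⟩
  | zero => exact ⟨0, zero_mem _, by
      rw [zero_pow (pow_ne_zero _ (Fact.out : p.Prime).ne_zero)]; ring⟩
  | add x y hx hy ihx ihy =>
    rw [← toSubmodule_teichmullerAlgebra, Subalgebra.mem_toSubmodule] at hx hy
    obtain ⟨r, hr, hxr⟩ := ihx
    obtain ⟨t, ht, hyt⟩ := ihy
    obtain ⟨e, he⟩ := exists_add_pow_prime_pow_eq (p := p) Fact.out
      (⟨x, hx⟩ : teichmullerAlgebra p n) ⟨y, hy⟩ n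
    have he' := congrArg Subtype.val he
    push_cast at he'
    refine ⟨r + t - x * y * e, sub_mem (add_mem hr ht) (mul_mem (mul_mem hx hy) e.2), ?_⟩
    rw [he']
    linear_combination hxr + hyt
  | smul a x hx ih =>
    rw [← toSubmodule_teichmullerAlgebra, Subalgebra.mem_toSubmodule] at hx
    obtain ⟨r, hr, hxr⟩ := ih
    obtain ⟨b, hb⟩ : ∃ b, a - a ^ p ^ n = p * b := by
      rw [← dvd_def, ← Ideal.mem_span_singleton, ← PadicInt.maximalIdeal_eq_span_p,
        ← PadicInt.ker_toZMod, RingHom.mem_ker, map_sub, map_pow, ZMod.pow_card_pow, sub_self]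
    refine ⟨b • x ^ p ^ n + a • r, add_mem (Subalgebra.smul_mem _ (pow_mem hx _) b)
      (Subalgebra.smul_mem _ hr a), ?_⟩
    have hb' := congrArg (algebraMap ℤ_[p] (PadicAlgCl p)) hb
    simp only [map_sub, map_mul, map_pow, map_natCast] at hb'
    simp only [Algebra.smul_def]
    linear_combination algebraMap ℤ_[p] (PadicAlgCl p) a * hxr + x ^ p ^ n * hb'

theorem natCast_ne_zero : (p : PadicAlgCl p) ≠ 0 :=
  Nat.cast_ne_zero.mpr (Fact.out : p.Prime).ne_zero

/-- Iterating the previous congruence gives `y = y ^ (p ^ (n N)) + p r_N` for all `N`. If `‖y‖ < 1`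
the powers tend to zero, so `r_N` tends to `y / p`, which belongs to the closed algebra. This is
where unramifiedness is proved. -/
theorem exists_eq_mul_of_norm_lt_one {n : ℕ} (hn : n ≠ 0) {y : PadicAlgCl p}
    (hy : y ∈ teichmullerAlgebra p n) (h : ‖y‖ < 1) :
    ∃ r ∈ teichmullerAlgebra p n, y = p * r := by
  have key : ∀ N : ℕ, ∃ r ∈ teichmullerAlgebra p n, y = y ^ (p ^ n) ^ N + p * r := fun N => by
    induction N with
    | zero => exact ⟨0, zero_mem _, by ring⟩
    | succ N ih =>
      obtain ⟨r, hr, hyr⟩ := ih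
      obtain ⟨t, ht, hyt⟩ := exists_pow_eq_add (pow_mem hy ((p ^ n) ^ N))
      refine ⟨t + r, add_mem ht hr, ?_⟩
      rw [pow_succ, pow_mul]
      linear_combination hyr + hyt
  choose r hr hyr using key
  refine ⟨y / p, ?_, by rw [mul_div_cancel₀ _ natCast_ne_zero]⟩
  have hlim : Filter.Tendsto r Filter.atTop (nhds (y / p)) := by
    have h1 : r = fun N => (y - y ^ (p ^ n) ^ N) / p := funext fun N => by
      rw [eq_div_iff natCast_ne_zero]
      linear_combination -hyr N
    rw [h1]
    have h2 : Filter.Tendsto (fun N => y ^ (p ^ n) ^ N) Filter.atTop (nhds 0) :=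
      (tendsto_pow_atTop_nhds_zero_of_norm_lt_one h).comp
        (tendsto_pow_atTop_atTop_of_one_lt (one_lt_pow₀ (Fact.out : p.Prime).one_lt hn))
    simpa using (tendsto_const_nhds.sub h2).div_const (p : PadicAlgCl p)
  exact (isClosed_teichmullerAlgebra hn).mem_of_tendsto hlim (Filter.Eventually.of_forall hr)

theorem norm_natCast_lt_one : ‖(p : PadicAlgCl p)‖ < 1 := by
  rw [← PadicComplex.norm_extends, PadicComplex.coe_natCast]
  exact PadicComplexInt.norm_natCast_lt_one

theorem exists_pow_mul_mem {x : PadicAlgCl p} (hx : x ∈ Qpnr p) :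
    ∃ n : ℕ, n ≠ 0 ∧ ∃ N : ℕ, (p : PadicAlgCl p) ^ N * x ∈ teichmullerAlgebra p n := by
  rw [Qpnr_eq_adjoin, ← IntermediateField.mem_toSubalgebra,
    IntermediateField.adjoin_toSubalgebra_of_isAlgebraic fun x _ => Algebra.IsAlgebraic.isAlgebraic x,
    ← Subalgebra.mem_toSubmodule, Algebra.adjoin_eq_span, Submonoid.closure_eq] at hx
  induction hx using Submodule.span_induction with
  | mem x hx =>
    obtain ⟨n, hn, hx⟩ := hx
    exact ⟨n, hn, 0, by rw [pow_zero, one_mul]; exact Algebra.subset_adjoin hx⟩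
  | zero => exact ⟨1, one_ne_zero, 0, by rw [mul_zero]; exact zero_mem _⟩
  | add x y _ _ hx hy =>
    obtain ⟨m, hm, M, hx⟩ := hx
    obtain ⟨n, hn, N, hy⟩ := hy
    refine ⟨m * n, mul_ne_zero hm hn, M + N, ?_⟩
    have h1 : (p : PadicAlgCl p) ^ (M + N) * (x + y) =
        (p : PadicAlgCl p) ^ N * (p ^ M * x) + p ^ M * (p ^ N * y) := by ring
    rw [h1]
    exact add_mem (mul_mem (pow_mem (natCast_mem _ p) _) (teichmullerAlgebra_le_mul m n hx))
      (mul_mem (pow_mem (natCast_mem _ p) _)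
        (mul_comm m n ▸ teichmullerAlgebra_le_mul n m hy))
  | smul a x _ hx =>
    obtain ⟨n, hn, N, hx⟩ := hx
    obtain ⟨M, b, hb⟩ : ∃ (M : ℕ) (b : ℤ_[p]), (p : ℚ_[p]) ^ M * a = b := by
      obtain ⟨M, hM⟩ := exists_pow_lt_of_lt_one (x := (‖a‖ + 1)⁻¹) (by positivity)
        (Padic.norm_p_lt_one (p := p))
      refine ⟨M, ⟨(p : ℚ_[p]) ^ M * a, ?_⟩, rfl⟩
      rw [norm_mul, norm_pow]
      calc ‖(p : ℚ_[p])‖ ^ M * ‖a‖ ≤ (‖a‖ + 1)⁻¹ * (‖a‖ + 1) := by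
            gcongr; linarith
        _ = 1 := inv_mul_cancel₀ (by positivity)
    refine ⟨n, hn, M + N, ?_⟩
    have h1 : (p : PadicAlgCl p) ^ (M + N) * (a • x) = b • ((p : PadicAlgCl p) ^ N * x) := by
      rw [algebra_compatible_smul ℚ_[p] b, PadicInt.algebraMap_apply, ← hb, Algebra.smul_def,
        Algebra.smul_def, map_mul, map_pow, map_natCast]
      ring
    rw [h1]
    exact Subalgebra.smul_mem _ hx b

/-- Some `p ^ N x` lies in the algebra. As long as `N > 0` it has norm less than one, so a factor
`p` can be removed without leaving the algebra. -/
theorem exists_mem_teichmullerAlgebra {x : PadicAlgCl p} (hx : x ∈ Qpnr p) (h : ‖x‖ ≤ 1) :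
    ∃ n : ℕ, n ≠ 0 ∧ x ∈ teichmullerAlgebra p n := by
  obtain ⟨n, hn, N, hN⟩ := exists_pow_mul_mem hx
  refine ⟨n, hn, ?_⟩
  induction N with
  | zero => simpa using hN
  | succ N ih =>
    refine ih ?_
    obtain ⟨r, hr, hxr⟩ := exists_eq_mul_of_norm_lt_one hn hN (by
      rw [norm_mul, norm_pow]
      exact mul_lt_one_of_nonneg_of_lt_one_left (by positivity)
        (pow_lt_one₀ (norm_nonneg _) norm_natCast_lt_one N.succ_ne_zero) h)
    rw [pow_succ', mul_assoc] at hxr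
    rwa [mul_left_cancel₀ natCast_ne_zero hxr]

theorem teichmullerAlgebra_norm_le_one {n : ℕ} (hn : n ≠ 0) {x : PadicAlgCl p}
    (hx : x ∈ teichmullerAlgebra p n) : ‖x‖ ≤ 1 := by
  induction hx using Algebra.adjoin_induction with
  | mem x hx => exact norm_le_one_of_mem_teichmuller hn hx
  | algebraMap a =>
    rw [IsScalarTower.algebraMap_apply ℤ_[p] ℚ_[p] (PadicAlgCl p)]
    exact (PadicAlgCl.norm_extends p _).trans_le a.2
  | add x y _ _ hx hy => exact (IsUltrametricDist.norm_add_le_max _ _).trans (max_le hx hy)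
  | mul x y _ _ hx hy => rw [norm_mul]; exact mul_le_one₀ hx (norm_nonneg _) hy

/-- `p` is a uniformizer of the maximal unramified extension. -/
theorem norm_div_natCast_le_one {x : PadicAlgCl p} (hx : x ∈ Qpnr p) (h : ‖x‖ < 1) :
    ‖x / p‖ ≤ 1 := by
  obtain ⟨n, hn, hxn⟩ := exists_mem_teichmullerAlgebra hx h.le
  obtain ⟨r, hr, rfl⟩ := exists_eq_mul_of_norm_lt_one hn hxn h
  rw [mul_div_cancel_left₀ _ natCast_ne_zero]
  exact teichmullerAlgebra_norm_le_one hn hr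

end PadicAlgCl

/-! ### The completed unramified ring `W` and its Frobenius lift -/

namespace ZpnrHat

open PadicComplexInt

variable {p : ℕ} [Fact p.Prime]

theorem mem_Zpnr_iff {x : 𝓞_ℂ_[p]} : x ∈ Zpnr p ↔ ∃ y ∈ Qpnr p, (y : ℂ_[p]) = x := Iff.rfl

/-- The reduction map to the residue field of `𝓞_ℂ_p`. -/
noncomputable def residue : ZpnrHat p →+* IsLocalRing.ResidueField 𝓞_ℂ_[p] :=
  (IsLocalRing.residue 𝓞_ℂ_[p]).comp (ZpnrHat p).subtype

theorem isClosed : IsClosed (ZpnrHat p : Set 𝓞_ℂ_[p]) :=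
  Subring.isClosed_topologicalClosure _

/-- Approximate `w` by elements of the unramified ring before completion. They eventually have norm
less than one and are divisible by `p` there; the quotients converge to `w / p`. -/
theorem natCast_dvd_of_norm_lt_one {w : ZpnrHat p} (hw : ‖((w : 𝓞_ℂ_[p]) : ℂ_[p])‖ < 1) :
    (p : ZpnrHat p) ∣ w := by
  have hp0 : (p : ℂ_[p]) ≠ 0 := norm_pos_iff.mp norm_natCast_pos
  have key : ∀ x ∈ Zpnr p, ‖(x : ℂ_[p])‖ < 1 → ∃ y ∈ Zpnr p, x = p * y := by
    intro x hx h
    obtain ⟨y, hy, hyx⟩ := mem_Zpnr_iff.mp hx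
    rw [← hyx, PadicComplex.norm_extends] at h
    refine ⟨PadicAlgCl.toOCp _ (PadicAlgCl.norm_div_natCast_le_one hy h),
      ⟨y / p, div_mem hy (natCast_mem _ p), rfl⟩, Subtype.ext ?_⟩
    rw [← hyx]
    change (y : ℂ_[p]) = p * ((y / p : PadicAlgCl p) : ℂ_[p])
    rw [PadicComplex.coe_eq, PadicComplex.coe_eq, map_div₀, map_natCast, mul_div_cancel₀ _ hp0]
  obtain ⟨x, hx, hlim⟩ := mem_closure_iff_seq_limit.mp w.2
  have hlim' : Filter.Tendsto (fun n => (x n : ℂ_[p])) Filter.atTop (nhds ((w : 𝓞_ℂ_[p]) : ℂ_[p])) :=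
    (continuous_subtype_val.tendsto _).comp hlim
  have hev : ∀ᶠ n in Filter.atTop, ‖(x n : ℂ_[p])‖ < 1 :=
    hlim'.norm.eventually (gt_mem_nhds hw)
  have h0 : ∀ n, ∃ y ∈ Zpnr p, ‖(x n : ℂ_[p])‖ < 1 → x n = p * y := fun n => by
    by_cases h : ‖(x n : ℂ_[p])‖ < 1
    · obtain ⟨y, hy, hxy⟩ := key _ (hx n) h
      exact ⟨y, hy, fun _ => hxy⟩
    · exact ⟨0, zero_mem _, fun h' => absurd h' h⟩
  choose y hy hxy using h0
  have hy' : Filter.Tendsto (fun n => (y n : ℂ_[p])) Filter.atTop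
      (nhds (((w : 𝓞_ℂ_[p]) : ℂ_[p]) / p)) := by
    refine (hlim'.div_const (p : ℂ_[p])).congr' (hev.mono fun n hn => ?_)
    rw [hxy n hn, div_eq_iff hp0, mul_comm]
    rfl
  have hle : ‖((w : 𝓞_ℂ_[p]) : ℂ_[p]) / p‖ ≤ 1 :=
    le_of_tendsto hy'.norm (Filter.Eventually.of_forall fun n => mem_OCp.mp (y n).2)
  refine ⟨⟨⟨_, mem_OCp.mpr hle⟩, mem_closure_of_tendsto
    (tendsto_subtype_rng.mpr hy') (Filter.Eventually.of_forall hy)⟩, ?_⟩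
  apply Subtype.ext
  apply Subtype.ext
  change ((w : 𝓞_ℂ_[p]) : ℂ_[p]) = p * (((w : 𝓞_ℂ_[p]) : ℂ_[p]) / p)
  rw [mul_div_cancel₀ _ hp0]

theorem residue_eq_zero_iff {w : ZpnrHat p} : residue w = 0 ↔ (p : ZpnrHat p) ∣ w := by
  constructor
  · exact fun h => natCast_dvd_of_norm_lt_one (PadicComplexInt.residue_eq_zero_iff.mp h)
  · rintro ⟨y, rfl⟩
    rw [map_mul, map_natCast, CharP.cast_eq_zero, zero_mul]

/-- The algebraic closure of `ℚ_p` is dense in `ℂ_p`, so every residue class has an algebraic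
representative and then a Teichmüller one. Hence `W` has the full residue field of the ring of
integers of `ℂ_p`. -/
theorem exists_teichmuller_residue_eq (x : IsLocalRing.ResidueField 𝓞_ℂ_[p]) :
    ∃ n : ℕ, n ≠ 0 ∧ ∃ z : PadicAlgCl p, z ∈ PadicAlgCl.teichmuller p n ∧ ∃ hz : ‖z‖ ≤ 1,
      IsLocalRing.residue _ (PadicAlgCl.toOCp z hz) = x := by
  obtain ⟨x, rfl⟩ := IsLocalRing.residue_surjective x
  obtain ⟨y, hy⟩ := Metric.denseRange_iff.mp
    (UniformSpace.Completion.denseRange_coe (α := PadicAlgCl p)) (x : ℂ_[p]) 1 one_pos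
  rw [dist_eq_norm] at hy
  have hy1 : ‖y‖ ≤ 1 := by
    rw [← PadicComplex.norm_extends, ← sub_sub_self (x : ℂ_[p]) y, sub_eq_add_neg]
    refine (IsUltrametricDist.norm_add_le_max _ _).trans (max_le (mem_OCp.mp x.2) ?_)
    rw [norm_neg]
    exact hy.le
  obtain ⟨n, hn, z, hz, hyz⟩ := PadicAlgCl.exists_mem_teichmuller hy1
  refine ⟨n, hn, z, hz, PadicAlgCl.norm_le_one_of_mem_teichmuller hn hz, ?_⟩
  rw [(PadicAlgCl.residue_toOCp_eq_iff _ hy1).mpr (by rwa [norm_sub_rev])]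
  exact (PadicComplexInt.residue_eq_iff.mpr hy).symm

theorem residue_surjective : Function.Surjective (residue : ZpnrHat p →+* _) := fun x => by
  obtain ⟨n, hn, z, hz, hz1, rfl⟩ := exists_teichmuller_residue_eq x
  refine ⟨⟨PadicAlgCl.toOCp z hz1, Subring.le_topologicalClosure _ ⟨z, ?_, rfl⟩⟩, rfl⟩
  rw [PadicAlgCl.Qpnr_eq_adjoin]
  exact IntermediateField.subset_adjoin _ _ ⟨n, hn, hz⟩

theorem exists_residueField_pow_eq (x : IsLocalRing.ResidueField 𝓞_ℂ_[p]) :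
    ∃ n : ℕ, n ≠ 0 ∧ x ^ p ^ n = x := by
  obtain ⟨n, hn, z, hz, hz1, rfl⟩ := exists_teichmuller_residue_eq x
  refine ⟨n, hn, ?_⟩
  rw [← map_pow]
  congr 1
  exact Subtype.ext ((map_pow (algebraMap (PadicAlgCl p) ℂ_[p]) z _).symm.trans
    (congrArg _ (PadicAlgCl.mem_teichmuller.mp hz)))

/-- The Frobenius condition concerns algebraic elements only. It extends because each residue class
has a Teichmüller representative and `σ` is isometric. -/
theorem residue_actOCp {σ : GQp p} (hσ : IsArithmeticFrobenius σ) (x : 𝓞_ℂ_[p]) :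
    IsLocalRing.residue _ (σ.actOCp x) = IsLocalRing.residue _ x ^ p := by
  obtain ⟨n, hn, z, hz, hz1, h⟩ := exists_teichmuller_residue_eq (IsLocalRing.residue _ x)
  have h1 : IsLocalRing.residue _ (σ.actOCp x) =
      IsLocalRing.residue _ (σ.actOCp (PadicAlgCl.toOCp z hz1)) := by
    rw [PadicComplexInt.residue_eq_iff] at h ⊢
    change ‖σ.actCp x - σ.actCp (PadicAlgCl.toOCp z hz1)‖ < 1
    rw [← map_sub, σ.norm_actCp, norm_sub_rev]
    exact h
  rw [h1, ← h, ← map_pow, PadicComplexInt.residue_eq_iff]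
  have h2 := hσ z hz1
  rw [← PadicComplex.norm_extends, UniformSpace.Completion.coe_sub, PadicComplex.coe_eq (p := p) (z ^ p),
    map_pow, ← PadicComplex.coe_eq, ← σ.actCp_coe] at h2
  exact h2

theorem isFrobeniusLift {σ : GQp p} (hσ : IsArithmeticFrobenius σ) :
    IsFrobeniusLift p σ.actZpnrHat := by
  refine isFrobeniusLift_of_norm (K := ℂ_[p]) ((𝓞_ℂ_[p].subtype).comp (ZpnrHat p).subtype)
    (Subtype.val_injective.comp Subtype.val_injective) (fun w => mem_OCp.mp w.1.2) ?_
    norm_natCast_pos norm_natCast_lt_one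
    (fun w hw => natCast_dvd_of_norm_lt_one (hw.trans_lt norm_natCast_lt_one)) fun x => ?_
  · have hO : IsClosed ((𝓞_ℂ_[p] : ValuationSubring ℂ_[p]) : Set ℂ_[p]) :=
      (completeSpace_coe_iff_isComplete.mp (inferInstanceAs (CompleteSpace 𝓞_ℂ_[p]))).isClosed
    have h1 : Set.range ((𝓞_ℂ_[p].subtype).comp (ZpnrHat p).subtype) =
        Subtype.val '' (ZpnrHat p : Set 𝓞_ℂ_[p]) := by
      ext x
      constructor
      · rintro ⟨w, rfl⟩
        exact ⟨w, w.2, rfl⟩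
      · rintro ⟨w, hw, rfl⟩
        exact ⟨⟨w, hw⟩, rfl⟩
    rw [h1]
    exact hO.isClosedEmbedding_subtypeVal.isClosedMap _ isClosed
  · rw [← residue_eq_zero_iff, map_sub, map_pow, sub_eq_zero]
    exact residue_actOCp hσ x

end ZpnrHat

/-! ### The Galois action on `W`: inertia, commutation, fixed points, density -/

namespace GQp

variable {p : ℕ} [Fact p.Prime]

theorem actZpnrHat_one (w : ZpnrHat p) : (1 : GQp p).actZpnrHat w = w :=
  Subtype.ext (Subtype.ext (actCp_one _))

theorem actZpnrHat_mul (g h : GQp p) (w : ZpnrHat p) :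
    (g * h).actZpnrHat w = g.actZpnrHat (h.actZpnrHat w) :=
  Subtype.ext (Subtype.ext (actCp_mul g h _))

theorem actZpnrHat_algebraMap (g : GQp p) (a : ℤ_[p]) :
    g.actZpnrHat (algebraMap ℤ_[p] (ZpnrHat p) a) = algebraMap ℤ_[p] (ZpnrHat p) a :=
  Subtype.ext (g.actOCp_algebraMap a)

theorem actZpnrHat_of_mem_inertia {g : GQp p} (hg : g ∈ inertia p) (w : ZpnrHat p) :
    g.actZpnrHat w = w := by
  apply Subtype.ext
  change g.actOCp w = w
  have hw : (w : 𝓞_ℂ_[p]) ∈ closure (Zpnr p : Set 𝓞_ℂ_[p]) := w.2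
  refine closure_minimal (fun x hx => ?_) (isClosed_eq g.continuous_actOCp continuous_id) hw
  obtain ⟨y, hy, hyx⟩ := ZpnrHat.mem_Zpnr_iff.mp hx
  apply Subtype.ext
  change g.actCp x = x
  rw [← hyx, g.actCp_coe, (IntermediateField.mem_fixedField_iff _ _).mp hy g hg]

theorem apply_teichmuller {σ : GQp p} (hσ : IsArithmeticFrobenius σ) {z : PadicAlgCl p}
    (hz : z ∈ PadicAlgCl.allTeichmuller p) : σ z = z ^ p := by
  obtain ⟨n, hn, hz⟩ := hz
  exact PadicAlgCl.teichmuller_eq_of_norm_lt hn hn (PadicAlgCl.map_mem_teichmuller σ hz)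
    (pow_mem hz p) (hσ z (PadicAlgCl.norm_le_one_of_mem_teichmuller hn hz))

/-- On Teichmüller representatives `σ` is the `p`-th power map, which commutes with every `g`. The
commutator therefore lies in inertia, which acts trivially on `W`. -/
theorem actZpnrHat_comm {σ : GQp p} (hσ : IsArithmeticFrobenius σ) (g : GQp p) (w : ZpnrHat p) :
    σ.actZpnrHat (g.actZpnrHat w) = g.actZpnrHat (σ.actZpnrHat w) := by
  have h : (g * σ)⁻¹ * (σ * g) ∈ inertia p := by
    rw [PadicAlgCl.mem_inertia_iff]
    intro z hz
    have hgz : g z ∈ PadicAlgCl.allTeichmuller p := by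
      obtain ⟨n, hn, hz⟩ := hz
      exact ⟨n, hn, PadicAlgCl.map_mem_teichmuller g hz⟩
    have h1 : (σ * g) z = (g * σ) z := by
      rw [AlgEquiv.mul_apply, AlgEquiv.mul_apply, apply_teichmuller hσ hz,
        apply_teichmuller hσ hgz, map_pow]
    rw [AlgEquiv.mul_apply, h1, ← AlgEquiv.mul_apply, inv_mul_cancel, AlgEquiv.one_apply]
  have h1 := actZpnrHat_mul (g * σ) ((g * σ)⁻¹ * (σ * g)) w
  rw [mul_inv_cancel_left, actZpnrHat_of_mem_inertia h] at h1
  rw [← actZpnrHat_mul, ← actZpnrHat_mul, h1]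

theorem exists_algebraMap_eq {σ : GQp p} (hσ : IsArithmeticFrobenius σ) {w : ZpnrHat p}
    (hw : σ.actZpnrHat w = w) : ∃ a : ℤ_[p], algebraMap ℤ_[p] (ZpnrHat p) a = w :=
  (ZpnrHat.isFrobeniusLift hσ).exists_algebraMap_eq (π := ZpnrHat.residue)
    (fun _ => ZpnrHat.residue_eq_zero_iff) hw

theorem algebraMap_injective : Function.Injective (algebraMap ℤ_[p] (ZpnrHat p)) := fun a b h => by
  have h1 : ((algebraMap ℚ_[p] ℂ_[p]) a) = algebraMap ℚ_[p] ℂ_[p] b :=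
    congrArg (fun w : ZpnrHat p => ((w : 𝓞_ℂ_[p]) : ℂ_[p])) h
  exact Subtype.ext ((algebraMap ℚ_[p] ℂ_[p]).injective h1)

/-- A Frobenius and the inertia subgroup generate a dense subgroup. -/
theorem eq_top_of_isClosed {σ : GQp p} (hσ : IsArithmeticFrobenius σ) {H : Subgroup (GQp p)}
    (hH : IsClosed (H : Set (GQp p))) (hσH : σ ∈ H) (hI : inertia p ≤ H) : H = ⊤ := by
  have h := InfiniteGalois.fixingSubgroup_fixedField (⟨H, hH⟩ : ClosedSubgroup (GQp p))
  change (IntermediateField.fixedField H).fixingSubgroup = H at h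
  suffices hbot : IntermediateField.fixedField H = ⊥ by
    rw [← h, hbot, IntermediateField.fixingSubgroup_bot]
  rw [eq_bot_iff]
  intro x hx
  rw [IntermediateField.mem_fixedField_iff] at hx
  have hxQ : x ∈ Qpnr p := (IntermediateField.mem_fixedField_iff _ _).mpr fun g hg => hx g (hI hg)
  -- Clearing denominators moves `x` into `W`, where the fixed points of `σ` are `ℤ_p`. The fixed
  -- field of `H` is thus `ℚ_p`.
  obtain ⟨n, hn, N, hN⟩ := PadicAlgCl.exists_pow_mul_mem hxQ
  have hp0 : (p : PadicAlgCl p) ^ N ≠ 0 := pow_ne_zero _ PadicAlgCl.natCast_ne_zero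
  set y := (p : PadicAlgCl p) ^ N * x with hy
  have hyQ : y ∈ Qpnr p := mul_mem (pow_mem (natCast_mem _ p) _) hxQ
  let w : ZpnrHat p := ⟨PadicAlgCl.toOCp y (PadicAlgCl.teichmullerAlgebra_norm_le_one hn hN),
    Subring.le_topologicalClosure _ ⟨y, hyQ, rfl⟩⟩
  obtain ⟨a, ha⟩ := exists_algebraMap_eq hσ (w := w) (Subtype.ext <| Subtype.ext <|
    (σ.actCp_coe y).trans <| congrArg _ <| by rw [hy, map_mul, map_pow, map_natCast, hx σ hσH])
  have ha' : algebraMap (PadicAlgCl p) ℂ_[p] (algebraMap ℚ_[p] (PadicAlgCl p) a) =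
      algebraMap (PadicAlgCl p) ℂ_[p] y :=
    congrArg (fun w : ZpnrHat p => ((w : 𝓞_ℂ_[p]) : ℂ_[p])) ha
  have hxa : x = algebraMap ℚ_[p] (PadicAlgCl p) (a / p ^ N) := by
    rw [map_div₀, map_pow, map_natCast, (algebraMap (PadicAlgCl p) ℂ_[p]).injective ha', hy,
      mul_div_cancel_left₀ _ hp0]
  rw [hxa]
  exact (⊥ : IntermediateField ℚ_[p] (PadicAlgCl p)).algebraMap_mem _

/-- Galois elements are isometries, so approximating `x` by an algebraic `y` approximates the orbit
map uniformly in `g`; the orbit map of `y` is locally constant. -/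
theorem continuous_apply_actCp (x : ℂ_[p]) : Continuous fun g : GQp p => g.actCp x := by
  refine continuous_of_uniform_approx_of_continuous fun U hU => ?_
  obtain ⟨ε, hε, hεU⟩ := Metric.mem_uniformity_dist.mp hU
  obtain ⟨y, hy⟩ := Metric.denseRange_iff.mp
    (UniformSpace.Completion.denseRange_coe (α := PadicAlgCl p)) x ε hε
  refine ⟨fun g => g.actCp y, ?_, fun g => hεU ?_⟩
  · have h1 : Continuous fun g : GQp p => g y := by
      refine IsLocallyConstant.continuous (f := fun g : GQp p => g y) ?_
      rw [IsLocallyConstant.iff_exists_open]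
      intro g
      have hfd : FiniteDimensional ℚ_[p] (IntermediateField.adjoin ℚ_[p] {y}) :=
        IntermediateField.adjoin.finiteDimensional (Algebra.IsIntegral.isIntegral y)
      refine ⟨(fun h : GQp p => g⁻¹ * h) ⁻¹'
        ((IntermediateField.adjoin ℚ_[p] {y}).fixingSubgroup : Set (GQp p)),
        (IntermediateField.fixingSubgroup_isOpen _).preimage (continuous_const_mul g⁻¹),
        by simp, fun h hh => ?_⟩
      have h2 := (IntermediateField.mem_fixingSubgroup_iff _ _).mp hh y
        (IntermediateField.mem_adjoin_simple_self _ y)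
      have h3 := congrArg g h2
      rwa [← AlgEquiv.mul_apply, mul_inv_cancel_left] at h3
    simp only [actCp_coe]
    exact (UniformSpace.Completion.continuous_coe _).comp h1
  · rw [dist_eq_norm, ← map_sub, g.norm_actCp, ← dist_eq_norm]
    exact hy

theorem continuous_of_algebraMap {Y : Type*} [TopologicalSpace Y] {f : Y → ℤ_[p]}
    (h : Continuous fun y => ((algebraMap ℤ_[p] (ZpnrHat p) (f y) : 𝓞_ℂ_[p]) : ℂ_[p])) :
    Continuous f := by
  have h1 : Isometry fun a : ℤ_[p] => ((algebraMap ℤ_[p] (ZpnrHat p) a : 𝓞_ℂ_[p]) : ℂ_[p]) := by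
    refine Isometry.of_dist_eq fun a b => ?_
    change dist (algebraMap ℚ_[p] ℂ_[p] a) (algebraMap ℚ_[p] ℂ_[p] b) = _
    rw [dist_eq_norm, ← map_sub]
    exact (PadicComplex.norm_extends' p _).trans (dist_eq_norm a b).symm
  exact h1.isUniformInducing.isInducing.continuous_iff.mpr h

end GQp

/-- A solution of `σ(E) = u E` over the completed maximal unramified extension, commuting with
`u`. -/
theorem ZpnrHat.exists_commute_map_eq {p : ℕ} [Fact p.Prime] {ι : Type*} [Fintype ι]
    [DecidableEq ι] {σ : GQp p} (hσ : IsArithmeticFrobenius σ) (u : GL ι ℤ_[p]) :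
    ∃ E : GL ι (ZpnrHat p),
      Commute (Matrix.GeneralLinearGroup.map (algebraMap ℤ_[p] (ZpnrHat p)) u) E ∧
      Matrix.GeneralLinearGroup.map σ.actZpnrHat E =
        Matrix.GeneralLinearGroup.map (algebraMap ℤ_[p] (ZpnrHat p)) u * E := by
  obtain ⟨E, hE, hEu, hσE⟩ := (ZpnrHat.isFrobeniusLift hσ).exists_commute_map_eq
    (π := ZpnrHat.residue) ZpnrHat.residue_surjective (fun _ => ZpnrHat.residue_eq_zero_iff)
    ZpnrHat.exists_residueField_pow_eq
    (u := (Matrix.GeneralLinearGroup.map (algebraMap ℤ_[p] (ZpnrHat p)) u).val)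
    (v := (Matrix.GeneralLinearGroup.map (algebraMap ℤ_[p] (ZpnrHat p)) u)⁻¹.val)
    (Units.mul_inv _) (Matrix.ext fun i j => σ.actZpnrHat_algebraMap _)
  obtain ⟨E, rfl⟩ := hE
  exact ⟨E, Units.ext hEu, Units.ext hσE⟩

/-! ### The unramified representation attached to `u` -/

namespace GQp

variable {p : ℕ} [Fact p.Prime] {r : ℕ}

theorem map_actZpnrHat_algebraMap (g : GQp p) (u : GL (Fin r) ℤ_[p]) :
    Matrix.GeneralLinearGroup.map g.actZpnrHat
      (Matrix.GeneralLinearGroup.map (algebraMap ℤ_[p] (ZpnrHat p)) u) =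
      Matrix.GeneralLinearGroup.map (algebraMap ℤ_[p] (ZpnrHat p)) u :=
  Units.ext (Matrix.ext fun _ _ => g.actZpnrHat_algebraMap _)

theorem map_algebraMap_injective : Function.Injective
    (Matrix.GeneralLinearGroup.map (n := Fin r) (algebraMap ℤ_[p] (ZpnrHat p))) := fun _ _ h =>
  Units.ext (Matrix.ext fun i j => algebraMap_injective
    (congrArg (fun x : GL (Fin r) (ZpnrHat p) => x.val i j) h))

theorem exists_map_algebraMap_eq {σ : GQp p} (hσ : IsArithmeticFrobenius σ)
    {c : GL (Fin r) (ZpnrHat p)} (hc : Matrix.GeneralLinearGroup.map σ.actZpnrHat c = c) :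
    ∃ a : GL (Fin r) ℤ_[p],
      Matrix.GeneralLinearGroup.map (algebraMap ℤ_[p] (ZpnrHat p)) a = c := by
  have key : ∀ c : GL (Fin r) (ZpnrHat p), Matrix.GeneralLinearGroup.map σ.actZpnrHat c = c →
      ∃ a : Matrix (Fin r) (Fin r) ℤ_[p], (algebraMap ℤ_[p] (ZpnrHat p)).mapMatrix a = c.val :=
    fun c hc => by
      choose a ha using fun i j => exists_algebraMap_eq hσ
        (congrArg (fun x : GL (Fin r) (ZpnrHat p) => x.val i j) hc)
      exact ⟨Matrix.of a, Matrix.ext ha⟩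
  obtain ⟨a, ha⟩ := key c hc
  obtain ⟨b, hb⟩ := key c⁻¹ (by rw [map_inv, hc])
  have hinj : Function.Injective ((algebraMap ℤ_[p] (ZpnrHat p)).mapMatrix (m := Fin r)) :=
    Matrix.map_injective algebraMap_injective
  have hab : a * b = 1 := hinj (by rw [map_mul, ha, hb, map_one, Units.mul_inv])
  have hba : b * a = 1 := hinj (by rw [map_mul, ha, hb, map_one, Units.inv_mul])
  exact ⟨⟨a, b, hab, hba⟩, Units.ext ha⟩

/-- Take `E` with `φ⁻¹(E) = u⁻¹ E` and put `ρ(g) = E⁻¹ g(E)`. As `g` commutes with `φ⁻¹` on `W` and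
fixes `u`, this is fixed by `φ⁻¹`, so its entries lie in `ℤ_p`. Galois then fixes the values, and
the cocycle relation becomes multiplicativity. Finally `ρ(φ) = E⁻¹ u E`, which is `u` only because
`E` commutes with `u`. -/
theorem exists_isUnramifiedRep {φ : GQp p} (hφ : IsGeometricFrobenius φ) (u : GL (Fin r) ℤ_[p]) :
    ∃ ρ : GQp p →* GL (Fin r) ℤ_[p], IsUnramifiedRep φ u ρ := by
  obtain ⟨E, hEu, hσE⟩ := ZpnrHat.exists_commute_map_eq hφ u⁻¹
  let m : GQp p → GL (Fin r) (ZpnrHat p) →* GL (Fin r) (ZpnrHat p) :=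
    fun g => Matrix.GeneralLinearGroup.map g.actZpnrHat
  let ι := Matrix.GeneralLinearGroup.map (n := Fin r) (algebraMap ℤ_[p] (ZpnrHat p))
  have hm : ∀ g h x, m (g * h) x = m g (m h x) := fun g h x =>
    Units.ext (Matrix.ext fun _ _ => actZpnrHat_mul g h _)
  have hm1 : ∀ x, m 1 x = x := fun x => Units.ext (Matrix.ext fun _ _ => actZpnrHat_one _)
  have hmι : ∀ g a, m g (ι a) = ι a := fun g a => g.map_actZpnrHat_algebraMap a
  have hmc : ∀ g x, m φ⁻¹ (m g x) = m g (m φ⁻¹ x) := fun g x =>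
    Units.ext (Matrix.ext fun _ _ => actZpnrHat_comm hφ g _)
  have hσE' : m φ⁻¹ E = ι u⁻¹ * E := hσE
  have hfix : ∀ g, m φ⁻¹ (E⁻¹ * m g E) = E⁻¹ * m g E := fun g => by
    rw [map_mul, map_inv, hmc, hσE', map_mul, hmι]
    group
  choose ρ hρ using fun g => exists_map_algebraMap_eq hφ (hfix g)
  have hρ' : ∀ g, ι (ρ g) = E⁻¹ * m g E := hρ
  have hmul : ∀ g h, ρ (g * h) = ρ g * ρ h := fun g h => map_algebraMap_injective <| by
    change ι (ρ (g * h)) = ι (ρ g * ρ h)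
    rw [map_mul, ← hmι g (ρ h), hρ', hρ', hρ', hm, map_mul, map_inv]
    group
  have hone : ρ 1 = 1 := map_algebraMap_injective <| by
    change ι (ρ 1) = ι 1
    rw [hρ', hm1, inv_mul_cancel, map_one]
  have hcont : Continuous fun g => (ρ g).val := by
    refine continuous_matrix fun i j => continuous_of_algebraMap ?_
    have h1 : (fun g => ((algebraMap ℤ_[p] (ZpnrHat p) ((ρ g).val i j) : 𝓞_ℂ_[p]) : ℂ_[p])) =
        fun g => ∑ k, (((E⁻¹).val i k : 𝓞_ℂ_[p]) : ℂ_[p]) *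
          g.actCp ((E.val k j : 𝓞_ℂ_[p]) : ℂ_[p]) := by
      funext g
      have h2 : algebraMap ℤ_[p] (ZpnrHat p) ((ρ g).val i j) =
          ∑ k, (E⁻¹).val i k * g.actZpnrHat (E.val k j) :=
        congrArg (fun x : GL (Fin r) (ZpnrHat p) => x.val i j) (hρ g)
      have h3 := congrArg ((𝓞_ℂ_[p].subtype).comp (ZpnrHat p).subtype) h2
      rw [map_sum] at h3
      exact h3
    rw [h1]
    exact continuous_finsetSum _ fun k _ => continuous_const.mul (continuous_apply_actCp _)
  refine ⟨⟨⟨ρ, hone⟩, hmul⟩, ?_, fun g hg => ?_, ?_⟩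
  · refine Units.continuous_iff.mpr ⟨hcont, ?_⟩
    have h1 : (fun g => ((ρ g)⁻¹).val) = fun g => (ρ g⁻¹).val := by
      funext g
      congr 1
      rw [inv_eq_iff_mul_eq_one, ← hmul, mul_inv_cancel, hone]
    change Continuous fun g => ((ρ g)⁻¹).val
    rw [h1]
    exact hcont.comp continuous_inv
  · refine map_algebraMap_injective ?_
    change ι (ρ g) = ι 1
    have h1 : m g E = E := Units.ext (Matrix.ext fun _ _ => actZpnrHat_of_mem_inertia hg _)
    rw [hρ', h1, inv_mul_cancel, map_one]
  · refine map_algebraMap_injective ?_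
    change ι (ρ φ) = ι u
    have h1 : E = ι u⁻¹ * m φ E := by
      rw [← hmι φ, ← map_mul, ← hσE', ← hm, mul_inv_cancel, hm1]
    have h2 : m φ E = ι u * E := by
      conv_rhs => rw [h1]
      rw [map_inv, mul_inv_cancel_left]
    have h3 : Commute (ι u) E := by
      have h4 : Commute (ι u⁻¹) E := hEu
      rw [map_inv] at h4
      exact Commute.inv_left_iff.mp h4
    rw [hρ', h2, h3.eq, inv_mul_cancel_left]

end GQp

/-! ### Endomorphisms of the multiplicative group over a `ℤ_p`-algebra, and base change -/

namespace MvPowerSeries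

variable {p : ℕ} [hp : Fact p.Prime] {r : ℕ} {S : Type*} [CommRing S] [Algebra ℤ_[p] S]

theorem constantCoeff_multiplicativeEnd' (A : Matrix (Fin r) (Fin r) ℤ_[p]) (i : Fin r) :
    constantCoeff (multiplicativeEnd S A i) = 0 := by
  rw [multiplicativeEnd_eq_map, constantCoeff_map, constantCoeff_multiplicativeEnd, map_zero]

theorem hasSubst_multiplicativeEnd (A : Matrix (Fin r) (Fin r) ℤ_[p]) :
    HasSubst (multiplicativeEnd S A) :=
  hasSubst_of_constantCoeff_zero (constantCoeff_multiplicativeEnd' A)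

theorem map_multiplicativeEnd {s : S →+* S} (hs : ∀ a, s (algebraMap ℤ_[p] S a) = algebraMap _ _ a)
    (A : Matrix (Fin r) (Fin r) ℤ_[p]) :
    (fun i => MvPowerSeries.map s (multiplicativeEnd S A i)) = multiplicativeEnd S A := by
  ext1 i
  rw [multiplicativeEnd_eq_map]
  ext e
  simp [hs]

theorem tupleComp_multiplicativeEnd (A B : Matrix (Fin r) (Fin r) ℤ_[p]) :
    tupleComp (multiplicativeEnd S A) (multiplicativeEnd S B) = multiplicativeEnd S (A * B) := by
  rw [multiplicativeEnd_eq_map (S := S) A, multiplicativeEnd_eq_map (S := S) B,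
    multiplicativeEnd_eq_map (S := S) (A * B), ← multiplicativeEnd_mul,
    FormalGroupLaw.map_tupleComp _ (hasSubst_multiplicativeEnd B)]

theorem multiplicativeEnd_natCast_smul (n : ℕ) :
    multiplicativeEnd S ((n : ℤ_[p]) • (1 : Matrix (Fin r) (Fin r) ℤ_[p])) =
      fun i => (1 + X i) ^ n - 1 := by
  rw [multiplicativeEnd_eq_map, multiplicativeEnd_natCast]
  simp

theorem multiplicativeEnd_one_eq_X :
    multiplicativeEnd S (1 : Matrix (Fin r) (Fin r) ℤ_[p]) = X := by
  rw [multiplicativeEnd_eq_map, multiplicativeEnd_one]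
  simp

theorem jac_multiplicativeEnd_eq_map (A : Matrix (Fin r) (Fin r) ℤ_[p]) :
    jac (multiplicativeEnd S A) = A.map (algebraMap ℤ_[p] S) := by
  rw [multiplicativeEnd_eq_map, jac_map, jac_multiplicativeEnd]

/-- The series `(1 + X) ^ p - 1` is attached to the scalar matrix `p`, which commutes with `A`. -/
theorem intertwines_multiplicativeEnd {s : S →+* S}
    (hs : ∀ a, s (algebraMap ℤ_[p] S a) = algebraMap _ _ a) (A : Matrix (Fin r) (Fin r) ℤ_[p]) :
    Intertwines s (fun i => (1 + X i) ^ p - 1) (fun i => (1 + X i) ^ p - 1)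
      (multiplicativeEnd S A) where
  constantCoeff_eq_zero := constantCoeff_multiplicativeEnd' A
  comm := by
    rw [map_multiplicativeEnd hs, ← multiplicativeEnd_natCast_smul (p := p),
      tupleComp_multiplicativeEnd, tupleComp_multiplicativeEnd]
    simp

end MvPowerSeries

namespace FormalGroupLaw

variable {r : ℕ} {R S : Type*} [CommRing R] [CommRing S]

theorem tupleComp_multiplicative {τ : Type*} {a b : Fin r → MvPowerSeries τ R}
    (ha : ∀ i, constantCoeff (a i) = 0) (hb : ∀ i, constantCoeff (b i) = 0) :
    tupleComp (multiplicative r R).toSeries (Sum.elim a b) = fun i => a i + b i + a i * b i := by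
  have h := hasSubst_elim ha hb
  ext1 i
  simp [tupleComp, multiplicative, subst_add h, subst_mul h, subst_X h]

theorem subst_one_add_pow_sub_one {σ τ : Type*} {a : σ → MvPowerSeries τ R} (ha : HasSubst a)
    (n : ℕ) (i : σ) : subst a ((1 + X i) ^ n - 1 : MvPowerSeries σ R) = (1 + a i) ^ n - 1 := by
  have h1 : subst a (1 : MvPowerSeries σ R) = 1 := by rw [← coe_substAlgHom ha, map_one]
  rw [subst_sub ha, subst_pow ha, subst_add ha, subst_X ha, h1]

theorem isHom_multiplicative_pow (n : ℕ) :
    (multiplicative r R).IsHom (multiplicative r R) fun i => (1 + X i) ^ n - 1 := by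
  have hc : ∀ i : Fin r, constantCoeff ((1 + X i) ^ n - 1 : MvPowerSeries (Fin r) R) = 0 := by simp
  have hl : HasSubst fun j : Fin r => (X (Sum.inl j) : MvPowerSeries (Fin r ⊕ Fin r) R) :=
    hasSubst_of_constantCoeff_zero (by simp)
  have hr : HasSubst fun j : Fin r => (X (Sum.inr j) : MvPowerSeries (Fin r ⊕ Fin r) R) :=
    hasSubst_of_constantCoeff_zero (by simp)
  refine ⟨hc, ?_⟩
  rw [tupleComp_multiplicative (constantCoeff_tupleComp hc (by simp))
    (constantCoeff_tupleComp hc (by simp))]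
  ext1 i
  rw [tupleComp, tupleComp, tupleComp, subst_one_add_pow_sub_one hl, subst_one_add_pow_sub_one hr,
    subst_one_add_pow_sub_one
      (hasSubst_of_constantCoeff_zero (multiplicative r R).constantCoeff_eq_zero)]
  have h : (1 + (multiplicative r R).toSeries i) = (1 + X (Sum.inl i)) * (1 + X (Sum.inr i)) := by
    simp only [multiplicative]; ring
  rw [h, mul_pow]
  ring

theorem IsHom.map {F G : FormalGroupLaw r R} {θ : Fin r → MvPowerSeries (Fin r) R}
    (h : F.IsHom G θ) (φ : R →+* S) :
    (F.map φ).IsHom (G.map φ) fun i => MvPowerSeries.map φ (θ i) := by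
  have hl : HasSubst fun j : Fin r => (X (Sum.inl j) : MvPowerSeries (Fin r ⊕ Fin r) R) :=
    hasSubst_of_constantCoeff_zero (by simp)
  have hr : HasSubst fun j : Fin r => (X (Sum.inr j) : MvPowerSeries (Fin r ⊕ Fin r) R) :=
    hasSubst_of_constantCoeff_zero (by simp)
  refine ⟨fun i => by rw [constantCoeff_map, h.1, map_zero], ?_⟩
  have h1 := map_tupleComp φ (θ := θ) (hasSubst_of_constantCoeff_zero F.constantCoeff_eq_zero)
  have h2 := map_tupleComp φ (θ := G.toSeries) (hasSubst_elim
    (constantCoeff_tupleComp (η := fun j => (X (Sum.inl j) : MvPowerSeries (Fin r ⊕ Fin r) R))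
      h.1 (by simp))
    (constantCoeff_tupleComp (η := fun j => (X (Sum.inr j) : MvPowerSeries (Fin r ⊕ Fin r) R))
      h.1 (by simp)))
  rw [map_elim, ← map_tupleComp φ hl, ← map_tupleComp φ hr] at h2
  simp only [map_X] at h2
  refine h1.trans (Eq.trans ?_ h2.symm)
  rw [h.2]

end FormalGroupLaw

theorem IsFrobeniusSeries.map {p : ℕ} {ι R S : Type*} [CommRing R] [CommRing S] (φ : R →+* S)
    {A : Matrix ι ι R} {d : ι → MvPowerSeries ι R} (hd : IsFrobeniusSeries p A d) :
    IsFrobeniusSeries p (A.map φ) fun i => MvPowerSeries.map φ (d i) where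
  constantCoeff_eq_zero i := by rw [constantCoeff_map, hd.constantCoeff_eq_zero, map_zero]
  linear := by
    rw [jac_map, hd.linear]
    ext i j
    simp
  frobenius i e := by
    have h := map_dvd φ (hd.frobenius i e)
    rwa [map_natCast, ← coeff_map, map_sub, map_pow, map_X] at h

/-- Used with `t = s` to recognize `θ^s` as another intertwiner of the same two series. -/
theorem Intertwines.map {ι τ R : Type*} [CommRing R] [Finite ι] [Finite τ] {s t : R →+* R}
    (hst : t.comp s = s.comp t)
    {d : τ → MvPowerSeries τ R} {f : ι → MvPowerSeries ι R} {Φ : ι → MvPowerSeries τ R}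
    (hd0 : ∀ i, constantCoeff (d i) = 0)
    (hd : ∀ i, MvPowerSeries.map t (d i) = d i) (hf : ∀ i, MvPowerSeries.map t (f i) = f i)
    (h : Intertwines s d f Φ) : Intertwines s d f fun i => MvPowerSeries.map t (Φ i) where
  constantCoeff_eq_zero i := by rw [constantCoeff_map, h.constantCoeff_eq_zero, map_zero]
  comm := by
    have h1 := FormalGroupLaw.map_tupleComp t (θ := fun i => MvPowerSeries.map s (Φ i))
      (hasSubst_of_constantCoeff_zero hd0)
    have h2 := FormalGroupLaw.map_tupleComp t (θ := f) h.hasSubst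
    rw [h.comm, ← h2] at h1
    simp only [hd, hf] at h1
    rw [← h1]
    congr 1
    ext1 i
    change ((MvPowerSeries.map s).comp (MvPowerSeries.map t)) (Φ i) =
      ((MvPowerSeries.map t).comp (MvPowerSeries.map s)) (Φ i)
    rw [← MvPowerSeries.map_comp, ← MvPowerSeries.map_comp, hst]

/-! ### Lubin–Tate groups: existence and the isomorphism with `𝔾_m^r` over `W` -/

section LubinTate

variable {p : ℕ} [Fact p.Prime] {r : ℕ}

theorem IsLubinTateSeries.isFrobeniusSeries {A : Matrix (Fin r) (Fin r) ℤ_[p]}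
    {d : Fin r → MvPowerSeries (Fin r) ℤ_[p]} (h : IsLubinTateSeries ((p : ℤ_[p]) • A) d) :
    IsFrobeniusSeries p A d :=
  ⟨h.constantCoeff_eq_zero, Matrix.ext h.linear, h.frobenius⟩

theorem exists_isLubinTate (u : GL (Fin r) ℤ_[p]) :
    ∃ F : FormalGroupLaw r ℤ_[p], IsLubinTate ((p : ℤ_[p]) • u.val) F := by
  have hp : p.Prime := Fact.out
  have hd : IsLubinTateSeries ((p : ℤ_[p]) • u.val)
      (fun i => linSeries ((p : ℤ_[p]) • u.val) i + X i ^ p) := by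
    refine ⟨fun i => ?_, fun i j => ?_, fun i e => ?_⟩
    · rw [map_add, constantCoeff_linSeries, map_pow, constantCoeff_X, zero_pow hp.ne_zero, add_zero]
    · have h1 : coeff (Finsupp.single j 1) (X i ^ p : MvPowerSeries (Fin r) ℤ_[p]) = 0 := by
        classical
        rw [coeff_X_pow, if_neg]
        intro h
        have h2 := congrArg Finsupp.degree h
        simp only [Finsupp.degree_single] at h2
        exact hp.one_lt.ne h2
      rw [map_add, h1, add_zero]
      exact congrFun (congrFun (jac_linSeries ((p : ℤ_[p]) • u.val)) i) j
    · rw [add_sub_cancel_right, linSeries, map_sum]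
      refine Finset.dvd_sum fun j _ => ?_
      rw [coeff_C_mul, Matrix.smul_apply, smul_eq_mul, mul_assoc]
      exact dvd_mul_right _ _
  obtain ⟨F, hF⟩ := FormalGroupLaw.exists_isHom_of_isFrobeniusSeries (isFrobeniusLift_padicInt p)
    (Units.mul_inv u) hd.isFrobeniusSeries
  exact ⟨F, _, hd, hF⟩

/-- Over the completed maximal unramified extension, a Lubin–Tate formal group is isomorphic to
the multiplicative group. -/
theorem IsLubinTate.exists_iso {φ : GQp p} (hφ : IsGeometricFrobenius φ) {u : GL (Fin r) ℤ_[p]}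
    {F : FormalGroupLaw r ℤ_[p]} (hF : IsLubinTate ((p : ℤ_[p]) • (u⁻¹).val) F) :
    ∃ (ε : GL (Fin r) (ZpnrHat p))
      (θ : (F.map (algebraMap ℤ_[p] (ZpnrHat p))).Iso
        (FormalGroupLaw.multiplicative r (ZpnrHat p))),
      Matrix.GeneralLinearGroup.map φ.actZpnrHat ε⁻¹ * ε =
        Matrix.GeneralLinearGroup.map (algebraMap ℤ_[p] (ZpnrHat p)) u⁻¹ ∧
      jac θ.hom = (ε⁻¹).val ∧
      tupleComp (fun i => MvPowerSeries.map φ.actZpnrHat (θ.hom i)) θ.inv =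
        multiplicativeEnd (ZpnrHat p) (u⁻¹).val := by
  obtain ⟨d, hd, hFd⟩ := hF
  obtain ⟨E, hUE, hsE⟩ := ZpnrHat.exists_commute_map_eq hφ u
  set s := GQp.actZpnrHat φ⁻¹ with hs_def
  have hs : IsFrobeniusLift p s := ZpnrHat.isFrobeniusLift hφ
  have hsa : ∀ a, s (algebraMap ℤ_[p] (ZpnrHat p) a) = algebraMap _ _ a :=
    GQp.actZpnrHat_algebraMap φ⁻¹
  set U := Matrix.GeneralLinearGroup.map (n := Fin r) (algebraMap ℤ_[p] (ZpnrHat p)) u with hU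
  let dW : Fin r → MvPowerSeries (Fin r) (ZpnrHat p) :=
    fun i => MvPowerSeries.map (algebraMap ℤ_[p] (ZpnrHat p)) (d i)
  let f : Fin r → MvPowerSeries (Fin r) (ZpnrHat p) := fun i => (1 + X i) ^ p - 1
  have hd' : IsFrobeniusSeries p (U⁻¹).val dW :=
    hd.isFrobeniusSeries.map (algebraMap ℤ_[p] (ZpnrHat p))
  have hf : IsFrobeniusSeries p (1 : Matrix (Fin r) (Fin r) (ZpnrHat p)) f :=
    isFrobeniusSeries_multiplicative p r
  have h11 : (1 : Matrix (Fin r) (Fin r) (ZpnrHat p)) * 1 = 1 := one_mul 1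
  have hsE' : E.val.map s = (U * E).val := congrArg (fun x : GL (Fin r) (ZpnrHat p) => x.val) hsE
  have hsEi : (E⁻¹).val.map s = (U⁻¹ * E⁻¹).val := by
    have h1 : Matrix.GeneralLinearGroup.map s E⁻¹ = U⁻¹ * E⁻¹ := by
      rw [map_inv, hsE, hUE.eq, mul_inv_rev]
    exact congrArg (fun x : GL (Fin r) (ZpnrHat p) => x.val) h1
  -- The condition on the linear part is `s(E) U⁻¹ = E`. Since `s(E) = U E`, it holds because `E`
  -- commutes with `U`; the condition for the inverse uses the same fact.
  obtain ⟨θ, hθ, hθE⟩ := exists_intertwines hs h11 hd' hf E.val (by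
    rw [hsE', one_mul, ← Units.val_mul, hUE.eq, mul_inv_cancel_right])
  obtain ⟨η, hη, hηE⟩ := exists_intertwines hs (Units.inv_mul U) hf hd' (E⁻¹).val (by
    rw [hsEi, mul_one, Units.val_mul])
  have hd0 := hd'.constantCoeff_eq_zero
  have hf0 := hf.constantCoeff_eq_zero
  have hηθ : tupleComp η θ = X := Intertwines.ext hs (Units.mul_inv U) hd' hd'
    (Intertwines.comp hd0 hf0 hη hθ) (Intertwines.X hd0) (by
      rw [jac_tupleComp hη.constantCoeff_eq_zero hθ.constantCoeff_eq_zero, hηE, hθE, jac_X,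
        Units.inv_mul])
  have hθη : tupleComp θ η = X := Intertwines.ext hs h11 hf hf
    (Intertwines.comp hf0 hd0 hθ hη) (Intertwines.X hf0) (by
      rw [jac_tupleComp hθ.constantCoeff_eq_zero hη.constantCoeff_eq_zero, hηE, hθE, jac_X,
        Units.mul_inv])
  have hmapd : ∀ {τ : Type} (g : MvPowerSeries τ ℤ_[p]), MvPowerSeries.map s
      (MvPowerSeries.map (algebraMap ℤ_[p] (ZpnrHat p)) g) = MvPowerSeries.map (algebraMap _ _) g :=
    fun g => MvPowerSeries.ext fun e => by simp only [coeff_map, hsa]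
  have hFint : Intertwines s (sumSeries dW dW) dW
      (F.map (algebraMap ℤ_[p] (ZpnrHat p))).toSeries :=
    FormalGroupLaw.intertwines_toSeries (hFd.map _) fun i => hmapd _
  have hGint : Intertwines s (sumSeries f f) f (FormalGroupLaw.multiplicative r _).toSeries :=
    FormalGroupLaw.intertwines_toSeries (FormalGroupLaw.isHom_multiplicative_pow p) fun i => by
      simp [FormalGroupLaw.multiplicative]
  let iso : (F.map (algebraMap ℤ_[p] (ZpnrHat p))).Iso
      (FormalGroupLaw.multiplicative r (ZpnrHat p)) :=
    { hom := θ
      inv := η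
      isHom_hom := FormalGroupLaw.isHom_of_intertwines hs h11 hd' hf hFint hGint hθ
      isHom_inv := FormalGroupLaw.isHom_of_intertwines hs (Units.mul_inv U) hf hd' hGint hFint hη
      inv_comp_hom := hηθ
      hom_comp_inv := hθη }
  -- Both sides intertwine `dW` with `f` and have linear part `U E`, so uniqueness identifies them.
  have hθs : (fun i => MvPowerSeries.map s (θ i)) =
      tupleComp (multiplicativeEnd (ZpnrHat p) u.val) θ := by
    refine Intertwines.ext hs h11 hd' hf
      (Intertwines.map rfl hd0 (fun i => hmapd _) (fun i => by simp [f]) hθ)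
      (Intertwines.comp hd0 hf0 (intertwines_multiplicativeEnd hsa u.val) hθ) ?_
    rw [jac_map, jac_tupleComp (constantCoeff_multiplicativeEnd' _) hθ.constantCoeff_eq_zero,
      jac_multiplicativeEnd_eq_map, hθE, hsE', Units.val_mul]
    rfl
  have hφs : ∀ w, φ.actZpnrHat (s w) = w := fun w => by
    rw [hs_def, ← GQp.actZpnrHat_mul, mul_inv_cancel, GQp.actZpnrHat_one]
  let θφ : Fin r → MvPowerSeries (Fin r) (ZpnrHat p) := fun i => MvPowerSeries.map φ.actZpnrHat (θ i)
  have hθφ0 : HasSubst θφ := hasSubst_of_constantCoeff_zero fun i => by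
    rw [constantCoeff_map, hθ.constantCoeff_eq_zero, map_zero]
  -- Apply `φ`, the inverse of `s`, to the previous relation. Composing with the endomorphism of
  -- `u⁻¹` then isolates `θ^φ`.
  have hθφ : θ = tupleComp (multiplicativeEnd (ZpnrHat p) u.val) θφ := by
    have h1 := FormalGroupLaw.map_tupleComp φ.actZpnrHat
      (θ := multiplicativeEnd (ZpnrHat p) u.val) hθ.hasSubst
    rw [map_multiplicativeEnd φ.actZpnrHat_algebraMap, ← hθs] at h1
    rw [h1]
    exact funext fun i => MvPowerSeries.ext fun e => by simp only [coeff_map, hφs]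
  refine ⟨E⁻¹, iso, ?_, by rw [inv_inv]; exact hθE, ?_⟩
  · rw [inv_inv]
    have h1 : Matrix.GeneralLinearGroup.map φ.actZpnrHat (U * E) = E := by
      rw [← hsE]
      exact Units.ext (Matrix.ext fun i j => hφs _)
    rw [map_mul, hU, GQp.map_actZpnrHat_algebraMap, ← eq_inv_mul_iff_mul_eq] at h1
    rw [h1, mul_inv_cancel_right, map_inv]
  · change tupleComp θφ η = _
    have h1 : θφ = tupleComp (multiplicativeEnd (ZpnrHat p) (u⁻¹).val) θ := by
      conv_rhs => rw [hθφ]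
      rw [← tupleComp_assoc (hasSubst_multiplicativeEnd _) hθφ0, tupleComp_multiplicativeEnd,
        Units.inv_mul, multiplicativeEnd_one_eq_X, X_tupleComp hθφ0]
    rw [h1, tupleComp_assoc hθ.hasSubst hη.hasSubst, hθη, tupleComp_X]

end LubinTate

/-! ### Points of the formal group as tuples of principal units -/

section EvalAt

variable {R S : Type*} [CommRing R] [CommRing S] [UniformSpace S] [Algebra R S]

theorem evalAt_map {R' : Type*} [CommRing R'] [Algebra R' S] {σ : Type*} {φ : R →+* R'}
    (h : ∀ a, algebraMap R' S (φ a) = algebraMap R S a) (x : σ → S) (f : MvPowerSeries σ R) :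
    evalAt x (MvPowerSeries.map φ f) = evalAt x f := by
  simp only [evalAt, coeff_map, h]

theorem evalAt_zero_of_constantCoeff {σ : Type*} {f : MvPowerSeries σ R}
    (hf : constantCoeff f = 0) : evalAt (0 : σ → S) f = 0 := by
  rw [evalAt]
  refine (tsum_congr fun d => ?_).trans tsum_zero
  by_cases hd : d = 0
  · rw [hd, coeff_zero_eq_constantCoeff_apply, hf, map_zero, zero_mul]
  · obtain ⟨i, hi⟩ := Finsupp.ne_iff.mp hd
    rw [Finsupp.prod, Finset.prod_eq_zero (Finsupp.mem_support_iff.mpr hi), mul_zero]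
    exact zero_pow hi

namespace FormalGroupLaw.Iso

variable {r : ℕ} {R₀ : Type*} [CommRing R₀] [Algebra R₀ R] {F : FormalGroupLaw r R₀}
  (θ : (F.map (algebraMap R₀ R)).Iso (multiplicative r R))

/-- The values `1 + θ(x)`, for an isomorphism `θ` onto the multiplicative group. -/
noncomputable def unitsAt (x : F.Points S) (i : Fin r) : S :=
  1 + evalAt x.val (θ.hom i)

theorem unitsAt_zero : θ.unitsAt (0 : F.Points S) = 1 :=
  funext fun i => by
    rw [unitsAt]
    change 1 + evalAt (0 : Fin r → S) (θ.hom i) = 1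
    rw [evalAt_zero_of_constantCoeff (θ.isHom_hom.1 i), add_zero]

end FormalGroupLaw.Iso

variable [IsUniformAddGroup S] [CompleteSpace S] [T2Space S] [IsTopologicalRing S]
  [IsLinearTopology S S]

/-- Evaluation at a point, as a ring homomorphism. -/
theorem exists_ringHom_eq_evalAt {σ : Type*} {x : σ → S} (hx : HasEval x) :
    ∃ ε : MvPowerSeries σ R →+* S, ∀ f, ε f = evalAt x f := by
  let : UniformSpace R := ⊥
  exact ⟨eval₂Hom continuous_of_discreteTopology hx, fun f => by
    rw [evalAt_eq_eval₂ hx, coe_eval₂Hom continuous_of_discreteTopology hx]⟩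

/-- A Galois element moves the coefficients in `W` as well as the point, so `θ` has to be replaced
by its conjugate. -/
theorem map_evalAt_of_semilinear {σ : Type*} {x : σ → S} (hx : HasEval x)
    (f : MvPowerSeries σ R) {ε : S →+* S} (hε : Continuous ε) {t : R →+* R}
    (ht : ∀ a, ε (algebraMap R S a) = algebraMap R S (t a)) :
    ε (evalAt x f) = evalAt (fun i => ε (x i)) (MvPowerSeries.map t f) := by
  let : UniformSpace R := ⊥
  rw [evalAt_eq_eval₂ hx]
  have h := congrFun (comp_eval₂ (φ := algebraMap R S) continuous_of_discreteTopology hx hε) f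
  have h2 : ε.comp (algebraMap R S) = (algebraMap R S).comp t := RingHom.ext ht
  rw [h2] at h
  refine h.trans ((eval₂_eq_tsum continuous_of_discreteTopology (hx.map hε) f).trans ?_)
  simp only [evalAt, coeff_map]
  rfl

variable {r : ℕ}

theorem evalAt_tupleComp {σ τ ι : Type*} [Finite σ] {θ : ι → MvPowerSeries σ R}
    {η : σ → MvPowerSeries τ R} (hη : ∀ i, constantCoeff (η i) = 0) {x : τ → S} (hx : HasEval x)
    (i : ι) : evalAt x (tupleComp θ η i) = evalAt (fun j => evalAt x (η j)) (θ i) :=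
  evalAt_subst (hasSubst_of_constantCoeff_zero hη) hx
    (hasEval_of_finite fun j => isTopologicallyNilpotent_evalAt hx (hη j)) _

namespace FormalGroupLaw

variable {R₀ : Type*} [CommRing R₀] [Algebra R₀ R] {F : FormalGroupLaw r R₀}

namespace Iso

variable (θ : (F.map (algebraMap R₀ R)).Iso (multiplicative r R))

theorem evalAt_inv_hom (x : F.Points S) (i : Fin r) :
    evalAt (fun j => evalAt x.val (θ.hom j)) (θ.inv i) = x.val i := by
  have hx := hasEval_of_finite x.topNilp
  rw [← evalAt_tupleComp θ.isHom_hom.1 hx, θ.inv_comp_hom, evalAt_X hx]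

theorem unitsAt_injective : Function.Injective (θ.unitsAt (S := S)) := fun x y h => by
  have h1 : (fun j => evalAt x.val (θ.hom j)) = fun j => evalAt y.val (θ.hom j) :=
    funext fun j => add_left_cancel (congrFun h j)
  refine Points.ext (funext fun i => ?_)
  rw [← θ.evalAt_inv_hom x, ← θ.evalAt_inv_hom y, h1]

theorem exists_unitsAt_eq {y : Fin r → S} (hy : ∀ i, IsTopologicallyNilpotent (y i - 1)) :
    ∃ x : F.Points S, θ.unitsAt x = y := by
  have hy' := hasEval_of_finite hy
  refine ⟨⟨fun i => evalAt (fun j => y j - 1) (θ.inv i), fun i =>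
    isTopologicallyNilpotent_evalAt hy' (θ.isHom_inv.1 i)⟩, funext fun i => ?_⟩
  rw [unitsAt, ← evalAt_tupleComp θ.isHom_inv.1 hy', θ.hom_comp_inv, evalAt_X hy',
    add_sub_cancel]

variable [Algebra R₀ S] [IsScalarTower R₀ R S]

/-- In the coordinate `1 + X` the law of `𝔾_m` is multiplication, so the group of points becomes a
group of tuples of principal units. -/
theorem unitsAt_add (x y : F.Points S) : θ.unitsAt (x + y) = θ.unitsAt x * θ.unitsAt y := by
  funext i
  have hxy := Points.hasEval_elim x y
  obtain ⟨ε, hε⟩ := exists_ringHom_eq_evalAt (R := R) hxy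
  have hl : ∀ j : Fin r, constantCoeff (X (Sum.inl j) : MvPowerSeries (Fin r ⊕ Fin r) R) = 0 := by
    simp
  have hr : ∀ j : Fin r, constantCoeff (X (Sum.inr j) : MvPowerSeries (Fin r ⊕ Fin r) R) = 0 := by
    simp
  have h1 : evalAt (x + y).val (θ.hom i) =
      evalAt (Sum.elim x.val y.val) (tupleComp θ.hom (F.map (algebraMap R₀ R)).toSeries i) := by
    rw [evalAt_tupleComp (F.map (algebraMap R₀ R)).constantCoeff_eq_zero hxy]
    congr 1
    funext j
    exact (evalAt_map (fun a => (IsScalarTower.algebraMap_apply R₀ R S a).symm) _ _).symm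
  have h2 : evalAt (Sum.elim x.val y.val) (tupleComp θ.hom (fun j => X (Sum.inl j)) i) =
      evalAt x.val (θ.hom i) := by
    rw [evalAt_tupleComp hl hxy]
    simp only [evalAt_X hxy]
    rfl
  have h3 : evalAt (Sum.elim x.val y.val) (tupleComp θ.hom (fun j => X (Sum.inr j)) i) =
      evalAt y.val (θ.hom i) := by
    rw [evalAt_tupleComp hr hxy]
    simp only [evalAt_X hxy]
    rfl
  rw [Pi.mul_apply, unitsAt, unitsAt, unitsAt, h1, θ.isHom_hom.2, tupleComp_multiplicative
    (constantCoeff_tupleComp θ.isHom_hom.1 hl) (constantCoeff_tupleComp θ.isHom_hom.1 hr), ← hε,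
    map_add, map_add, map_mul, hε, hε, h2, h3]
  ring

theorem unitsAt_nsmul (n : ℕ) (x : F.Points S) : θ.unitsAt (n • x) = θ.unitsAt x ^ n := by
  induction n with
  | zero => rw [zero_nsmul, unitsAt_zero, pow_zero]
  | succ n ih => rw [succ_nsmul, unitsAt_add, ih, pow_succ]

end Iso

end FormalGroupLaw

end EvalAt

/-! ### Roots of unity and their powers with exponent in `ℤ_p` -/

section RootsOfUnity

variable {p : ℕ} [hp : Fact p.Prime] {r : ℕ} {S : Type*} [CommRing S] [UniformSpace S]
  [Algebra ℤ_[p] S] [IsUniformAddGroup S] [CompleteSpace S] [T2Space S] [IsTopologicalRing S]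
  [IsLinearTopology S S]

theorem PadicInt.exists_eq_val_add (a : ℤ_[p]) (n : ℕ) :
    ∃ b : ℤ_[p], a = (a.toZModPow n).val + (p : ℤ_[p]) ^ n * b := by
  have h : a - ((a.toZModPow n).val : ℤ_[p]) ∈ RingHom.ker (PadicInt.toZModPow (p := p) n) := by
    rw [RingHom.mem_ker, map_sub, map_natCast, TateModule.val_cast, sub_self]
  rw [PadicInt.ker_toZModPow, Ideal.mem_span_singleton] at h
  obtain ⟨b, hb⟩ := h
  exact ⟨b, by rw [← hb]; ring⟩

/-- The value of an endomorphism of the multiplicative group at a tuple of roots of unity. -/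
theorem evalAt_multiplicativeEnd {n : ℕ} {y : Fin r → S}
    (hy : ∀ i, IsTopologicallyNilpotent (y i)) (hyn : ∀ i, (1 + y i) ^ p ^ n = 1)
    (A : Matrix (Fin r) (Fin r) ℤ_[p]) (i : Fin r) :
    1 + evalAt y (multiplicativeEnd ℤ_[p] A i) =
      ∏ j, (1 + y j) ^ ((A i j).toZModPow n).val := by
  have hy' := hasEval_of_finite hy
  obtain ⟨ε, hε⟩ := exists_ringHom_eq_evalAt (R := ℤ_[p]) hy'
  choose B hB using fun i j => PadicInt.exists_eq_val_add (A i j) n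
  have h1 : ∀ M : Matrix (Fin r) (Fin r) ℤ_[p], 1 + evalAt y (multiplicativeEnd ℤ_[p] M i) =
      ∏ j, ε (padicPow (1 + X j) (M i j)) := fun M => by
    rw [← map_prod, ← one_add_multiplicativeEnd, map_add, map_one, hε]
  -- The part of the exponents divisible by `p ^ n` contributes the endomorphism of `B` evaluated at
  -- `(1 + y) ^ (p ^ n) - 1 = 0`, hence nothing.
  have h2 : ∏ j, ε (padicPow (1 + X j) ((p : ℤ_[p]) ^ n * B i j)) = 1 := by
    have h3 := h1 (Matrix.of B * (((p ^ n : ℕ) : ℤ_[p]) • (1 : Matrix (Fin r) (Fin r) ℤ_[p])))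
    rw [← multiplicativeEnd_mul, evalAt_tupleComp (constantCoeff_multiplicativeEnd _) hy',
      multiplicativeEnd_natCast] at h3
    have h4 : (fun j : Fin r => evalAt y ((1 + X j) ^ p ^ n - 1 : MvPowerSeries (Fin r) ℤ_[p])) =
        0 := by
      funext j
      rw [← hε, map_sub, map_pow, map_add, map_one, hε, evalAt_X hy', hyn, sub_self]
      rfl
    rw [h4, evalAt_zero_of_constantCoeff (constantCoeff_multiplicativeEnd _ i), add_zero] at h3
    rw [h3]
    refine Finset.prod_congr rfl fun j _ => ?_
    congr 2
    simp
  rw [h1]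
  refine Eq.trans ?_ ((congrArg _ h2).trans (mul_one _))
  rw [← Finset.prod_mul_distrib]
  refine Finset.prod_congr rfl fun j _ => ?_
  conv_lhs => rw [hB i j]
  rw [padicPow_add (constantCoeff_one_add_X j), padicPow_natCast (constantCoeff_one_add_X j),
    map_mul, map_pow, map_add, map_one, hε (X j), evalAt_X hy']

end RootsOfUnity

theorem exists_compatible_primitiveRoots (L : Type*) [Field L] (p : ℕ) [hp : Fact p.Prime]
    [∀ n, HasEnoughRootsOfUnity L (p ^ n)] :
    ∃ z : ℕ → L, (∀ n, IsPrimitiveRoot (z n) (p ^ n)) ∧ ∀ n, z (n + 1) ^ p = z n := by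
  have hpos : ∀ n, 0 < p ^ n := fun n => pow_pos hp.out.pos n
  have step : ∀ n (z : L), IsPrimitiveRoot z (p ^ n) →
      ∃ w, IsPrimitiveRoot w (p ^ (n + 1)) ∧ w ^ p = z := fun n z hz => by
    obtain ⟨t, ht⟩ := HasEnoughRootsOfUnity.exists_primitiveRoot L (p ^ (n + 1))
    have htp : IsPrimitiveRoot (t ^ p) (p ^ n) := ht.pow (hpos _) (pow_succ' p n)
    have : NeZero (p ^ n) := ⟨(hpos n).ne'⟩
    obtain ⟨k, hk, rfl⟩ := htp.eq_pow_of_pow_eq_one hz.pow_eq_one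
    -- Here `z` is the `k`-th power of `t ^ p`. For positive level `k` is prime to `p`, so `t ^ k`
    -- remains primitive. At level zero `k` need not be, but then `z = 1` and `t` itself works.
    rcases n with _ | n
    · have h1 : t ^ p = 1 := by simpa using htp.pow_eq_one
      exact ⟨t, ht, by rw [h1, one_pow]⟩
    · have hk' : k.Coprime (p ^ (n + 1)) := (htp.pow_iff_coprime (hpos _) k).mp hz
      refine ⟨t ^ k, ht.pow_of_coprime k (Nat.Coprime.pow_right _ ?_), ?_⟩
      · exact hk'.coprime_dvd_right (dvd_pow_self p n.succ_ne_zero)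
      · rw [← pow_mul, ← pow_mul, mul_comm]
  choose! f hf hfp using step
  let z : ℕ → L := fun n => Nat.rec 1 (fun n z => f n z) n
  have hz : ∀ n, IsPrimitiveRoot (z n) (p ^ n) := fun n => by
    induction n with
    | zero => simp [z]
    | succ n ih => exact hf n _ ih
  exact ⟨z, hz, fun n => hfp n _ (hz n)⟩

section PadicPowers

variable {p : ℕ} [hp : Fact p.Prime] {S : Type*} [CommRing S]

/-- The power `ζ_n ^ a` with exponent in `ℤ_p`, for a system of `p`-power roots of unity. -/
noncomputable def rootPow (ζ : ℕ → S) (a : ℤ_[p]) (n : ℕ) : S :=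
  ζ n ^ (a.toZModPow n).val

variable {ζ : ℕ → S} {n : ℕ}

theorem pow_eq_rootPow (hζ : ζ n ^ p ^ n = 1) {a : ℤ_[p]} {k : ℕ}
    (h : (k : ZMod (p ^ n)) = a.toZModPow n) : ζ n ^ k = rootPow ζ a n := by
  refine pow_eq_pow_of_modEq ?_ hζ
  rw [← ZMod.natCast_eq_natCast_iff, h, TateModule.val_cast]

theorem rootPow_zero (hζ : ζ n ^ p ^ n = 1) : rootPow ζ (0 : ℤ_[p]) n = 1 := by
  rw [← pow_eq_rootPow hζ (k := 0) (by simp), pow_zero]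

theorem rootPow_add (hζ : ζ n ^ p ^ n = 1) (a b : ℤ_[p]) :
    rootPow ζ (a + b) n = rootPow ζ a n * rootPow ζ b n := by
  rw [rootPow, rootPow, rootPow, ← pow_add]
  exact (pow_eq_rootPow hζ (by simp only [Nat.cast_add, TateModule.val_cast, map_add])).symm

theorem rootPow_mul (hζ : ζ n ^ p ^ n = 1) (a b : ℤ_[p]) :
    rootPow ζ (a * b) n = rootPow ζ b n ^ (a.toZModPow n).val := by
  rw [rootPow, rootPow, ← pow_mul]
  exact (pow_eq_rootPow hζ
    (by rw [Nat.cast_mul, TateModule.val_cast, TateModule.val_cast, map_mul, mul_comm])).symm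

theorem rootPow_sum (hζ : ζ n ^ p ^ n = 1) {ι : Type*} (s : Finset ι) (a : ι → ℤ_[p]) :
    rootPow ζ (∑ i ∈ s, a i) n = ∏ i ∈ s, rootPow ζ (a i) n := by
  classical
  induction s using Finset.induction_on with
  | empty => exact rootPow_zero hζ
  | insert i s hi ih => rw [Finset.sum_insert hi, Finset.prod_insert hi, rootPow_add hζ, ih]

theorem rootPow_pow_pow (hζ : ζ n ^ p ^ n = 1) (a : ℤ_[p]) : rootPow ζ a n ^ p ^ n = 1 := by
  rw [rootPow, ← pow_mul, mul_comm, pow_mul, hζ, one_pow]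

theorem rootPow_succ_pow (hζ : ζ n ^ p ^ n = 1) (hζp : ζ (n + 1) ^ p = ζ n) (a : ℤ_[p]) :
    rootPow ζ a (n + 1) ^ p = rootPow ζ a n := by
  have : NeZero (p ^ (n + 1)) := ⟨pow_ne_zero _ hp.out.ne_zero⟩
  rw [rootPow, ← pow_mul, mul_comm, pow_mul, hζp]
  refine pow_eq_rootPow hζ ?_
  rw [ZMod.natCast_val, PadicInt.cast_toZModPow _ _ n.le_succ]

theorem toZModPow_eq_zero_of_rootPow_eq_one (hζ : IsPrimitiveRoot (ζ n) (p ^ n)) {a : ℤ_[p]}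
    (h : rootPow ζ a n = 1) : a.toZModPow n = 0 := by
  rw [← TateModule.val_cast, ZMod.natCast_eq_zero_iff]
  exact hζ.dvd_of_pow_eq_one _ h

/-- At each level `y_n` is a power `ζ_n ^ k_n`. Compatibility gives `k_(n+1) ≡ k_n` modulo `p ^ n`,
so the exponents define a `p`-adic integer. -/
theorem exists_rootPow_eq [IsDomain S] (hζ : ∀ n, IsPrimitiveRoot (ζ n) (p ^ n))
    (hζp : ∀ n, ζ (n + 1) ^ p = ζ n) {y : ℕ → S} (hy : ∀ n, y (n + 1) ^ p = y n) (hy0 : y 0 = 1) :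
    ∃ a : ℤ_[p], ∀ n, y n = rootPow ζ a n := by
  have hyn : ∀ n, y n ^ p ^ n = 1 := fun n => by
    induction n with
    | zero => simpa using hy0
    | succ n ih => rw [pow_succ', pow_mul, hy, ih]
  have hk : ∀ n, ∃ k : ℕ, ζ n ^ k = y n := fun n => by
    have : NeZero (p ^ n) := ⟨pow_ne_zero _ hp.out.ne_zero⟩
    obtain ⟨k, -, hk⟩ := (hζ n).eq_pow_of_pow_eq_one (hyn n)
    exact ⟨k, hk⟩
  choose k hk using hk
  have hdvd : ∀ n, (p : ℤ) ^ n ∣ (k (n + 1) : ℤ) - k n := fun n => by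
    have h1 : ζ n ^ k (n + 1) = ζ n ^ k n := by
      rw [hk n, ← hy n, ← hk (n + 1), ← hζp n, ← pow_mul, ← pow_mul, mul_comm]
    have : NeZero (p ^ n) := ⟨pow_ne_zero _ hp.out.ne_zero⟩
    have hfin : IsOfFinOrder (ζ n) := isOfFinOrder_iff_pow_eq_one.mpr
      ⟨p ^ n, pow_pos hp.out.pos n, (hζ n).pow_eq_one⟩
    have h2 := hfin.pow_eq_pow_iff_modEq.mp h1
    rw [← (hζ n).eq_orderOf] at h2
    exact_mod_cast Nat.modEq_iff_dvd.mp h2.symm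
  refine ⟨PadicInt.ofIntSeq (fun n => (k n : ℤ))
    (PadicInt.isCauSeq_padicNorm_of_pow_dvd_sub (fun n => (k n : ℤ)) p hdvd), fun n => ?_⟩
  rw [← hk n]
  refine pow_eq_rootPow (hζ n).pow_eq_one ?_
  rw [PadicInt.toZModPow_ofIntSeq_of_pow_dvd_sub (fun n => (k n : ℤ)) p hdvd n]
  simp

end PadicPowers

theorem PadicInt.isLocallyConstant_toZModPow (p : ℕ) [Fact p.Prime] (n : ℕ) :
    IsLocallyConstant (PadicInt.toZModPow (p := p) n) := by
  rw [IsLocallyConstant.iff_eventually_eq]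
  intro x
  have hpos : (0 : ℝ) < (p : ℝ) ^ (-n : ℤ) :=
    zpow_pos (Nat.cast_pos.mpr (Fact.out : p.Prime).pos) _
  filter_upwards [Metric.ball_mem_nhds x hpos] with y hy
  rw [Metric.mem_ball, dist_eq_norm] at hy
  rw [← sub_eq_zero, ← map_sub, ← RingHom.mem_ker, PadicInt.ker_toZModPow,
    ← PadicInt.norm_le_pow_iff_mem_span_pow]
  exact hy.le

/-! ### The Tate module as a free `ℤ_p`-module -/

namespace FormalGroupLaw.Iso

variable {p : ℕ} [hp : Fact p.Prime] {r : ℕ} {R S : Type*} [CommRing R] [CommRing S]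
  [UniformSpace S] [Algebra R S] [IsUniformAddGroup S] [CompleteSpace S] [T2Space S]
  [IsTopologicalRing S] [IsLinearTopology S S] {R₀ : Type*} [CommRing R₀] [Algebra R₀ R]
  [Algebra R₀ S] [IsScalarTower R₀ R S] {F : FormalGroupLaw r R₀}

/-- Through `x ↦ 1 + θ(x)` an element of the Tate module is an `r`-tuple of compatible systems of
`p`-power roots of unity, and each such system is `ζ ^ a` for a unique `p`-adic integer `a`. The
hypothesis `hnil` ensures that all these systems come from points. -/
theorem exists_tateModule_equiv [IsDomain S]
    (θ : (F.map (algebraMap R₀ R)).Iso (multiplicative r R)) {ζ : ℕ → S}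
    (hζ : ∀ n, IsPrimitiveRoot (ζ n) (p ^ n)) (hζp : ∀ n, ζ (n + 1) ^ p = ζ n)
    (hnil : ∀ n (t : S), t ^ p ^ n = 1 → IsTopologicallyNilpotent (t - 1)) :
    ∃ e : (Fin r → ℤ_[p]) ≃ₗ[ℤ_[p]] TateModule p (F.Points S),
      ∀ a n, θ.unitsAt ((e a).val n) = fun i => rootPow ζ (a i) n := by
  have h1 : ∀ n, ζ n ^ p ^ n = 1 := fun n => (hζ n).pow_eq_one
  have hex : ∀ (a : Fin r → ℤ_[p]) n, ∃ x : F.Points S,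
      θ.unitsAt x = fun i => rootPow ζ (a i) n := fun a n =>
    θ.exists_unitsAt_eq fun i => hnil n _ (rootPow_pow_pow (h1 n) _)
  choose x hx using hex
  have hx0 : ∀ a, x a 0 = 0 := fun a => θ.unitsAt_injective <| by
    rw [hx, unitsAt_zero]
    funext i
    have h2 := rootPow_pow_pow (h1 0) (a i)
    rwa [pow_zero, pow_one] at h2
  have hxs : ∀ a n, p • x a (n + 1) = x a n := fun a n => θ.unitsAt_injective <| by
    rw [unitsAt_nsmul, hx, hx]
    exact funext fun i => rootPow_succ_pow (h1 n) (hζp n) (a i)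
  let e : (Fin r → ℤ_[p]) →ₗ[ℤ_[p]] TateModule p (F.Points S) :=
    { toFun := fun a => ⟨x a, hx0 a, hxs a⟩
      map_add' := fun a b => TateModule.ext fun n => θ.unitsAt_injective <| by
        rw [TateModule.add_apply, unitsAt_add, hx, hx, hx]
        exact funext fun i => rootPow_add (h1 n) _ _
      map_smul' := fun c a => TateModule.ext fun n => θ.unitsAt_injective <| by
        rw [RingHom.id_apply, TateModule.smul_apply, unitsAt_nsmul, hx, hx]
        exact funext fun i => rootPow_mul (h1 n) _ _ }
  have hinj : Function.Injective e := by
    rw [injective_iff_map_eq_zero]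
    intro a ha
    funext i
    refine PadicInt.ext_of_toZModPow.mp fun n => ?_
    rw [Pi.zero_apply, map_zero]
    refine toZModPow_eq_zero_of_rootPow_eq_one (hζ n) ?_
    have h2 : x a n = 0 := congrArg (fun z : TateModule p (F.Points S) => z.val n) ha
    have h3 := hx a n
    rw [h2, unitsAt_zero] at h3
    exact (congrFun h3 i).symm
  have hsurj : Function.Surjective e := fun z => by
    have h2 : ∀ i, ∃ a : ℤ_[p], ∀ n, θ.unitsAt (z.val n) i = rootPow ζ a n := fun i =>
      exists_rootPow_eq hζ hζp
        (fun n => by rw [← z.nsmul_succ n, unitsAt_nsmul, Pi.pow_apply])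
        (by rw [z.val_zero, unitsAt_zero, Pi.one_apply])
    choose a ha using h2
    refine ⟨a, TateModule.ext fun n => θ.unitsAt_injective ?_⟩
    exact (hx a n).trans (funext fun i => (ha i n).symm)
  exact ⟨LinearEquiv.ofBijective e ⟨hinj, hsurj⟩, hx⟩

end FormalGroupLaw.Iso

/-! ### A cyclotomic system in the ring of integers of `ℂ_p` -/

namespace PadicComplexInt

variable {p : ℕ} [Fact p.Prime]

theorem isTopologicallyNilpotent_of_norm_lt_one {x : 𝓞_ℂ_[p]} (hx : ‖(x : ℂ_[p])‖ < 1) :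
    IsTopologicallyNilpotent x := by
  rw [IsTopologicallyNilpotent, tendsto_subtype_rng]
  simpa using tendsto_pow_atTop_nhds_zero_of_norm_lt_one hx

/-- In the residue field, of characteristic `p`, one has `(t - 1) ^ (p ^ n) = t ^ (p ^ n) - 1 = 0`.
-/
theorem isTopologicallyNilpotent_sub_one {n : ℕ} {t : 𝓞_ℂ_[p]} (ht : t ^ p ^ n = 1) :
    IsTopologicallyNilpotent (t - 1) := by
  refine isTopologicallyNilpotent_of_norm_lt_one (residue_eq_zero_iff.mp ?_)
  have h := congrArg (IsLocalRing.residue 𝓞_ℂ_[p]) ht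
  rw [map_pow, map_one] at h
  refine eq_zero_of_pow_eq_zero (n := p ^ n) ?_
  rw [map_sub, map_one, sub_pow_char_pow, h, one_pow, sub_self]

theorem exists_zeta (p : ℕ) [Fact p.Prime] : ∃ ζ : ℕ → 𝓞_ℂ_[p],
    (∀ n, IsPrimitiveRoot (ζ n) (p ^ n)) ∧ (∀ n, ζ (n + 1) ^ p = ζ n) ∧
      ∀ (g : GQp p) n, g.actOCp (ζ n) = rootPow ζ (cycChar p g : ℤ_[p]) n := by
  obtain ⟨z, hz, hzp⟩ := exists_compatible_primitiveRoots (PadicAlgCl p) p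
  have hnorm : ∀ n, ‖z n‖ ≤ 1 := fun n => by
    have h := congrArg norm (hz n).pow_eq_one
    rw [norm_pow, norm_one] at h
    exact ((pow_eq_one_iff_of_nonneg (norm_nonneg _)
      (pow_ne_zero _ (Fact.out : p.Prime).ne_zero)).mp h).le
  have hcoe : ∀ n k, ((z n : PadicAlgCl p) : ℂ_[p]) ^ k = ((z n ^ k : PadicAlgCl p) : ℂ_[p]) :=
    fun n k => (map_pow (algebraMap (PadicAlgCl p) ℂ_[p]) (z n) k).symm
  refine ⟨fun n => PadicAlgCl.toOCp (z n) (hnorm n), fun n => ?_, fun n => ?_, fun g n => ?_⟩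
  · refine IsPrimitiveRoot.of_map_of_injective (f := 𝓞_ℂ_[p].subtype) ?_ Subtype.val_injective
    exact (hz n).map_of_injective (algebraMap (PadicAlgCl p) ℂ_[p]).injective
  · refine Subtype.ext ((hcoe (n + 1) p).trans ?_)
    rw [hzp]
    rfl
  · refine Subtype.ext ((g.actCp_coe (z n)).trans (Eq.trans ?_ (hcoe n _).symm))
    exact congrArg _ (cyclotomicCharacter.spec p
      (MulSemiringAction.toRingAut (GQp p) (PadicAlgCl p) g) (z n) (hz n).pow_eq_one)

end PadicComplexInt

instance {p : ℕ} [Fact p.Prime] : IsScalarTower ℤ_[p] (ZpnrHat p) 𝓞_ℂ_[p] :=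
  IsScalarTower.of_algebraMap_eq fun _ => rfl

/-! ### Galois equivariance -/

section Equivariance

variable {p : ℕ} [Fact p.Prime] {r : ℕ} {F : FormalGroupLaw r ℤ_[p]}
  (θ : (F.map (algebraMap ℤ_[p] (ZpnrHat p))).Iso (FormalGroupLaw.multiplicative r (ZpnrHat p)))

theorem GQp.actOCp_unitsAt (g : GQp p) (x : F.Points 𝓞_ℂ_[p]) (i : Fin r) :
    g.actOCp (θ.unitsAt x i) = 1 + evalAt (fun j => g.actOCp (x.val j))
      (MvPowerSeries.map g.actZpnrHat (θ.hom i)) := by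
  rw [FormalGroupLaw.Iso.unitsAt, map_add, map_one, map_evalAt_of_semilinear
    (hasEval_of_finite x.topNilp) _ g.continuous_actOCp (t := g.actZpnrHat) fun _ => rfl]

theorem cycTwist_apply (ρ : GQp p →* GL (Fin r) ℤ_[p]) (g : GQp p) (a : Fin r → ℤ_[p]) :
    cycTwist ρ g a = (cycChar p g : ℤ_[p]) • (ρ g).val.mulVec a := rfl

variable {ζ : ℕ → 𝓞_ℂ_[p]} {φ : GQp p} {u : GL (Fin r) ℤ_[p]} {ρ : GQp p →* GL (Fin r) ℤ_[p]}

theorem GQp.actOCp_rootPow (hζ : ∀ n, ζ n ^ p ^ n = 1)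
    (hg : ∀ (g : GQp p) n, g.actOCp (ζ n) = rootPow ζ (cycChar p g : ℤ_[p]) n) (g : GQp p)
    (b : ℤ_[p]) (n : ℕ) :
    g.actOCp (rootPow ζ b n) = rootPow ζ ((cycChar p g : ℤ_[p]) * b) n := by
  rw [mul_comm, rootPow_mul (hζ n), ← hg, ← map_pow]
  rfl

/-- The coefficients of `θ` lie in `W`, which inertia fixes, so only the cyclotomic action remains.
-/
theorem unitsAt_of_mem_inertia (hζ : ∀ n, ζ n ^ p ^ n = 1)
    (hg : ∀ (g : GQp p) n, g.actOCp (ζ n) = rootPow ζ (cycChar p g : ℤ_[p]) n)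
    {g : GQp p} (hgI : g ∈ inertia p) {a : Fin r → ℤ_[p]} {n : ℕ} {x y : F.Points 𝓞_ℂ_[p]}
    (hx : θ.unitsAt x = fun i => rootPow ζ (a i) n) (hy : ∀ i, y.val i = g.actOCp (x.val i))
    (i : Fin r) : θ.unitsAt y i = rootPow ζ ((cycChar p g : ℤ_[p]) * a i) n := by
  have h1 : MvPowerSeries.map g.actZpnrHat (θ.hom i) = θ.hom i :=
    MvPowerSeries.ext fun e => by rw [coeff_map, GQp.actZpnrHat_of_mem_inertia hgI]
  have h2 := g.actOCp_unitsAt θ x i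
  rw [h1, hx] at h2
  rw [FormalGroupLaw.Iso.unitsAt, funext hy, ← h2, GQp.actOCp_rootPow hζ hg]

/-- Applying `φ` to `1 + θ(x) = ζ ^ a` turns `θ(x)` into `θ^φ(y)`, and `θ^φ` is the endomorphism of
`u⁻¹` composed with `θ`. Hence that endomorphism maps `θ(y)` to `ζ ^ (χ(φ) a) - 1`, with `χ` the
cyclotomic character. Applying the endomorphism of `u` recovers `θ(y)` and replaces the exponent by
`χ(φ) u a`. -/
theorem unitsAt_of_frobenius (hζ : ∀ n, ζ n ^ p ^ n = 1)
    (hg : ∀ (g : GQp p) n, g.actOCp (ζ n) = rootPow ζ (cycChar p g : ℤ_[p]) n)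
    (hθ : tupleComp (fun i => MvPowerSeries.map φ.actZpnrHat (θ.hom i)) θ.inv =
      multiplicativeEnd (ZpnrHat p) (u⁻¹).val)
    {a : Fin r → ℤ_[p]} {n : ℕ} {x y : F.Points 𝓞_ℂ_[p]}
    (hx : θ.unitsAt x = fun i => rootPow ζ (a i) n) (hy : ∀ i, y.val i = φ.actOCp (x.val i))
    (i : Fin r) :
    θ.unitsAt y i = rootPow ζ ((cycChar p φ : ℤ_[p]) * (u.val.mulVec a) i) n := by
  have hinv := hasSubst_of_constantCoeff_zero θ.isHom_inv.1
  have hhom := hasSubst_of_constantCoeff_zero θ.isHom_hom.1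
  have hθ' : (fun i => MvPowerSeries.map φ.actZpnrHat (θ.hom i)) =
      tupleComp (multiplicativeEnd (ZpnrHat p) (u⁻¹).val) θ.hom := by
    rw [← hθ, tupleComp_assoc hinv hhom, θ.inv_comp_hom, tupleComp_X]
  have hyev := hasEval_of_finite y.topNilp
  let Y : Fin r → 𝓞_ℂ_[p] := fun j => evalAt y.val (θ.hom j)
  have hY : ∀ j, IsTopologicallyNilpotent (Y j) := fun j =>
    isTopologicallyNilpotent_evalAt hyev (θ.isHom_hom.1 j)
  have hmap : ∀ (A : Matrix (Fin r) (Fin r) ℤ_[p]) (w : Fin r → 𝓞_ℂ_[p]) j,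
      evalAt w (multiplicativeEnd (ZpnrHat p) A j) = evalAt w (multiplicativeEnd ℤ_[p] A j) :=
    fun A w j => by
      rw [multiplicativeEnd_eq_map (S := ZpnrHat p)]
      exact evalAt_map (fun _ => rfl) _ _
  have hw : ∀ j, evalAt Y (multiplicativeEnd ℤ_[p] (u⁻¹).val j) =
      rootPow ζ ((cycChar p φ : ℤ_[p]) * a j) n - 1 := fun j => by
    have h2 := φ.actOCp_unitsAt θ x j
    rw [hx, ← funext hy, congrFun hθ' j, evalAt_tupleComp θ.isHom_hom.1 hyev, hmap] at h2
    rw [eq_sub_iff_add_eq', ← h2, GQp.actOCp_rootPow hζ hg]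
  have h3 := evalAt_tupleComp (θ := multiplicativeEnd ℤ_[p] u.val)
    (constantCoeff_multiplicativeEnd (u⁻¹).val) (hasEval_of_finite hY) i
  rw [multiplicativeEnd_mul, Units.mul_inv, multiplicativeEnd_one,
    evalAt_X (hasEval_of_finite hY), funext hw] at h3
  have h4 : θ.unitsAt y i = 1 + Y i := rfl
  have hroot : ∀ j, rootPow ζ ((cycChar p φ : ℤ_[p]) * a j) n ^ p ^ n = 1 := fun j =>
    rootPow_pow_pow (hζ n) _
  rw [h4, h3, evalAt_multiplicativeEnd (n := n)
    (fun j => PadicComplexInt.isTopologicallyNilpotent_sub_one (hroot j))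
    (fun j => by rw [add_sub_cancel, hroot])]
  simp only [add_sub_cancel]
  rw [Matrix.mulVec, dotProduct, Finset.mul_sum, rootPow_sum (hζ n)]
  refine Finset.prod_congr rfl fun j _ => ?_
  rw [mul_left_comm, rootPow_mul (hζ n) (u.val i j)]

theorem tateRep_val (g : GQp p) (z : TateModule p (F.Points 𝓞_ℂ_[p])) (n : ℕ) (i : Fin r) :
    ((tateRep F g z).val n).val i = g.actOCp ((z.val n).val i) := rfl

theorem continuous_cycTwist (hρ : Continuous ρ) (a : Fin r → ℤ_[p]) (i : Fin r) :
    Continuous fun g => cycTwist ρ g a i := by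
  have hχ : Continuous fun g => (cycChar p g : ℤ_[p]) :=
    Units.continuous_val.comp (cyclotomicCharacter.continuous p ℚ_[p] (PadicAlgCl p))
  have hρ' : Continuous fun g => (ρ g).val := Units.continuous_val.comp hρ
  change Continuous fun g => (cycChar p g : ℤ_[p]) * ∑ j, (ρ g).val i j * a j
  exact hχ.mul (continuous_finsetSum _ fun j _ =>
    (hρ'.matrix_elem i j).mul continuous_const)

/-- The isomorphism of Tate modules given by `θ` is Galois equivariant. -/
theorem cycTwist_equivariant (hφ : IsGeometricFrobenius φ) (hρ : IsUnramifiedRep φ u ρ)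
    (hζ : ∀ n, ζ n ^ p ^ n = 1)
    (hg : ∀ (g : GQp p) n, g.actOCp (ζ n) = rootPow ζ (cycChar p g : ℤ_[p]) n)
    (hθ : tupleComp (fun i => MvPowerSeries.map φ.actZpnrHat (θ.hom i)) θ.inv =
      multiplicativeEnd (ZpnrHat p) (u⁻¹).val)
    (e : (Fin r → ℤ_[p]) ≃ₗ[ℤ_[p]] TateModule p (F.Points 𝓞_ℂ_[p]))
    (he : ∀ a n, θ.unitsAt ((e a).val n) = fun i => rootPow ζ (a i) n) (g : GQp p)
    (a : Fin r → ℤ_[p]) : e (cycTwist ρ g a) = tateRep F g (e a) := by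
  -- Equivariance is a closed, multiplicative condition on the Galois element, so it suffices to
  -- verify it at `φ` and on inertia.
  let H : Subgroup (GQp p) :=
    { carrier := {g | ∀ a, e (cycTwist ρ g a) = tateRep F g (e a)}
      one_mem' := fun a => by simp only [map_one, Module.End.one_apply]
      mul_mem' := fun {g h} hg hh a => by
        simp only [map_mul, Module.End.mul_apply]
        rw [hg, hh]
      inv_mem' := fun {g} hg a => by
        have h1 := hg (cycTwist ρ g⁻¹ a)
        rw [← Module.End.mul_apply, ← map_mul, mul_inv_cancel, map_one, Module.End.one_apply] at h1
        rw [h1, ← Module.End.mul_apply, ← map_mul, inv_mul_cancel, map_one, Module.End.one_apply] }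
  -- At level `n` the left side depends only on the twisted vector modulo `p ^ n`, so it is locally
  -- constant in `g`; the right side is an orbit map in `ℂ_p`, hence continuous.
  have hclosed : IsClosed (H : Set (GQp p)) := by
    have h1 : (H : Set (GQp p)) = ⋂ (a : Fin r → ℤ_[p]) (n : ℕ) (i : Fin r),
        {g | (((e (cycTwist ρ g a)).val n).val i : ℂ_[p]) =
          g.actCp (((e a).val n).val i)} := by
      ext g
      simp only [Set.mem_iInter]
      constructor
      · intro h a n i
        exact congrArg (fun z : TateModule p (F.Points 𝓞_ℂ_[p]) => ((z.val n).val i : ℂ_[p])) (h a)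
      · intro h a
        exact TateModule.ext fun n => FormalGroupLaw.Points.ext <| funext fun i =>
          Subtype.ext (h a n i)
    rw [h1]
    refine isClosed_iInter fun a => isClosed_iInter fun n => isClosed_iInter fun i =>
      isClosed_eq ?_ (GQp.continuous_apply_actCp _)
    refine IsLocallyConstant.continuous ?_
    rw [IsLocallyConstant.iff_eventually_eq]
    intro g₀
    have h2 : ∀ᶠ g in nhds g₀, ∀ j, (cycTwist ρ g a j).toZModPow n =
        (cycTwist ρ g₀ a j).toZModPow n := Filter.eventually_all.mpr fun j =>
      ((IsLocallyConstant.iff_eventually_eq _).mp ((PadicInt.isLocallyConstant_toZModPow p n)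
        |>.comp_continuous (continuous_cycTwist hρ.continuous a j))) g₀
    filter_upwards [h2] with g hg'
    have h3 : (e (cycTwist ρ g a)).val n = (e (cycTwist ρ g₀ a)).val n := θ.unitsAt_injective <| by
      rw [he, he]
      exact funext fun j => by rw [rootPow, rootPow, hg']
    rw [h3]
  have hφH : φ ∈ H := fun a => TateModule.ext fun n => θ.unitsAt_injective <| by
    rw [he, cycTwist_apply, hρ.frobenius]
    exact funext fun i => (unitsAt_of_frobenius θ hζ hg hθ (he a n) (tateRep_val φ (e a) n) i).symm
  have hI : inertia p ≤ H := fun g hgI a => TateModule.ext fun n => θ.unitsAt_injective <| by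
    rw [he, cycTwist_apply, hρ.unramified g hgI]
    refine funext fun i => Eq.trans ?_
      (unitsAt_of_mem_inertia θ hζ hg hgI (he a n) (tateRep_val g (e a) n) i).symm
    simp
  have htop := GQp.eq_top_of_isClosed hφ hclosed (H.inv_mem hφH) hI
  exact (htop ▸ Subgroup.mem_top g : g ∈ H) a

end Equivariance

/-! ### The main theorem -/

theorem mainTheorem7 (p : ℕ) [Fact p.Prime] (r : ℕ) (u : GL (Fin r) ℤ_[p])
    (φ : GQp p) (hφ : IsGeometricFrobenius φ) :
    -- the Lubin–Tate formal group and the unramified representation exist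
    (∃ F : FormalGroupLaw r ℤ_[p],
      IsLubinTate ((p : ℤ_[p]) • (u⁻¹ : GL (Fin r) ℤ_[p]).val) F) ∧
    (∃ ρ : GQp p →* GL (Fin r) ℤ_[p], IsUnramifiedRep φ u ρ) ∧
    ∀ F : FormalGroupLaw r ℤ_[p],
      IsLubinTate ((p : ℤ_[p]) • (u⁻¹ : GL (Fin r) ℤ_[p]).val) F →
      -- the formal isomorphism `θ` with `θ^φ ∘ θ⁻¹ = u⁻¹`
      (∃ (ε : GL (Fin r) (ZpnrHat p))
        (θ : (F.map (algebraMap ℤ_[p] (ZpnrHat p))).Iso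
          (FormalGroupLaw.multiplicative r (ZpnrHat p))),
        Matrix.GeneralLinearGroup.map φ.actZpnrHat ε⁻¹ * ε =
          Matrix.GeneralLinearGroup.map (algebraMap ℤ_[p] (ZpnrHat p)) u⁻¹ ∧
        (∀ i j, MvPowerSeries.coeff (Finsupp.single j 1) (θ.hom i) =
          (ε⁻¹ : GL (Fin r) (ZpnrHat p)).val i j) ∧
        MvPowerSeries.tupleComp (fun i => MvPowerSeries.map φ.actZpnrHat (θ.hom i)) θ.inv =
          multiplicativeEnd (ZpnrHat p) (u⁻¹ : GL (Fin r) ℤ_[p]).val) ∧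
      -- every such `θ` induces an isomorphism of representations `ℤ_p^r(1)(ρ) ≅ T_p F`
      ∀ θ : (F.map (algebraMap ℤ_[p] (ZpnrHat p))).Iso
          (FormalGroupLaw.multiplicative r (ZpnrHat p)),
        MvPowerSeries.tupleComp (fun i => MvPowerSeries.map φ.actZpnrHat (θ.hom i)) θ.inv =
          multiplicativeEnd (ZpnrHat p) (u⁻¹ : GL (Fin r) ℤ_[p]).val →
        ∀ ρ : GQp p →* GL (Fin r) ℤ_[p], IsUnramifiedRep φ u ρ →
          ∃ ζ : ℕ → 𝓞_ℂ_[p], (∀ n, IsPrimitiveRoot (ζ n) (p ^ n)) ∧ (∀ n, ζ (n + 1) ^ p = ζ n) ∧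
            ∃ e : (cycTwist ρ).Equiv (tateRep F),
              ∀ (a : Fin r → ℤ_[p]) (n : ℕ) (i : Fin r),
                MvPowerSeries.evalAt ((e a).val n).val (θ.hom i) =
                  ζ n ^ ((a i).toZModPow n).val - 1 := by

  refine ⟨exists_isLubinTate u⁻¹, GQp.exists_isUnramifiedRep hφ u, fun F hF => ⟨?_, ?_⟩⟩
  · obtain ⟨ε, θ, h1, h2, h3⟩ := hF.exists_iso hφ
    exact ⟨ε, θ, h1, fun i j => congrFun (congrFun h2 i) j, h3⟩
  · intro θ hθ ρ hρ
    obtain ⟨ζ, hζ, hζp, hg⟩ := PadicComplexInt.exists_zeta p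
    obtain ⟨e, he⟩ := θ.exists_tateModule_equiv hζ hζp
      fun n t ht => PadicComplexInt.isTopologicallyNilpotent_sub_one ht
    refine ⟨ζ, hζ, hζp, Representation.Equiv.mk e fun g => LinearMap.ext fun a =>
      cycTwist_equivariant θ hφ hρ (fun n => (hζ n).pow_eq_one) hg hθ e he g a, fun a n i => ?_⟩
    exact eq_sub_of_add_eq' (congrFun (he a n) i)
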